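/- Let $\tau$ be the square root of the golden ratio, $s=1/\tau$, and let $G$ (the golden bee) be the closed hexagon with vertices $(0,0),(s,0),(s,s^2),(s^3,s^2),(s^3,1),(0,1)$. Put $f_1(x,y)=(s-sy,\;sx)$ and $f_2(x,y)=(s^2x,\;1-s^2y)$, so that $G=f_1(G)\cup f_2(G)$ without overlap. Isometric copies (reflections allowed) of $sG$ and $s^2G$ are called large and small tiles. Two sets, or two collections of tiles, are congruent if an isometry of the plane carries one to the other. *Ammann tilings.* The substitution rule enlarges a collection of tiles by the factor $\tau$ and cuts each enlarged large tile, a copy of $G$, into the copies of $f_1(G)$ (large) and $f_2(G)$ (small); an enlarged small tile becomes a large tile. The supertile $\mathcal T_n$ is obtained from the single tile $sG$ by $n$ substitutions. An Ammann tiling of the plane is a tiling of the plane by large and small tiles each finite part of which is congruent to a part of some $\mathcal T_n$. Some nested unions of congruent copies of supertiles of increasing levels fill only a half plane or a quadrant. In this theorem these are also called Ammann tilings, whereas the tilings of the plane obtained from them by reflection in the border line (half plane), respectively in the two border rays (quadrant), are not. *Codes.* In an Ammann tiling $T$ each small tile $a$ has a partner, the unique large tile $b\in T$ for which $a\cup b$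 is congruent to $G$; then $a$ is also called the partner of $b$. For $T'=h(T)$, with $h$ a homeomorphism of the plane, the large tiles, small tiles and partners in $T'$ are the images of those in $T$ (this depends only on $T'$), and $A(T')$ is the tiling obtained from $T'$ by replacing each small tile and its partner by their union; it is again a homeomorphic image of an Ammann tiling. For a large tile $t'$ of $T'$ define $\widetilde c(T',t')$ and $g(T',t')$ as follows. If $t'$ has a partner in $T'$, then $\widetilde c(T',t')=1$ and $g(T',t')=(A(T'),\widetilde t)$, where $\widetilde t$ is the union of $t'$ and its partner. If not, then $t'$ is a small tile of $A(T')$; put $\widetilde c(T',t')=2$ and $g(T',t')=(A^2(T'),\widetilde t)$, where $\widetilde t$ is the union of $t'$ and its partner in $A(T')$. The code $c(T',t')\in\{1,2\}^\infty$ is the sequence $\widetilde c(g^n(T',t'))$, $n=0,1,2,\dots$. *The tiling $T(\theta)$.* For a finite string $\sigma=\sigma_1\cdots\sigma_k$ over $\{1,2\}$ let $e(\sigma)=\sum_i\sigma_i$, $f_\sigma=f_{\sigma_1}\circ\cdots\circ f_{\sigma_k}$ and $f_{-\sigma}=f_{\sigma_1}^{-1}\circ\cdots\circ f_{\sigma_k}^{-1}$,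 and, if $k\ge 1$, let $\sigma_*=\sigma_k$. For $\theta\in\{1,2\}^\infty$ let $\theta|k=\theta_1\cdots\theta_k$, let $W(\theta,k)$ be the set of nonempty finite strings $\sigma$ with $\sigma_*>e(\sigma)-e(\theta|k)\ge 0$, and let $$T(\theta)=\bigcup_{k\ge 1}\bigl\{\,s\,(f_{-(\theta|k)}\circ f_\sigma)(G)\;:\;\sigma\in W(\theta,k)\,\bigr\}.$$ **Theorem.** Let $T'=h(T)$ be the image of an Ammann tiling $T$ under an arbitrary homeomorphism $h$ of the plane, let $t'$ be any large tile of $T'$, and let $\theta=c(T',t')$. Then $T(\theta)$ is congruent to $T$, whichever large tile $t'$ is chosen. -/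

import Mathlib

noncomputable section

namespace Ammann

open scoped Pointwise

/-! ### Tilings and congruence -/

/-- The Euclidean plane. -/
abbrev Plane : Type := EuclideanSpace ℝ (Fin 2)

/-- A collection of subsets of the plane (the tiles of a tiling, or of a patch). -/
abbrev TileSet : Type := Set (Set Plane)

/-- The image `f(T)` of a collection of tiles. -/
def mapTiles (f : Plane → Plane) (T : TileSet) : TileSet := (fun t => f '' t) '' T

/-- Two subsets of the plane are congruent: an isometry, possibly a reflection, carries one to
the other. -/
def CongruentSets (A B : Set Plane) : Prop := ∃ U : Plane ≃ᵢ Plane, U '' A = B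

/-- Two tilings (or patches) are congruent: `S = U(T)` for an isometry `U` of the plane. -/
def CongruentTilings (T S : TileSet) : Prop := ∃ U : Plane ≃ᵢ Plane, mapTiles U T = S

/-- A tiling of the region `D`: non-overlapping tiles with union `D`. -/
def IsTilingOf (T : TileSet) (D : Set Plane) : Prop :=
  (∀ t ∈ T, ∀ u ∈ T, t ≠ u → interior (t ∩ u) = ∅) ∧ ⋃₀ T = D

/-! ### The golden bee and its two maps -/

/-- `τ`, the square root of the golden ratio. -/
def tau : ℝ := √Real.goldenRatio

/-- `s = 1 / τ`. -/
def s : ℝ := tau⁻¹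

theorem tau_pos : 0 < tau := Real.sqrt_pos.mpr Real.goldenRatio_pos

theorem tau_mul_s : tau * s = 1 := mul_inv_cancel₀ tau_pos.ne'

/-- The golden bee `G`: the closed hexagon with vertices
`(0,0), (s,0), (s,s²), (s³,s²), (s³,1), (0,1)`. -/
def G : Set Plane :=
  {p | (0 ≤ p 0 ∧ p 0 ≤ s ∧ 0 ≤ p 1 ∧ p 1 ≤ s ^ 2) ∨
       (0 ≤ p 0 ∧ p 0 ≤ s ^ 3 ∧ 0 ≤ p 1 ∧ p 1 ≤ 1)}

/-- `f₁(x, y) = (s - s y, s x)`. -/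
def f₁ : Equiv.Perm Plane where
  toFun p := !₂[s - s * p 1, s * p 0]
  invFun p := !₂[tau * p 1, 1 - tau * p 0]
  left_inv p := by
    have h := tau_mul_s
    ext i; fin_cases i
    · simp; linear_combination p 0 * h
    · simp; linear_combination (p 1 - 1) * h
  right_inv p := by
    have h := tau_mul_s
    ext i; fin_cases i
    · simp; linear_combination p 0 * h
    · simp; linear_combination p 1 * h

/-- `f₂(x, y) = (s² x, 1 - s² y)`. -/
def f₂ : Equiv.Perm Plane where
  toFun p := !₂[s ^ 2 * p 0, 1 - s ^ 2 * p 1]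
  invFun p := !₂[tau ^ 2 * p 0, tau ^ 2 * (1 - p 1)]
  left_inv p := by
    have h : tau ^ 2 * s ^ 2 = 1 := by rw [← mul_pow, tau_mul_s, one_pow]
    ext i; fin_cases i
    · simp; linear_combination p 0 * h
    · simp; linear_combination p 1 * h
  right_inv p := by
    have h : tau ^ 2 * s ^ 2 = 1 := by rw [← mul_pow, tau_mul_s, one_pow]
    ext i; fin_cases i
    · simp; linear_combination p 0 * h
    · simp; linear_combination (p 1 - 1) * h

/-! ### Ammann tilings of the plane -/

/-- Large tiles are isometric copies of `sG`. -/
def IsLarge (t : Set Plane) : Prop := CongruentSets (s • G) t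

/-- Small tiles are isometric copies of `s²G`. -/
def IsSmall (t : Set Plane) : Prop := CongruentSets (s ^ 2 • G) t

/-- The substitution rule: enlarge by the factor `τ`; an enlarged small tile is a large tile, and
an enlarged large tile is a congruent copy of `G = f₁(G) ∪ f₂(G)` and is cut accordingly into a
large and a small tile. -/
def substitute (T : TileSet) : TileSet :=
  {t | ∃ u ∈ T, IsSmall u ∧ t = tau • u} ∪
  {t | ∃ U : Plane ≃ᵢ Plane, U '' (s • G) ∈ T ∧
    (t = tau • (U '' (s • (f₁ '' G))) ∨ t = tau • (U '' (s • (f₂ '' G))))}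

/-- The supertile `𝒯ₙ`: a single large tile after `n` substitutions. -/
def supertile (n : ℕ) : TileSet := substitute^[n] {s • G}

/-- An Ammann(-A2) tiling of the plane: a tiling of the plane by large and small tiles each finite
part of which occurs, up to congruence, in a supertile. -/
def IsPlaneAmmann (T : TileSet) : Prop :=
  IsTilingOf T Set.univ ∧ (∀ t ∈ T, IsLarge t ∨ IsSmall t) ∧
    ∀ F : TileSet, F.Finite → F ⊆ T → ∃ n, ∃ P ⊆ supertile n, CongruentTilings P F

/-! ### Half-plane and quadrant tilings -/

/-- `T` is a nested union of (congruent copies of) supertiles of increasing levels. -/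
def IsNestedUnion (T : TileSet) : Prop :=
  ∃ (m : ℕ → ℕ) (P : ℕ → TileSet), StrictMono m ∧ Monotone P ∧
    (∀ n, CongruentTilings (supertile (m n)) (P n)) ∧ T = ⋃ n, P n

/-- The closed upper half plane. -/
def upperHalf : Set Plane := {p | 0 ≤ p 1}

/-- The closed first quadrant. -/
def quadrant : Set Plane := {p | 0 ≤ p 0 ∧ 0 ≤ p 1}

/-- Reflection in the horizontal coordinate axis. -/
def reflX (p : Plane) : Plane := !₂[p 0, -p 1]

/-- Reflection in the vertical coordinate axis. -/
def reflY (p : Plane) : Plane := !₂[-p 0, p 1]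

/-- `T` is (up to congruence) obtained from a nested union of supertiles that fills a half plane by
reflecting in the border line, or from one that fills a quadrant by reflecting in the two border
rays. -/
def IsReflected (T : TileSet) : Prop :=
  (∃ S, IsNestedUnion S ∧ IsTilingOf S upperHalf ∧
    CongruentTilings (S ∪ mapTiles reflX S) T) ∨
  (∃ S, IsNestedUnion S ∧ IsTilingOf S quadrant ∧
    CongruentTilings
      (S ∪ mapTiles reflX S ∪ mapTiles reflY S ∪ mapTiles (reflX ∘ reflY) S) T)

/-- The Ammann tilings of the retrieval theorem: the Ammann tilings of the plane that do not arise
by reflecting a half-plane or quadrant tiling, together with the nested unions of supertiles that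
fill a half plane or a quadrant. -/
def IsAmmann (T : TileSet) : Prop :=
  (IsPlaneAmmann T ∧ ¬ IsReflected T) ∨
  (IsNestedUnion T ∧ ∃ D, (CongruentSets upperHalf D ∨ CongruentSets quadrant D) ∧ IsTilingOf T D)

/-! ### Partners, amalgamation and codes of distorted tilings

Everything below depends on the distorted tiling `T'` alone, not on a chosen homeomorphism. -/

/-- In an (undistorted) tiling, `b` is the partner of the small tile `a`: `b` is a large tile and
`a ∪ b` is a hexagon congruent to `G`. -/
def IsPartner (T : TileSet) (a b : Set Plane) : Prop :=
  a ∈ T ∧ b ∈ T ∧ IsSmall a ∧ IsLarge b ∧ CongruentSets G (a ∪ b)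

/-- In a distorted tiling `T' = h(T)`, the partner of `a' = h(a)` is `h(b)`, where `b` is the
partner of `a` in `T`. -/
def IsPartner' (T' : TileSet) (a' b' : Set Plane) : Prop :=
  ∃ (T : TileSet) (h : Plane ≃ₜ Plane) (a b : Set Plane),
    IsAmmann T ∧ mapTiles h T = T' ∧ IsPartner T a b ∧ a' = h '' a ∧ b' = h '' b

/-- In a distorted tiling `T' = h(T)`, the large tiles are the images of the large tiles of `T`. -/
def IsLargeTile' (T' : TileSet) (t' : Set Plane) : Prop :=
  ∃ (T : TileSet) (h : Plane ≃ₜ Plane) (t : Set Plane),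
    IsAmmann T ∧ mapTiles h T = T' ∧ t ∈ T ∧ IsLarge t ∧ t' = h '' t

/-- The (unscaled) amalgamation `A(T')`: each small tile is united with its partner, and the tiles
that belong to no such pair are kept. -/
def amalgamate (T' : TileSet) : TileSet :=
  {u | ∃ a b, IsPartner' T' a b ∧ u = a ∪ b} ∪
  {t | t ∈ T' ∧ ∀ a b, IsPartner' T' a b → t ≠ a ∧ t ≠ b}

/-- The alphabet `{1, 2}`. -/
inductive Digit
  | one
  | two

/-- A digit as a number. -/
def Digit.val : Digit → ℕ
  | .one => 1
  | .two => 2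

/-- The large tile `t'` has a partner in `T'`, i.e. it is the partner of a small tile of `T'`. -/
def HasPartner (T' : TileSet) (t' : Set Plane) : Prop := ∃ a, IsPartner' T' a t'

open Classical in
/-- The map `g`. If `t'` has a partner in `T'`, then `g(T', t')` consists of `A(T')` and the union
of `t'` with its partner. Otherwise `t'` is a small tile of `A(T')`, and `g(T', t')` consists of
`A²(T')` and the union of `t'` with its partner in `A(T')`. -/
def g (x : TileSet × Set Plane) : TileSet × Set Plane :=
  if HasPartner x.1 x.2 then
    (amalgamate x.1, x.2 ∪ ⋃₀ {a | IsPartner' x.1 a x.2})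
  else
    (amalgamate (amalgamate x.1), x.2 ∪ ⋃₀ {b | IsPartner' (amalgamate x.1) x.2 b})

open Classical in
/-- The digit read at `(T', t')`: it is `1` if `t'` has a partner in `T'`, and `2` otherwise. -/
def digit (x : TileSet × Set Plane) : Digit :=
  if HasPartner x.1 x.2 then .one else .two

/-- The code `c(T', t')`; its `n`-th digit, counted from `0`, is read at `gⁿ(T', t')`. -/
def code (T' : TileSet) (t' : Set Plane) : ℕ → Digit := fun n => digit (g^[n] (T', t'))

/-! ### The tiling `T(θ)` -/

/-- The map `f₁` or `f₂` named by a digit. -/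
def f : Digit → Equiv.Perm Plane
  | .one => f₁
  | .two => f₂

/-- `f_σ = f_{σ₁} ∘ ⋯ ∘ f_{σₖ}`. -/
def fPos (σ : List Digit) : Equiv.Perm Plane := (σ.map f).prod

/-- `f_{-σ} = f_{σ₁}⁻¹ ∘ ⋯ ∘ f_{σₖ}⁻¹`. -/
def fNeg (σ : List Digit) : Equiv.Perm Plane := (σ.map fun i => (f i)⁻¹).prod

/-- `e(σ)`, the sum of the digits of `σ`. -/
def e (σ : List Digit) : ℕ := (σ.map Digit.val).sum

/-- `θ|k`, the string of the first `k` digits of `θ`. -/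
def trunc (θ : ℕ → Digit) (k : ℕ) : List Digit := (List.range k).map θ

/-- `W(θ, k)`: the nonempty strings `σ` with `e(σ_*) > e(σ) - e(θ|k) ≥ 0`, where `σ_*` is the last
digit of `σ`. -/
def W (θ : ℕ → Digit) (k : ℕ) : Set (List Digit) :=
  {σ | ∃ l ∈ σ.getLast?, e (trunc θ k) ≤ e σ ∧ e σ < e (trunc θ k) + l.val}

/-- The tile `t(θ, k, σ) = s (f_{-(θ|k)} ∘ f_σ)(G)`. -/
def thetaTile (θ : ℕ → Digit) (k : ℕ) (σ : List Digit) : Set Plane :=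
  s • ((fNeg (trunc θ k) * fPos σ) '' G)

/-- The patch `T(θ, k)`. -/
def thetaPatch (θ : ℕ → Digit) (k : ℕ) : TileSet := {t | ∃ σ ∈ W θ k, t = thetaTile θ k σ}

/-- The tiling `T(θ)`, the union of the patches `T(θ, k)`, `k ≥ 1`. -/
def thetaTiling (θ : ℕ → Digit) : TileSet := {t | ∃ k, 1 ≤ k ∧ t ∈ thetaPatch θ k}

end Ammann

end

noncomputable section

namespace Ammann

open scoped Pointwise

/-! ### The golden bee: arithmetic, topology, rigidity -/

/-! ### Arithmetic of `s` and `τ` -/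

/-! Uniting every small tile with its partner and shrinking by `s` inverts the substitution, and the
result is again an Ammann tiling (`IsAmmann.desub`). Hence every tile has an unambiguous chain of
ancestors, and the code of a large tile describes this chain. Digit 1 says that the tile is the
large piece of its parent. Digit 2 says that its parent is the same tile, which now counts as small,
and that its grandparent is the bee whose small piece this is. For a tile V(G), the first k digits
therefore locate the ancestor e(θ|k) levels up: it is the image of G under V followed by shrinking
e(θ|k) times and preceded by f_{-(θ|k)} (`IsAmmann.exists_g_iterate_eq`). Subdividing this ancestor
completely gives the k-th patch of T(θ), moved by the isometry `V * scS⁻¹` (`mapTiles_thetaPatch`).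
So T(θ) is congruent to the set of all tiles that have a common ancestor with the chosen one, its
class `cls`. Two facts remain.

First, the code can be read from the distorted tiling. Tiles of a supertile meet in one of 38
relative positions, and 200 neighbourhood types describe their surroundings. Exact arithmetic in
ℤ[s²] and kernel computation show that these tables are closed under substitution. The `colour` of a
tile is a number computed from the numbers of neighbours of the tile and of its edge neighbours. The
pair of colours tells whether a tile that shares infinitely many points with a small tile is its
partner (`partner_colours`, `LocallyAmmann.isPartner_iff_colour`). All these data survive a
bijection of the plane.

Second, there is only one class (`IsAmmann.cls_eq_self`). If two tiles of different classes share
infinitely many points, then so do all their ancestors, and the tables show that only mirror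
positions persist through six levels (`lateCodes_six`). The ancestors are mirror images as well, so
the whole classes are mirror images in a line, a `Wall`. A class lies on one side of each of its
walls, is not contained in a strip, and is separated by a wall from every point outside. So it fills
the plane, a half plane or a quadrant; in the last two cases the tiling is one of the excluded
reflected ones. In a nested union of supertiles, any two tiles lie in one copy of a supertile and
have a common ancestor for that reason (`IsNestedUnion.cls_eq_self`). -/

theorem s_pos : 0 < s := inv_pos.mpr tau_pos

theorem s_ne : s ≠ 0 := s_pos.ne'

theorem tau_sq : tau ^ 2 = Real.goldenRatio := Real.sq_sqrt Real.goldenRatio_pos.le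

/-- The golden equation τ⁴ = τ² + 1 multiplied by s⁴. Higher powers of `s` are reduced by means of
it. -/
theorem s_sq_add : s ^ 2 + s ^ 4 = 1 := by
  have h := tau_mul_s
  have h2 : tau ^ 4 = tau ^ 2 + 1 := by
    have := Real.goldenRatio_sq
    rw [← tau_sq] at this
    linear_combination this
  have h3 : tau ^ 4 * s ^ 4 = 1 := by rw [← mul_pow, h, one_pow]
  have h4 : tau ^ 2 * s ^ 2 = 1 := by rw [← mul_pow, h, one_pow]
  linear_combination (-s ^ 4) * h2 + h3 - s ^ 2 * h4

theorem s_four : s ^ 4 = 1 - s ^ 2 := by linear_combination s_sq_add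

theorem s_sq_bounds : 0.618 < s ^ 2 ∧ s ^ 2 < 0.6181 := by
  have h := s_four
  have h0 : 0 < s ^ 2 := pow_pos s_pos 2
  constructor <;> nlinarith

theorem s_bounds : 0.786 < s ∧ s < 0.787 := by
  have h := s_sq_bounds
  have h0 := s_pos
  constructor <;> nlinarith

theorem s_lt_one : s < 1 := by linarith [s_bounds.2]

theorem tau_gt_one : 1 < tau := by
  have h := tau_mul_s
  nlinarith [s_lt_one, s_pos, tau_pos]

/-! ### Coordinates and distances -/

/-- The point with the given coordinates. -/
def pt (x y : ℝ) : Plane := !₂[x, y]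

@[simp] theorem pt_zero (x y : ℝ) : pt x y 0 = x := by simp [pt]

@[simp] theorem pt_one (x y : ℝ) : pt x y 1 = y := by simp [pt]

theorem plane_ext {p q : Plane} (h0 : p 0 = q 0) (h1 : p 1 = q 1) : p = q := by
  ext i; fin_cases i
  · exact h0
  · exact h1

theorem dist_sq (p q : Plane) : dist p q ^ 2 = (p 0 - q 0) ^ 2 + (p 1 - q 1) ^ 2 := by
  rw [EuclideanSpace.dist_eq, Real.sq_sqrt (by positivity), Fin.sum_univ_two, Real.dist_eq,
    Real.dist_eq, sq_abs, sq_abs]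

@[simp] theorem f₁_apply_zero (p : Plane) : f₁ p 0 = s - s * p 1 := by simp [f₁]
@[simp] theorem f₁_apply_one (p : Plane) : f₁ p 1 = s * p 0 := by simp [f₁]
@[simp] theorem f₂_apply_zero (p : Plane) : f₂ p 0 = s ^ 2 * p 0 := by simp [f₂]
@[simp] theorem f₂_apply_one (p : Plane) : f₂ p 1 = 1 - s ^ 2 * p 1 := by simp [f₂]

theorem continuous_coord (i : Fin 2) : Continuous fun p : Plane => p i := by fun_prop

/-! ### Similarities -/

@[simp] theorem perm_inv_apply (V : Equiv.Perm Plane) (x : Plane) : V⁻¹ (V x) = x :=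
  V.symm_apply_apply x

@[simp] theorem perm_apply_inv (V : Equiv.Perm Plane) (x : Plane) : V (V⁻¹ x) = x :=
  V.apply_symm_apply x

/-- `V` multiplies all distances by `r`. -/
def Scales (r : ℝ) (V : Equiv.Perm Plane) : Prop := 0 < r ∧ ∀ x y, dist (V x) (V y) = r * dist x y

theorem Scales.mul {r r' : ℝ} {V W : Equiv.Perm Plane} (hV : Scales r V) (hW : Scales r' W) :
    Scales (r * r') (V * W) :=
  ⟨mul_pos hV.1 hW.1, fun x y => by
    rw [Equiv.Perm.mul_apply, Equiv.Perm.mul_apply, hV.2, hW.2, mul_assoc]⟩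

theorem Scales.inv {r : ℝ} {V : Equiv.Perm Plane} (hV : Scales r V) : Scales r⁻¹ V⁻¹ :=
  ⟨inv_pos.mpr hV.1, fun x y => by
    have h := hV.2 (V⁻¹ x) (V⁻¹ y)
    rw [perm_apply_inv, perm_apply_inv] at h
    rw [h, inv_mul_cancel_left₀ hV.1.ne']⟩

theorem Scales.of_sq {r : ℝ} (hr : 0 < r) {V : Equiv.Perm Plane}
    (h : ∀ x y, dist (V x) (V y) ^ 2 = r ^ 2 * dist x y ^ 2) : Scales r V :=
  ⟨hr, fun x y => by
    have := h x y
    rw [← mul_pow] at this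
    exact (pow_left_inj₀ dist_nonneg (mul_nonneg hr.le dist_nonneg) two_ne_zero).mp this⟩

theorem scales_one : Scales 1 1 := ⟨one_pos, fun x y => by simp⟩

theorem scales_f₁ : Scales s f₁ := Scales.of_sq s_pos fun x y => by
  rw [dist_sq, dist_sq]; simp; ring

theorem scales_f₂ : Scales (s ^ 2) f₂ := Scales.of_sq (pow_pos s_pos 2) fun x y => by
  rw [dist_sq, dist_sq]; simp; ring

theorem scales_f (d : Digit) : Scales (s ^ d.val) (f d) := by
  cases d
  · simpa [f, Digit.val] using scales_f₁
  · simpa [f, Digit.val] using scales_f₂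

/-- An isometry as a permutation. -/
theorem scales_isometry (U : Plane ≃ᵢ Plane) : Scales 1 U.toEquiv :=
  ⟨one_pos, fun x y => by rw [one_mul]; exact U.isometry.dist_eq x y⟩

/-- The isometry underlying a permutation that preserves distances. -/
def Scales.toIso {V : Equiv.Perm Plane} (hV : Scales 1 V) : Plane ≃ᵢ Plane :=
  IsometryEquiv.mk V (Isometry.of_dist_eq fun x y => (hV.2 x y).trans (one_mul _))

@[simp] theorem Scales.coe_toIso {V : Equiv.Perm Plane} (hV : Scales 1 V) : ⇑hV.toIso = V := rfl

theorem Scales.continuous {r : ℝ} {V : Equiv.Perm Plane} (hV : Scales r V) : Continuous V :=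
  (LipschitzWith.of_dist_le_mul (K := ⟨r, hV.1.le⟩) fun x y => (hV.2 x y).le).continuous

/-- The homeomorphism underlying a similarity. -/
def Scales.toHomeo {r : ℝ} {V : Equiv.Perm Plane} (hV : Scales r V) : Plane ≃ₜ Plane where
  toEquiv := V
  continuous_toFun := hV.continuous
  continuous_invFun := hV.inv.continuous

/-- The homothety with factor `s`. -/
def scS : Equiv.Perm Plane := MulAction.toPerm (Units.mk0 s s_ne)

@[simp] theorem scS_apply (x : Plane) : scS x = s • x := rfl

theorem s_inv : s⁻¹ = tau := inv_inv _

@[simp] theorem scS_inv_apply (x : Plane) : scS⁻¹ x = tau • x := by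
  rw [Equiv.Perm.inv_eq_iff_eq, scS_apply, smul_smul, mul_comm, tau_mul_s, one_smul]

theorem scales_scS : Scales s scS := ⟨s_pos, fun x y => by
  rw [scS_apply, scS_apply, dist_smul₀, Real.norm_of_nonneg s_pos.le]⟩

theorem scales_scS_inv : Scales tau scS⁻¹ := by
  have := scales_scS.inv
  rwa [s_inv] at this

theorem image_scS (A : Set Plane) : scS '' A = s • A := rfl

theorem image_scS_inv (A : Set Plane) : (scS⁻¹ : Equiv.Perm Plane) '' A = tau • A := by
  ext x
  simp [Set.mem_smul_set]

/-- A distance-preserving permutation that fixes three corners of `G` is the identity. -/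
theorem Scales.eq_one_of_fix {U : Equiv.Perm Plane} (hU : Scales 1 U) (h0 : U (pt 0 0) = pt 0 0)
    (h1 : U (pt s 0) = pt s 0) (h2 : U (pt 0 1) = pt 0 1) : U = 1 := by
  ext1 x
  have e0 := hU.2 x (pt 0 0)
  have e1 := hU.2 x (pt s 0)
  have e2 := hU.2 x (pt 0 1)
  rw [h0, one_mul] at e0
  rw [h1, one_mul] at e1
  rw [h2, one_mul] at e2
  have d0 := congrArg (· ^ 2) e0
  have d1 := congrArg (· ^ 2) e1
  have d2 := congrArg (· ^ 2) e2
  simp only [dist_sq, pt_zero, pt_one] at d0 d1 d2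
  have hx : U x 0 = x 0 := by
    have : s * (U x 0 - x 0) = 0 := by linear_combination (d0 - d1) / 2
    rcases mul_eq_zero.mp this with h | h
    · exact absurd h s_ne
    · linarith
  exact plane_ext hx (by rw [Equiv.Perm.one_apply]; linear_combination (d0 - d2) / 2)

theorem Scales.eq_of_agree {r : ℝ} {V W : Equiv.Perm Plane} (hV : Scales r V) (hW : Scales r W)
    (h0 : V (pt 0 0) = W (pt 0 0)) (h1 : V (pt s 0) = W (pt s 0))
    (h2 : V (pt 0 1) = W (pt 0 1)) : V = W := by
  have h := hW.inv.mul hV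
  rw [inv_mul_cancel₀ hW.1.ne'] at h
  have := h.eq_one_of_fix (by rw [Equiv.Perm.mul_apply, h0, perm_inv_apply])
    (by rw [Equiv.Perm.mul_apply, h1, perm_inv_apply])
    (by rw [Equiv.Perm.mul_apply, h2, perm_inv_apply])
  rw [inv_mul_eq_one] at this
  exact this.symm

/-! ### Topology of the bee -/

/-- A closed axis-parallel rectangle. -/
def rect (a b c d : ℝ) : Set Plane := {p | a ≤ p 0 ∧ p 0 ≤ b ∧ c ≤ p 1 ∧ p 1 ≤ d}

/-- An open axis-parallel rectangle. -/
def rectOpen (a b c d : ℝ) : Set Plane := {p | a < p 0 ∧ p 0 < b ∧ c < p 1 ∧ p 1 < d}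

theorem isClosed_rect (a b c d : ℝ) : IsClosed (rect a b c d) := by
  have h0 := continuous_coord 0
  have h1 := continuous_coord 1
  exact (isClosed_le continuous_const h0).inter ((isClosed_le h0 continuous_const).inter
    ((isClosed_le continuous_const h1).inter (isClosed_le h1 continuous_const)))

theorem isOpen_rectOpen (a b c d : ℝ) : IsOpen (rectOpen a b c d) := by
  have h0 := continuous_coord 0
  have h1 := continuous_coord 1
  exact (isOpen_lt continuous_const h0).inter ((isOpen_lt h0 continuous_const).inter
    ((isOpen_lt continuous_const h1).inter (isOpen_lt h1 continuous_const)))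

theorem rectOpen_subset_interior {a b c d : ℝ} {A : Set Plane} (h : rect a b c d ⊆ A) :
    rectOpen a b c d ⊆ interior A :=
  interior_maximal (fun _ hp => h ⟨hp.1.le, hp.2.1.le, hp.2.2.1.le, hp.2.2.2.le⟩)
    (isOpen_rectOpen _ _ _ _)

theorem rect_subset_closure {a b c d : ℝ} (hab : a < b) (hcd : c < d) :
    rect a b c d ⊆ closure (rectOpen a b c d) := by
  intro p hp
  -- Points of the segment from `p` to the centre of the rectangle lie in the open rectangle and
  -- tend to `p`.
  have hlim : Filter.Tendsto (fun t : ℝ => p + t • (pt ((a + b) / 2) ((c + d) / 2) - p))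
      (nhdsWithin 0 (Set.Ioo 0 1)) (nhds p) := by
    have : Continuous fun t : ℝ => p + t • (pt ((a + b) / 2) ((c + d) / 2) - p) := by fun_prop
    have h2 := this.tendsto 0
    simp only [zero_smul, add_zero] at h2
    exact h2.mono_left nhdsWithin_le_nhds
  have : (nhdsWithin (0 : ℝ) (Set.Ioo 0 1)).NeBot := by
    rw [← mem_closure_iff_nhdsWithin_neBot, closure_Ioo zero_ne_one]
    exact ⟨le_rfl, zero_le_one⟩
  refine mem_closure_of_tendsto hlim ?_
  filter_upwards [self_mem_nhdsWithin] with t ht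
  obtain ⟨h1, h2, h3, h4⟩ := hp
  obtain ⟨t0, t1⟩ := ht
  refine ⟨?_, ?_, ?_, ?_⟩ <;> simp <;> nlinarith

theorem G_eq : G = rect 0 s 0 (s ^ 2) ∪ rect 0 (s ^ 3) 0 1 := rfl

theorem isClosed_G : IsClosed G := (isClosed_rect _ _ _ _).union (isClosed_rect _ _ _ _)

theorem G_bounds {p : Plane} (hp : p ∈ G) : 0 ≤ p 0 ∧ p 0 ≤ s ∧ 0 ≤ p 1 ∧ p 1 ≤ 1 := by
  have h1 := s_bounds
  have h2 := s_sq_bounds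
  have h3 : s ^ 3 ≤ s := by nlinarith [s_pos]
  rcases hp with h | h <;> refine ⟨h.1, ?_, h.2.2.1, ?_⟩ <;> linarith [h.2.1, h.2.2.2]

theorem regular_G : G ⊆ closure (interior G) := by
  have h := s_pos
  rw [G_eq]
  rintro p (hp | hp)
  · exact closure_mono (rectOpen_subset_interior Set.subset_union_left)
      (rect_subset_closure h (by positivity) hp)
  · exact closure_mono (rectOpen_subset_interior Set.subset_union_right)
      (rect_subset_closure (by positivity) one_pos hp)

theorem mem_G_zero : pt 0 0 ∈ G := Or.inl (by simp; exact ⟨s_pos.le, by positivity⟩)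

theorem mem_G_A : pt s 0 ∈ G := Or.inl (by simp; exact ⟨s_pos.le, by positivity⟩)

theorem mem_G_B : pt 0 1 ∈ G := Or.inr (by simp; exact pow_nonneg s_pos.le 3)

theorem mem_G_D : pt s (s ^ 2) ∈ G := Or.inl (by simp; exact ⟨s_pos.le, by positivity⟩)

theorem mem_G_C : pt (s ^ 3) 1 ∈ G := Or.inr (by simp; exact pow_nonneg s_pos.le 3)

theorem isCompact_G : IsCompact G := by
  refine Metric.isCompact_of_isClosed_isBounded isClosed_G ?_
  refine (Metric.isBounded_closedBall (x := pt 0 0) (r := 2)).subset fun p hp => ?_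
  have h := G_bounds hp
  have hs := s_lt_one
  have hd := dist_sq p (pt 0 0)
  simp at hd
  rw [Metric.mem_closedBall]
  nlinarith [dist_nonneg (x := p) (y := pt 0 0)]

/-! ### Rigidity of the bee -/

theorem s_cube_lt : s ^ 3 < s := by nlinarith [s_pos, s_bounds.1, s_bounds.2, s_sq_bounds.2]

theorem dist_sq_le_of_mem_G {p q : Plane} (hp : p ∈ G) (hq : q ∈ G) :
    dist p q ^ 2 ≤ 1 + s ^ 2 := by
  have h1 := G_bounds hp
  have h2 := G_bounds hq
  rw [dist_sq]
  nlinarith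

/-- The bee lies in an s × 1 box with squared diagonal 1 + s². Only opposite corners of the box are
so far apart, and the notch removes the corner (s, 1), so a single diagonal remains. -/
theorem eq_corners_of_dist_sq {p q : Plane} (hp : p ∈ G) (hq : q ∈ G)
    (h : dist p q ^ 2 = 1 + s ^ 2) :
    (p = pt s 0 ∧ q = pt 0 1) ∨ (p = pt 0 1 ∧ q = pt s 0) := by
  have h1 := G_bounds hp
  have h2 := G_bounds hq
  have hs := s_pos
  have hs2 := s_sq_bounds
  rw [dist_sq] at h
  have hx : (p 0 - q 0) ^ 2 = s ^ 2 := by nlinarith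
  have hy : (p 1 - q 1) ^ 2 = 1 ^ 2 := by nlinarith
  have hlow : ∀ {z : Plane}, z ∈ G → z 0 = s → z 1 ≤ s ^ 2 := by
    intro z hz h0
    rcases hz with hz | hz
    · exact hz.2.2.2
    · linarith [hz.2.1, s_cube_lt]
  rcases sq_eq_sq_iff_eq_or_eq_neg.mp hx with hx | hx
  · have hp0 : p 0 = s := by linarith
    have hq0 : q 0 = 0 := by linarith
    have := hlow hp hp0
    rcases sq_eq_sq_iff_eq_or_eq_neg.mp hy with hy | hy
    · linarith
    · exact Or.inl ⟨plane_ext (by simp [hp0]) (by simp; linarith),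
        plane_ext (by simp [hq0]) (by simp; linarith)⟩
  · have hp0 : p 0 = 0 := by linarith
    have hq0 : q 0 = s := by linarith
    have := hlow hq hq0
    rcases sq_eq_sq_iff_eq_or_eq_neg.mp hy with hy | hy
    · exact Or.inr ⟨plane_ext (by simp [hp0]) (by simp; linarith),
        plane_ext (by simp [hq0]) (by simp; linarith)⟩
    · linarith

/-- The two circles meet at the origin and at its mirror image in the diagonal, whose first
coordinate 2s/(1 + s²) exceeds s. -/
theorem eq_corner_of_dist_sq {z : Plane} (hz : z ∈ G) (hA : dist z (pt s 0) ^ 2 = s ^ 2)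
    (hB : dist z (pt 0 1) ^ 2 = 1) : z = pt 0 0 := by
  have hs := s_bounds
  have hs2 := s_sq_bounds
  have h4 := s_four
  have hb := G_bounds hz
  simp only [dist_sq, pt_zero, pt_one] at hA hB
  have hy : z 1 = s * z 0 := by linear_combination (hA - hB) / 2
  rw [hy] at hA
  have hx : z 0 * (z 0 * (1 + s ^ 2) - 2 * s) = 0 := by linear_combination hA
  have hx0 : z 0 = 0 := by
    rcases mul_eq_zero.mp hx with h | h
    · exact h
    · nlinarith
  exact plane_ext (by simp [hx0]) (by simp [hy, hx0])

/-- The two circles meet at the missing corner (s, 1) and at a point with negative first coordinate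
s⁵ - s³. -/
theorem false_of_dist_sq {z : Plane} (hz : z ∈ G) (hA : dist z (pt s 0) ^ 2 = 1)
    (hB : dist z (pt 0 1) ^ 2 = s ^ 2) : False := by
  have hs := s_bounds
  have hs2 := s_sq_bounds
  have h4 := s_four
  have hb := G_bounds hz
  simp only [dist_sq, pt_zero, pt_one] at hA hB
  have hy : z 1 = s * z 0 + 1 - s ^ 2 := by linear_combination (hA - hB) / 2
  have hx : (1 + s ^ 2) * ((z 0 - s) * (z 0 + s ^ 3 - s ^ 5)) = 0 := by
    rw [hy] at hB
    linear_combination hB + (s ^ 4 - s ^ 2 - s * z 0 * (s ^ 2 - 1)) * h4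
  have hx0 : z 0 = s := by
    have h1 : (0 : ℝ) < 1 + s ^ 2 := by positivity
    rcases mul_eq_zero.mp ((mul_eq_zero.mp hx).resolve_left h1.ne') with h | h
    · linarith
    · have : s ^ 5 < s ^ 3 := by nlinarith [pow_pos s_pos 3]
      linarith
  have hy1 : z 1 = 1 := by rw [hy, hx0]; ring
  rcases hz with hz | hz
  · linarith [hz.2.2.2]
  · linarith [hz.2.1, s_cube_lt]

theorem dist_A_B : dist (pt s 0) (pt 0 1) ^ 2 = 1 + s ^ 2 := by rw [dist_sq]; simp; ring
theorem dist_O_A : dist (pt 0 0) (pt s 0) ^ 2 = s ^ 2 := by rw [dist_sq]; simp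
theorem dist_O_B : dist (pt 0 0) (pt 0 1) ^ 2 = 1 := by rw [dist_sq]; simp

theorem Scales.dist_sq_eq {r : ℝ} {V : Equiv.Perm Plane} (hV : Scales r V) (x y : Plane) :
    dist (V x) (V y) ^ 2 = r ^ 2 * dist x y ^ 2 := by rw [hV.2, mul_pow]

/-- With equal ratios, the farthest pair of corners must go to the farthest pair. The distances s
and 1 from the origin to this pair fix the third corner and rule out the exchange of the two ends.
-/
theorem Scales.eq_of_corners_mem {r : ℝ} {V W : Equiv.Perm Plane} (hV : Scales r V)
    (hW : Scales r W) (h0 : V (pt 0 0) ∈ W '' G) (h1 : V (pt s 0) ∈ W '' G)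
    (h2 : V (pt 0 1) ∈ W '' G) : V = W := by
  obtain ⟨z0, hz0, e0⟩ := h0
  obtain ⟨z1, hz1, e1⟩ := h1
  obtain ⟨z2, hz2, e2⟩ := h2
  have key : ∀ {x y z w : Plane}, W z = V x → W w = V y → dist z w ^ 2 = dist x y ^ 2 := by
    intro x y z w hz hw
    have h3 := hW.2 z w
    rw [hz, hw, hV.2] at h3
    rw [mul_left_cancel₀ hW.1.ne' h3]
  have k12 := key e1 e2
  have k01 := key e0 e1
  have k02 := key e0 e2
  rw [dist_A_B] at k12
  rw [dist_O_A] at k01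
  rw [dist_O_B] at k02
  rcases eq_corners_of_dist_sq hz1 hz2 k12 with ⟨rfl, rfl⟩ | ⟨rfl, rfl⟩
  · obtain rfl := eq_corner_of_dist_sq hz0 k01 k02
    exact hV.eq_of_agree hW e0.symm e1.symm e2.symm
  · exact (false_of_dist_sq hz0 k02 k01).elim

theorem Scales.ratio_le {r r' : ℝ} {V W : Equiv.Perm Plane} (hV : Scales r V) (hW : Scales r' W)
    (h : V '' G ⊆ W '' G) : r ≤ r' := by
  obtain ⟨z1, hz1, e1⟩ := h ⟨_, mem_G_A, rfl⟩
  obtain ⟨z2, hz2, e2⟩ := h ⟨_, mem_G_B, rfl⟩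
  have h1 := hW.dist_sq_eq z1 z2
  rw [e1, e2, hV.dist_sq_eq, dist_A_B] at h1
  have h2 := dist_sq_le_of_mem_G hz1 hz2
  have h3 : r ^ 2 * (1 + s ^ 2) ≤ r' ^ 2 * (1 + s ^ 2) := by
    rw [h1]; exact mul_le_mul_of_nonneg_left h2 (sq_nonneg _)
  have h4 := le_of_mul_le_mul_right h3 (by positivity)
  exact (pow_le_pow_iff_left₀ hV.1.le hW.1.le two_ne_zero).mp h4

/-- The bee has no symmetries: a similar copy of `G` determines the similarity. -/
theorem Scales.eq_of_image {r r' : ℝ} {V W : Equiv.Perm Plane} (hV : Scales r V)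
    (hW : Scales r' W) (h : V '' G = W '' G) : V = W := by
  obtain rfl : r = r' := le_antisymm (hV.ratio_le hW h.le) (hW.ratio_le hV h.ge)
  refine hV.eq_of_corners_mem hW ?_ ?_ ?_ <;> rw [← h]
  exacts [⟨_, mem_G_zero, rfl⟩, ⟨_, mem_G_A, rfl⟩, ⟨_, mem_G_B, rfl⟩]

theorem Scales.ratio_eq {r r' : ℝ} {V : Equiv.Perm Plane} (hV : Scales r V)
    (hW : Scales r' V) : r = r' :=
  le_antisymm (hV.ratio_le hW subset_rfl) (hW.ratio_le hV subset_rfl)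

theorem mul_le_iff_of_mul_eq_one {a b : ℝ} (ha : 0 < a) (hab : a * b = 1) (x c : ℝ) :
    a * x ≤ c ↔ x ≤ b * c := by
  have e : x = b * (a * x) := by linear_combination (-x) * hab
  have hb : 0 < b := pos_of_mul_pos_right (hab ▸ one_pos) ha.le
  conv_rhs => rw [e]
  exact (mul_le_mul_iff_right₀ hb).symm

theorem le_mul_iff_of_mul_eq_one {a b : ℝ} (ha : 0 < a) (hab : a * b = 1) (x c : ℝ) :
    c ≤ a * x ↔ b * c ≤ x := by
  have e : x = b * (a * x) := by linear_combination (-x) * hab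
  have hb : 0 < b := pos_of_mul_pos_right (hab ▸ one_pos) ha.le
  conv_rhs => rw [e]
  exact (mul_le_mul_iff_right₀ hb).symm

theorem mem_f₁_image (p : Plane) : p ∈ f₁ '' G ↔
    (0 ≤ p 0 ∧ p 0 ≤ s ∧ 0 ≤ p 1 ∧ p 1 ≤ s ^ 4) ∨
    (s ^ 5 ≤ p 0 ∧ p 0 ≤ s ∧ 0 ≤ p 1 ∧ p 1 ≤ s ^ 2) := by
  have h5 : s ^ 5 = s - s ^ 3 := by linear_combination s * s_four
  rw [Equiv.image_eq_preimage_symm]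
  have hinv : f₁.symm p = pt (tau * p 1) (1 - tau * p 0) := rfl
  rw [Set.mem_preimage, hinv]
  have i1 := mul_le_iff_of_mul_eq_one tau_pos tau_mul_s
  have i2 := le_mul_iff_of_mul_eq_one tau_pos tau_mul_s
  have c1 : s * (1 - s ^ 2) = s ^ 5 := by rw [h5]; ring
  have c2 : s * s = s ^ 2 := by ring
  have c3 : s * s ^ 3 = s ^ 4 := by ring
  change ((0 ≤ tau * p 1 ∧ tau * p 1 ≤ s ∧ 0 ≤ 1 - tau * p 0 ∧ 1 - tau * p 0 ≤ s ^ 2) ∨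
    (0 ≤ tau * p 1 ∧ tau * p 1 ≤ s ^ 3 ∧ 0 ≤ 1 - tau * p 0 ∧ 1 - tau * p 0 ≤ 1)) ↔ _
  rw [sub_nonneg, sub_le_comm, sub_le_comm (b := tau * p 0) (c := (1 : ℝ)), i1, i1, i1, i2, i2, i2, c1, c2, c3, sub_self, mul_zero,
    mul_one]
  tauto

theorem mem_f₂_image (p : Plane) : p ∈ f₂ '' G ↔
    (0 ≤ p 0 ∧ p 0 ≤ s ^ 3 ∧ s ^ 2 ≤ p 1 ∧ p 1 ≤ 1) ∨
    (0 ≤ p 0 ∧ p 0 ≤ s ^ 5 ∧ s ^ 4 ≤ p 1 ∧ p 1 ≤ 1) := by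
  have h4 := s_four
  rw [Equiv.image_eq_preimage_symm]
  have hinv : f₂.symm p = pt (tau ^ 2 * p 0) (tau ^ 2 * (1 - p 1)) := rfl
  have ht : 0 < tau ^ 2 := pow_pos tau_pos 2
  have hts : tau ^ 2 * s ^ 2 = 1 := by rw [← mul_pow, tau_mul_s, one_pow]
  have i1 := mul_le_iff_of_mul_eq_one ht hts
  have i2 := le_mul_iff_of_mul_eq_one ht hts
  rw [Set.mem_preimage, hinv]
  have c1 : s ^ 2 * s = s ^ 3 := by ring
  have c2 : s ^ 2 * s ^ 2 = s ^ 4 := by ring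
  have c3 : s ^ 2 * s ^ 3 = s ^ 5 := by ring
  change ((0 ≤ tau ^ 2 * p 0 ∧ tau ^ 2 * p 0 ≤ s ∧ 0 ≤ tau ^ 2 * (1 - p 1) ∧
      tau ^ 2 * (1 - p 1) ≤ s ^ 2) ∨
    (0 ≤ tau ^ 2 * p 0 ∧ tau ^ 2 * p 0 ≤ s ^ 3 ∧ 0 ≤ tau ^ 2 * (1 - p 1) ∧
      tau ^ 2 * (1 - p 1) ≤ 1)) ↔ _
  rw [i1, i1, i1, i1, i2, i2, c1, c2, c3, mul_zero, mul_one, sub_nonneg]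
  constructor
  · rintro (⟨a, b, c, d⟩ | ⟨a, b, c, d⟩)
    · exact Or.inl ⟨a, b, by linarith, by linarith⟩
    · exact Or.inr ⟨a, b, by linarith, by linarith⟩
  · rintro (⟨a, b, c, d⟩ | ⟨a, b, c, d⟩)
    · exact Or.inl ⟨a, b, by linarith, by linarith⟩
    · exact Or.inr ⟨a, b, by linarith, by linarith⟩

theorem G_eq_union : G = f₁ '' G ∪ f₂ '' G := by
  have hs := s_bounds
  have hs2 := s_sq_bounds
  have h4 := s_four
  have h5 : s ^ 5 = s - s ^ 3 := by linear_combination s * h4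
  have h3 := pow_pos s_pos 3
  have b5 : s ^ 5 < s ^ 3 := by nlinarith
  have b3 := s_cube_lt
  ext p
  rw [Set.mem_union, mem_f₁_image, mem_f₂_image]
  constructor
  · rintro (⟨a, b, c, d⟩ | ⟨a, b, c, d⟩)
    · rcases le_total (p 1) (s ^ 4) with h | h
      · exact Or.inl (Or.inl ⟨a, b, c, h⟩)
      · rcases le_total (p 0) (s ^ 5) with h' | h'
        · exact Or.inr (Or.inr ⟨a, h', h, by linarith⟩)
        · exact Or.inl (Or.inr ⟨h', b, c, d⟩)
    · rcases le_total (s ^ 2) (p 1) with h | h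
      · exact Or.inr (Or.inl ⟨a, b, h, d⟩)
      · rcases le_total (p 1) (s ^ 4) with h' | h'
        · exact Or.inl (Or.inl ⟨a, by linarith, c, h'⟩)
        · rcases le_total (p 0) (s ^ 5) with h'' | h''
          · exact Or.inr (Or.inr ⟨a, h'', h', d⟩)
          · exact Or.inl (Or.inr ⟨h'', by linarith, c, h⟩)
  · rintro ((⟨a, b, c, d⟩ | ⟨a, b, c, d⟩) | (⟨a, b, c, d⟩ | ⟨a, b, c, d⟩))
    · exact Or.inl ⟨a, b, c, by linarith⟩
    · exact Or.inl ⟨by nlinarith, b, c, d⟩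
    · exact Or.inr ⟨a, b, by nlinarith, d⟩
    · exact Or.inr ⟨a, by linarith, by nlinarith, d⟩

/-- Similarities are affine. -/
theorem Scales.map_combo {r : ℝ} {V : Equiv.Perm Plane} (hV : Scales r V) {a b : ℝ}
    (hab : a + b = 1) (x y : Plane) : V (a • x + b • y) = a • V x + b • V y := by
  have hr : r⁻¹ ≠ 0 := inv_ne_zero hV.1.ne'
  -- Rescaling turns the similarity into an isometry, which is affine by the Mazur–Ulam theorem.
  let U : Plane ≃ᵢ Plane := IsometryEquiv.mk (V.trans (MulAction.toPerm (Units.mk0 r⁻¹ hr)))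
    (Isometry.of_dist_eq fun x y => by
      change dist (r⁻¹ • V x) (r⁻¹ • V y) = _
      rw [dist_smul₀, hV.2, Real.norm_of_nonneg (inv_pos.mpr hV.1).le,
        inv_mul_cancel_left₀ hV.1.ne'])
  have h := U.toRealAffineIsometryEquiv.toAffineEquiv.toAffineMap.apply_lineMap x y b
  have hU : ∀ z, U.toRealAffineIsometryEquiv.toAffineEquiv.toAffineMap z = r⁻¹ • V z :=
    fun z => rfl
  rw [hU, hU, hU, AffineMap.lineMap_apply_module, AffineMap.lineMap_apply_module,
    ← hab, add_sub_cancel_right, smul_comm a, smul_comm b, ← smul_add] at h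
  exact smul_right_injective Plane hr h

/-- The two ends of the long diagonal `OD` lie on different sides of the line `AB`. -/
theorem Scales.not_one_sided {r : ℝ} {V : Equiv.Perm Plane} (hV : Scales r V) {i : Fin 2}
    (hi : i = 0 ∨ i = 1) (hA : V (pt s 0) i = 0) (hB : V (pt 0 1) i = 0) (hO : 0 ≤ V (pt 0 0) i)
    (hD : 0 ≤ V (pt s (s ^ 2)) i) : False := by
  have h4 := s_four
  have hs := s_bounds
  have hs2 := s_sq_bounds
  have hsum : s ^ 2 + s ^ 4 = 1 := s_sq_add
  -- The crossing point (s³, s⁴) of AB and OD, written with its weights on each. Its image has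
  -- `i`-th coordinate 0, so the two nonnegative terms on the side of OD vanish.
  have e : s ^ 2 • pt s 0 + s ^ 4 • pt 0 1 = s ^ 2 • pt s (s ^ 2) + s ^ 4 • pt 0 0 :=
    plane_ext (by simp) (by simp; ring)
  have h := congrArg V e
  rw [hV.map_combo hsum, hV.map_combo hsum] at h
  have hc := congrArg (fun p : Plane => p i) h
  simp only [PiLp.add_apply, PiLp.smul_apply, smul_eq_mul, hA, hB] at hc
  have hO' : V (pt 0 0) i = 0 := by nlinarith
  have q1 := hV.dist_sq_eq (pt 0 0) (pt s 0)
  have q2 := hV.dist_sq_eq (pt 0 0) (pt 0 1)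
  have q3 := hV.dist_sq_eq (pt s 0) (pt 0 1)
  rw [dist_O_A] at q1
  rw [dist_O_B] at q2
  rw [dist_A_B] at q3
  have hr2 : 0 < r ^ 2 := pow_pos hV.1 2
  -- The images of O, A, B now lie on one line. There the relation between the three distances,
  -- which expresses the right angle at O, forces one of the legs to be zero.
  have key : ∀ x y z : ℝ, (x - y) ^ 2 = r ^ 2 * s ^ 2 → (x - z) ^ 2 = r ^ 2 * 1 →
      (y - z) ^ 2 = r ^ 2 * (1 + s ^ 2) → False := by
    intro x y z a b c
    have h1 : (x - y) * (x - z) = 0 := by linear_combination (a + b - c) / 2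
    have h2 : (r ^ 2 * s ^ 2) * (r ^ 2 * 1) = 0 := by
      rw [← a, ← b]; linear_combination ((x - y) * (x - z)) * h1
    have : 0 < (r ^ 2 * s ^ 2) * (r ^ 2 * 1) := by
      have := pow_pos s_pos 2
      positivity
    linarith
  rw [dist_sq] at q1 q2 q3
  rcases hi with rfl | rfl
  · rw [hO', hA] at q1
    rw [hO', hB] at q2
    rw [hA, hB] at q3
    exact key (V (pt 0 0) 1) (V (pt s 0) 1) (V (pt 0 1) 1) (by linear_combination q1)
      (by linear_combination q2) (by linear_combination q3)
  · rw [hO', hA] at q1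
    rw [hO', hB] at q2
    rw [hA, hB] at q3
    exact key (V (pt 0 0) 0) (V (pt s 0) 0) (V (pt 0 1) 0) (by linear_combination q1)
      (by linear_combination q2) (by linear_combination q3)

/-- A small and a large tile with union `G` are the two pieces of `G`. -/
theorem decomposition_unique {V W : Equiv.Perm Plane} (hV : Scales (s ^ 2) V) (hW : Scales s W)
    (h : V '' G ∪ W '' G = G) : V = f₂ ∧ W = f₁ := by
  have hs := s_bounds
  have hs2 := s_sq_bounds
  have h4 := s_four
  have hs0 := s_pos
  have e6 : s ^ 6 = 2 * s ^ 2 - 1 := by linear_combination (s ^ 2 - 1) * h4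
  have e8 : s ^ 8 = 2 - 3 * s ^ 2 := by linear_combination (s ^ 4 - s ^ 2 + 2) * h4
  have e10 : s ^ 10 = 5 * s ^ 2 - 3 := by linear_combination s ^ 2 * e8 - 3 * h4
  have hVG : V '' G ⊆ G := Set.subset_union_left.trans h.le
  have hWG : W '' G ⊆ G := Set.subset_union_right.trans h.le
  have cover : ∀ {p}, p ∈ G → p ∈ V '' G ∨ p ∈ W '' G := fun hp => h.ge hp
  -- The squared diameters are s⁴(1 + s²) = s² for the small tile and s²(1 + s²) = 1 for the large
  -- one.
  have farV : ∀ {p q}, p ∈ V '' G → q ∈ V '' G → dist p q ^ 2 ≤ s ^ 2 := by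
    rintro _ _ ⟨p, hp, rfl⟩ ⟨q, hq, rfl⟩
    rw [hV.dist_sq_eq]
    nlinarith [dist_sq_le_of_mem_G hp hq]
  have farW : ∀ {p q}, p ∈ W '' G → q ∈ W '' G → dist p q ^ 2 ≤ 1 := by
    rintro _ _ ⟨p, hp, rfl⟩ ⟨q, hq, rfl⟩
    rw [hW.dist_sq_eq]
    nlinarith [dist_sq_le_of_mem_G hp hq]
  have hOB := dist_O_B
  -- If B = (0, 1) is in the small tile, then the distances put O, A and D into the large one. These
  -- are the images of B, O and A under `f₁`.
  rcases cover mem_G_B with hB | hB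
  · have hA : pt s 0 ∈ W '' G := (cover mem_G_A).resolve_left fun hA => by
      have := farV hA hB
      rw [dist_A_B] at this
      linarith
    have hO : pt 0 0 ∈ W '' G := (cover mem_G_zero).resolve_left fun hO => by
      have := farV hO hB
      rw [dist_O_B] at this
      linarith
    have hD : pt s (s ^ 2) ∈ W '' G := (cover mem_G_D).resolve_left fun hD => by
      have := farV hD hB
      rw [dist_sq] at this
      simp at this
      nlinarith
    have hWf : W = f₁ := by
      refine (scales_f₁.eq_of_corners_mem hW ?_ ?_ ?_).symm
      · convert hA using 1
        exact plane_ext (by simp) (by simp)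
      · convert hD using 1
        exact plane_ext (by simp) (by simp; ring)
      · convert hO using 1
        exact plane_ext (by simp) (by simp)
    refine ⟨(scales_f₂.eq_of_corners_mem hV ?_ ?_ ?_).symm, hWf⟩
    · convert hB using 1
      exact plane_ext (by simp) (by simp)
    · have hC : pt (s ^ 3) 1 ∈ V '' G := (cover mem_G_C).resolve_right fun hC => by
        rw [hWf, mem_f₁_image] at hC
        simp only [pt_zero, pt_one] at hC
        rcases hC with hC | hC <;> linarith [hC.2.2.2]
      convert hC using 1
      exact plane_ext (by simp; ring) (by simp)
    -- The point `f₂(0, 1)` = (0, s⁴) is on the common border of the two pieces, so membership in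
    -- the large tile cannot be excluded. It is a limit of points of the left edge above it, which
    -- the large tile misses.
    · have hcl : IsClosed (V '' G) := (isCompact_G.image hV.continuous).isClosed
      have hlim : Filter.Tendsto (fun t : ℝ => pt 0 (1 - s ^ 2 + t)) (nhdsWithin 0 (Set.Ioo 0 0.1))
          (nhds (f₂ (pt 0 1))) := by
        have hc : Continuous fun t : ℝ => pt 0 (1 - s ^ 2 + t) := by unfold pt; fun_prop
        have h2 := hc.tendsto 0
        have h3 : pt 0 (1 - s ^ 2 + 0) = f₂ (pt 0 1) := plane_ext (by simp) (by simp)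
        rw [h3] at h2
        exact h2.mono_left nhdsWithin_le_nhds
      have : (nhdsWithin (0 : ℝ) (Set.Ioo 0 0.1)).NeBot := by
        rw [← mem_closure_iff_nhdsWithin_neBot, closure_Ioo (by norm_num)]
        exact ⟨le_rfl, by norm_num⟩
      refine hcl.mem_of_tendsto hlim ?_
      filter_upwards [self_mem_nhdsWithin] with t ht
      have ht1 := ht.1
      have ht2 := ht.2
      refine (cover (Or.inr ?_)).resolve_right fun hc => ?_
      · refine ⟨?_, ?_, ?_, ?_⟩ <;> simp
        · positivity
        · linarith
        · linarith
      · rw [hWf, mem_f₁_image] at hc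
        simp at hc
        rcases hc with hc | hc
        · linarith [hc.2.2]
        · linarith [hc.1, pow_pos s_pos 5]
  · have hA : pt s 0 ∈ V '' G := (cover mem_G_A).resolve_right fun hA => by
      have := farW hA hB
      rw [dist_A_B] at this
      linarith
    exfalso
    have nonneg : ∀ {X : Equiv.Perm Plane}, X '' G ⊆ G → ∀ {p}, p ∈ G → X p ∈ G :=
      fun hX _ hp => hX ⟨_, hp, rfl⟩
    -- The tile containing O attains its diameter along the bottom or the left side of G. Its long
    -- diagonal is then on the border of a half plane that contains the tile, which
    -- `Scales.not_one_sided` forbids.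
    rcases cover mem_G_zero with hO | hO
    · obtain ⟨a, ha, ea⟩ := hO
      obtain ⟨b, hb, eb⟩ := hA
      have hab : dist a b ^ 2 = 1 + s ^ 2 := by
        have h1 := hV.dist_sq_eq a b
        rw [ea, eb, dist_O_A] at h1
        have h2 : s ^ 4 * (dist a b ^ 2 - (1 + s ^ 2)) = 0 := by linear_combination -h1 - s ^ 2 * h4
        rcases mul_eq_zero.mp h2 with h2 | h2
        · nlinarith
        · linarith
      have n0 := (G_bounds (nonneg hVG mem_G_zero)).2.2.1
      have nD := (G_bounds (nonneg hVG mem_G_D)).2.2.1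
      refine hV.not_one_sided (Or.inr rfl) ?_ ?_ n0 nD <;>
      rcases eq_corners_of_dist_sq ha hb hab with ⟨rfl, rfl⟩ | ⟨rfl, rfl⟩ <;> simp [ea, eb]
    · obtain ⟨a, ha, ea⟩ := hO
      obtain ⟨b, hb, eb⟩ := hB
      have hab : dist a b ^ 2 = 1 + s ^ 2 := by
        have h1 := hW.dist_sq_eq a b
        rw [ea, eb, dist_O_B] at h1
        have h2 : s ^ 2 * (dist a b ^ 2 - (1 + s ^ 2)) = 0 := by linear_combination -h1 - h4
        rcases mul_eq_zero.mp h2 with h2 | h2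
        · nlinarith
        · linarith
      have n0 := (G_bounds (nonneg hWG mem_G_zero)).1
      have nD := (G_bounds (nonneg hWG mem_G_D)).1
      refine hW.not_one_sided (Or.inl rfl) ?_ ?_ n0 nD <;>
      rcases eq_corners_of_dist_sq ha hb hab with ⟨rfl, rfl⟩ | ⟨rfl, rfl⟩ <;> simp [ea, eb]

/-! ### Tiles, substitution and desubstitution -/

/-! ### Tiles as placed copies of the bee -/

theorem isLarge_iff {t : Set Plane} : IsLarge t ↔ ∃ V, Scales s V ∧ V '' G = t := by
  constructor
  · rintro ⟨U, hU⟩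
    refine ⟨U.toEquiv * scS, by simpa using (scales_isometry U).mul scales_scS, ?_⟩
    rw [← hU, ← image_scS, Equiv.Perm.coe_mul, Set.image_comp]
    rfl
  · rintro ⟨V, hV, rfl⟩
    have h := hV.mul scales_scS.inv
    rw [mul_inv_cancel₀ s_ne] at h
    refine ⟨h.toIso, ?_⟩
    rw [← image_scS, Scales.coe_toIso, ← Set.image_comp, ← Equiv.Perm.coe_mul, inv_mul_cancel_right]

theorem isSmall_iff {t : Set Plane} : IsSmall t ↔ ∃ V, Scales (s ^ 2) V ∧ V '' G = t := by
  have e : ∀ A : Set Plane, s ^ 2 • A = (scS * scS : Equiv.Perm Plane) '' A := by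
    intro A
    rw [Equiv.Perm.coe_mul, Set.image_comp, image_scS, image_scS, smul_smul, sq]
  have h2 : Scales (s ^ 2) (scS * scS) := by simpa [sq] using scales_scS.mul scales_scS
  constructor
  · rintro ⟨U, hU⟩
    refine ⟨U.toEquiv * (scS * scS), by simpa using (scales_isometry U).mul h2, ?_⟩
    rw [← hU, e, Equiv.Perm.coe_mul, Set.image_comp]
    rfl
  · rintro ⟨V, hV, rfl⟩
    have h := hV.mul h2.inv
    rw [mul_inv_cancel₀ (pow_ne_zero 2 s_ne)] at h
    refine ⟨h.toIso, ?_⟩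
    rw [e, Scales.coe_toIso, ← Set.image_comp, ← Equiv.Perm.coe_mul, inv_mul_cancel_right]

theorem congruent_G_iff {t : Set Plane} : CongruentSets G t ↔ ∃ V, Scales 1 V ∧ V '' G = t :=
  ⟨fun ⟨U, hU⟩ => ⟨U.toEquiv, scales_isometry U, hU⟩, fun ⟨_, hV, e⟩ => ⟨hV.toIso, e⟩⟩

theorem s_sq_lt : s ^ 2 < s := by nlinarith [s_bounds.1, s_bounds.2, s_sq_bounds.2]

theorem IsLarge.not_isSmall {t : Set Plane} (h : IsLarge t) : ¬ IsSmall t := by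
  rw [isLarge_iff] at h
  rw [isSmall_iff]
  rintro ⟨W, hW, e'⟩
  obtain ⟨V, hV, e⟩ := h
  exact absurd (hV.ratio_le hW (e.trans e'.symm).le) s_sq_lt.not_ge

/-- A closed set that is the closure of its interior. -/
def Regular (t : Set Plane) : Prop := t ⊆ closure (interior t)

theorem Scales.image_interior {r : ℝ} {V : Equiv.Perm Plane} (hV : Scales r V) (A : Set Plane) :
    V '' interior A = interior (V '' A) := hV.toHomeo.image_interior A

theorem Scales.image_closure {r : ℝ} {V : Equiv.Perm Plane} (hV : Scales r V) (A : Set Plane) :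
    V '' closure A = closure (V '' A) := hV.toHomeo.image_closure A

theorem Scales.regular {r : ℝ} {V : Equiv.Perm Plane} (hV : Scales r V) : Regular (V '' G) := by
  have h := Set.image_mono (f := V) regular_G
  rwa [hV.image_closure, hV.image_interior] at h

theorem Scales.isCompact {r : ℝ} {V : Equiv.Perm Plane} (hV : Scales r V) : IsCompact (V '' G) :=
  isCompact_G.image hV.continuous

theorem Scales.nonempty_interior {r : ℝ} {V : Equiv.Perm Plane} (hV : Scales r V) :
    (interior (V '' G)).Nonempty := by
  have h : (V '' G).Nonempty := ⟨_, _, mem_G_zero, rfl⟩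
  obtain ⟨p, hp⟩ := h
  exact closure_nonempty_iff.mp ⟨p, hV.regular hp⟩

/-- `t` is a large or a small tile. -/
def IsTile (t : Set Plane) : Prop := IsLarge t ∨ IsSmall t

theorem IsTile.exists_scales {t : Set Plane} (h : IsTile t) : ∃ r V, Scales r V ∧ V '' G = t := by
  rcases h with h | h
  · obtain ⟨V, hV, e⟩ := isLarge_iff.mp h
    exact ⟨_, V, hV, e⟩
  · obtain ⟨V, hV, e⟩ := isSmall_iff.mp h
    exact ⟨_, V, hV, e⟩

theorem IsTile.regular {t : Set Plane} (h : IsTile t) : Regular t := by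
  obtain ⟨r, V, hV, rfl⟩ := h.exists_scales
  exact hV.regular

theorem IsTile.isCompact {t : Set Plane} (h : IsTile t) : IsCompact t := by
  obtain ⟨r, V, hV, rfl⟩ := h.exists_scales
  exact hV.isCompact

theorem IsTile.nonempty_interior {t : Set Plane} (h : IsTile t) : (interior t).Nonempty := by
  obtain ⟨r, V, hV, rfl⟩ := h.exists_scales
  exact hV.nonempty_interior

theorem Regular.overlap {t u : Set Plane} (hu : Regular u) {p : Plane} (hp : p ∈ interior t)
    (hpu : p ∈ u) : (interior (t ∩ u)).Nonempty := by
  obtain ⟨z, hz1, hz2⟩ := mem_closure_iff.mp (hu hpu) _ isOpen_interior hp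
  exact ⟨z, by rw [interior_inter]; exact ⟨hz1, hz2⟩⟩

/-- No two different members overlap. -/
def NoOverlap (T : TileSet) : Prop := ∀ t ∈ T, ∀ u ∈ T, t ≠ u → interior (t ∩ u) = ∅

/-- The working form of non-overlapping: a regular tile that contains an interior point of `t` also
has interior points in common with `t`. -/
theorem NoOverlap.eq {T : TileSet} (hT : NoOverlap T) {t u : Set Plane} (ht : t ∈ T) (hu : u ∈ T)
    (hr : Regular u) {p : Plane} (hp : p ∈ interior t) (hpu : p ∈ u) : t = u := by
  by_contra hne
  have := hr.overlap hp hpu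
  rw [hT t ht u hu hne] at this
  exact this.ne_empty rfl

theorem NoOverlap.mono {S T : TileSet} (hT : NoOverlap T) (h : S ⊆ T) : NoOverlap S :=
  fun t ht u hu => hT t (h ht) u (h hu)

/-! ### Images of collections of tiles -/

theorem mapTiles_comp (φ ψ : Plane → Plane) (T : TileSet) :
    mapTiles φ (mapTiles ψ T) = mapTiles (φ ∘ ψ) T := by
  simp only [mapTiles, Set.image_image, Set.image_comp]

theorem mapTiles_mul (V W : Equiv.Perm Plane) (T : TileSet) :
    mapTiles V (mapTiles W T) = mapTiles (V * W : Equiv.Perm Plane) T := mapTiles_comp _ _ _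

theorem mapTiles_id (T : TileSet) : mapTiles id T = T := by simp [mapTiles]

theorem mapTiles_one (T : TileSet) : mapTiles (1 : Equiv.Perm Plane) T = T := mapTiles_id T

theorem mapTiles_union (φ : Plane → Plane) (S T : TileSet) :
    mapTiles φ (S ∪ T) = mapTiles φ S ∪ mapTiles φ T := Set.image_union _ _ _

theorem mapTiles_iUnion {ι : Sort*} (φ : Plane → Plane) (S : ι → TileSet) :
    mapTiles φ (⋃ i, S i) = ⋃ i, mapTiles φ (S i) := Set.image_iUnion

theorem mapTiles_mono {φ : Plane → Plane} {S T : TileSet} (h : S ⊆ T) :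
    mapTiles φ S ⊆ mapTiles φ T := Set.image_mono h

theorem sUnion_mapTiles (φ : Plane → Plane) (T : TileSet) : ⋃₀ mapTiles φ T = φ '' ⋃₀ T := by
  rw [mapTiles, Set.sUnion_image, Set.sUnion_eq_biUnion, Set.image_iUnion₂]

theorem mem_mapTiles_iff (V : Equiv.Perm Plane) {T : TileSet} {t : Set Plane} :
    V '' t ∈ mapTiles V T ↔ t ∈ T :=
  ⟨fun ⟨_, hu, e⟩ => (Set.image_injective.mpr V.injective e) ▸ hu, fun h => ⟨t, h, rfl⟩⟩

theorem Scales.noOverlap {r : ℝ} {V : Equiv.Perm Plane} (hV : Scales r V) {T : TileSet}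
    (hT : NoOverlap T) : NoOverlap (mapTiles V T) := by
  rintro _ ⟨t, ht, rfl⟩ _ ⟨u, hu, rfl⟩ hne
  have hne' : t ≠ u := fun h => hne (h ▸ rfl)
  change interior (V '' t ∩ V '' u) = ∅
  rw [← Set.image_inter V.injective, ← hV.image_interior, hT t ht u hu hne', Set.image_empty]

theorem Scales.isLarge {V : Equiv.Perm Plane} (hV : Scales 1 V) {t : Set Plane} (h : IsLarge t) :
    IsLarge (V '' t) := by
  obtain ⟨W, hW, rfl⟩ := isLarge_iff.mp h
  exact isLarge_iff.mpr ⟨V * W, by simpa using hV.mul hW, by rw [Equiv.Perm.coe_mul, Set.image_comp]⟩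

theorem Scales.isSmall {V : Equiv.Perm Plane} (hV : Scales 1 V) {t : Set Plane} (h : IsSmall t) :
    IsSmall (V '' t) := by
  obtain ⟨W, hW, rfl⟩ := isSmall_iff.mp h
  exact isSmall_iff.mpr ⟨V * W, by simpa using hV.mul hW, by rw [Equiv.Perm.coe_mul, Set.image_comp]⟩

theorem Scales.isTile {V : Equiv.Perm Plane} (hV : Scales 1 V) {t : Set Plane} (h : IsTile t) :
    IsTile (V '' t) := h.imp hV.isLarge hV.isSmall

/-! ### The substitution rule on placements -/

/-- The rule in terms of placements of G. By rigidity a tile has exactly one placement, and its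
children arise by right multiplication with `f₁` and `f₂`. -/
theorem mem_substitute {T : TileSet} {t : Set Plane} : t ∈ substitute T ↔
    (∃ V, Scales (s ^ 2) V ∧ V '' G ∈ T ∧ t = (scS⁻¹ * V : Equiv.Perm Plane) '' G) ∨
    (∃ V d, Scales s V ∧ V '' G ∈ T ∧ t = (scS⁻¹ * V * f d : Equiv.Perm Plane) '' G) := by
  have e : ∀ (U : Plane ≃ᵢ Plane) (d : Digit), tau • (U '' (s • (f d '' G))) =
      (scS⁻¹ * (U.toEquiv * scS) * f d : Equiv.Perm Plane) '' G := by
    intro U d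
    rw [← image_scS_inv, ← image_scS, Equiv.Perm.coe_mul, Equiv.Perm.coe_mul, Equiv.Perm.coe_mul,
      Set.image_comp, Set.image_comp, Set.image_comp]
    rfl
  have e' : ∀ U : Plane ≃ᵢ Plane, U '' (s • G) = (U.toEquiv * scS : Equiv.Perm Plane) '' G := by
    intro U
    rw [← image_scS, Equiv.Perm.coe_mul, Set.image_comp]
    rfl
  constructor
  · rintro (⟨u, hu, hs, rfl⟩ | ⟨U, hU, h⟩)
    · obtain ⟨V, hV, rfl⟩ := isSmall_iff.mp hs
      exact Or.inl ⟨V, hV, hu, by rw [← image_scS_inv, Equiv.Perm.coe_mul, Set.image_comp]⟩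
    · refine Or.inr ⟨U.toEquiv * scS, ?_⟩
      have hsc : Scales s (U.toEquiv * scS) := by simpa using (scales_isometry U).mul scales_scS
      rw [e'] at hU
      rcases h with rfl | rfl
      · exact ⟨.one, hsc, hU, e U .one⟩
      · exact ⟨.two, hsc, hU, e U .two⟩
  · rintro (⟨V, hV, hT, rfl⟩ | ⟨V, d, hV, hT, rfl⟩)
    · exact Or.inl ⟨_, hT, isSmall_iff.mpr ⟨V, hV, rfl⟩, by
        rw [← image_scS_inv, Equiv.Perm.coe_mul, Set.image_comp]⟩
    · have h1 := hV.mul scales_scS.inv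
      rw [mul_inv_cancel₀ s_ne] at h1
      have h2 : V = h1.toIso.toEquiv * scS := by
        change V = V * scS⁻¹ * scS
        rw [inv_mul_cancel_right]
      refine Or.inr ⟨h1.toIso, ?_, ?_⟩
      · rw [e', ← h2]; exact hT
      · have h3 := e h1.toIso d
        rw [← h2] at h3
        rw [← h3]
        cases d
        · exact Or.inl rfl
        · exact Or.inr rfl

theorem scales_sub_small {V : Equiv.Perm Plane} (hV : Scales (s ^ 2) V) : Scales s (scS⁻¹ * V) := by
  have h := scales_scS.inv.mul hV
  rwa [sq, inv_mul_cancel_left₀ s_ne] at h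

theorem scales_sub_large {V : Equiv.Perm Plane} (hV : Scales s V) : Scales 1 (scS⁻¹ * V) := by
  have h := scales_scS.inv.mul hV
  rwa [inv_mul_cancel₀ s_ne] at h

theorem scales_sub_digit {V : Equiv.Perm Plane} (hV : Scales s V) (d : Digit) :
    Scales (s ^ d.val) (scS⁻¹ * V * f d) := by
  have h := (scales_sub_large hV).mul (scales_f d)
  rwa [one_mul] at h

theorem substitute_mono {S T : TileSet} (h : S ⊆ T) : substitute S ⊆ substitute T := by
  intro t ht
  rw [mem_substitute] at ht ⊢
  rcases ht with ⟨V, hV, hT, e⟩ | ⟨V, d, hV, hT, e⟩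
  · exact Or.inl ⟨V, hV, h hT, e⟩
  · exact Or.inr ⟨V, d, hV, h hT, e⟩

theorem mem_substitute_iff_exists {T : TileSet} {t : Set Plane} :
    t ∈ substitute T ↔ ∃ u ∈ T, t ∈ substitute {u} := by
  constructor
  · intro ht
    rw [mem_substitute] at ht
    rcases ht with ⟨V, hV, hT, e⟩ | ⟨V, d, hV, hT, e⟩
    · exact ⟨_, hT, mem_substitute.mpr (Or.inl ⟨V, hV, rfl, e⟩)⟩
    · exact ⟨_, hT, mem_substitute.mpr (Or.inr ⟨V, d, hV, rfl, e⟩)⟩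
  · rintro ⟨u, hu, ht⟩
    exact substitute_mono (Set.singleton_subset_iff.mpr hu) ht

theorem substitute_union (S T : TileSet) : substitute (S ∪ T) = substitute S ∪ substitute T := by
  ext t
  simp only [Set.mem_union, mem_substitute_iff_exists (T := S ∪ T), mem_substitute_iff_exists (T := S),
    mem_substitute_iff_exists (T := T), or_and_right, exists_or]

theorem substitute_iUnion {ι : Sort*} (S : ι → TileSet) :
    substitute (⋃ i, S i) = ⋃ i, substitute (S i) := by
  ext t
  rw [mem_substitute_iff_exists, Set.mem_iUnion]
  constructor
  · rintro ⟨u, hu, ht⟩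
    obtain ⟨i, hi⟩ := Set.mem_iUnion.mp hu
    exact ⟨i, mem_substitute_iff_exists.mpr ⟨u, hi, ht⟩⟩
  · rintro ⟨i, hi⟩
    obtain ⟨u, hu, ht⟩ := mem_substitute_iff_exists.mp hi
    exact ⟨u, Set.mem_iUnion.mpr ⟨i, hu⟩, ht⟩

/-- Enlarging conjugates an isometry by the homothety. One inclusion suffices, since the other one
is the same statement for `U⁻¹`. -/
theorem substitute_mapTiles {U : Equiv.Perm Plane} (hU : Scales 1 U) (T : TileSet) :
    substitute (mapTiles U T) = mapTiles (scS⁻¹ * U * scS : Equiv.Perm Plane) (substitute T) := by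
  have key : ∀ (U : Equiv.Perm Plane) (_ : Scales 1 U) (T : TileSet),
      mapTiles (scS⁻¹ * U * scS : Equiv.Perm Plane) (substitute T) ⊆ substitute (mapTiles U T) := by
    rintro U hU T _ ⟨t, ht, rfl⟩
    rw [mem_substitute] at ht ⊢
    rcases ht with ⟨V, hV, hT, rfl⟩ | ⟨V, d, hV, hT, rfl⟩
    · refine Or.inl ⟨U * V, by simpa using hU.mul hV, ⟨_, hT, ?_⟩, ?_⟩
      · rw [Equiv.Perm.coe_mul, Set.image_comp]
      · change (scS⁻¹ * U * scS : Equiv.Perm Plane) '' _ = _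
        rw [← Set.image_comp, ← Equiv.Perm.coe_mul]
        congr 2; group
    · refine Or.inr ⟨U * V, d, by simpa using hU.mul hV, ⟨_, hT, ?_⟩, ?_⟩
      · rw [Equiv.Perm.coe_mul, Set.image_comp]
      · change (scS⁻¹ * U * scS : Equiv.Perm Plane) '' _ = _
        rw [← Set.image_comp, ← Equiv.Perm.coe_mul]
        congr 2; group
  refine Set.Subset.antisymm ?_ (key U hU T)
  have hinv : Scales 1 U⁻¹ := by simpa using hU.inv
  have h := mapTiles_mono (φ := (scS⁻¹ * U * scS : Equiv.Perm Plane)) (key U⁻¹ hinv (mapTiles U T))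
  rw [mapTiles_mul, mapTiles_mul, inv_mul_cancel, mapTiles_one] at h
  have e : (scS⁻¹ * U * scS * (scS⁻¹ * U⁻¹ * scS) : Equiv.Perm Plane) = 1 := by group
  rwa [e, mapTiles_one] at h

theorem isTile_of_mem_substitute {T : TileSet} {t : Set Plane} (ht : t ∈ substitute T) :
    IsTile t := by
  rcases mem_substitute.mp ht with ⟨V, hV, -, rfl⟩ | ⟨V, d, hV, -, rfl⟩
  · exact Or.inl (isLarge_iff.mpr ⟨_, scales_sub_small hV, rfl⟩)
  · have h := scales_sub_digit hV d
    cases d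
    · exact Or.inl (isLarge_iff.mpr ⟨_, by simpa [Digit.val] using h, rfl⟩)
    · exact Or.inr (isSmall_iff.mpr ⟨_, by simpa [Digit.val] using h, rfl⟩)

theorem interior_coord_eq (i : Fin 2) (c : ℝ) : interior {p : Plane | p i = c} = ∅ := by
  rw [Set.eq_empty_iff_forall_notMem]
  intro p hp
  have hc : Continuous fun t : ℝ => p + t • EuclideanSpace.single i (1 : ℝ) := by fun_prop
  have h := (isOpen_interior.preimage hc).mem_nhds (x := (0 : ℝ)) (by simpa using hp)
  obtain ⟨ε, hε, hb⟩ := Metric.mem_nhds_iff.mp h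
  have h1 : ε / 2 ∈ Metric.ball (0 : ℝ) ε := by
    rw [Metric.mem_ball, dist_zero_right, Real.norm_of_nonneg (by positivity)]; linarith
  have h2 := interior_subset (hb h1)
  have h0 := interior_subset hp
  simp only [Set.mem_ofPred_eq] at h0 h2
  simp [h0] at h2
  linarith

theorem isClosed_coord_eq (i : Fin 2) (c : ℝ) : IsClosed {p : Plane | p i = c} :=
  isClosed_eq (continuous_coord i) continuous_const

theorem interior_pieces : interior (f₁ '' G ∩ f₂ '' G) = ∅ := by
  have hs := s_bounds
  have hs2 := s_sq_bounds
  have h4 := s_four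
  have hsub : f₁ '' G ∩ f₂ '' G ⊆
      ({p : Plane | p 1 = s ^ 4} ∪ {p : Plane | p 0 = s ^ 5}) ∪ {p : Plane | p 1 = s ^ 2} := by
    rintro p ⟨h1, h2⟩
    rw [mem_f₁_image] at h1
    rw [mem_f₂_image] at h2
    simp only [Set.mem_union, Set.mem_ofPred_eq]
    rcases h1 with ⟨a, b, c, d⟩ | ⟨a, b, c, d⟩ <;> rcases h2 with ⟨a', b', c', d'⟩ | ⟨a', b', c', d'⟩
    · linarith
    · exact Or.inl (Or.inl (by linarith))
    · exact Or.inr (by linarith)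
    · exact Or.inl (Or.inr (by linarith))
  refine Set.subset_empty_iff.mp ((interior_mono hsub).trans ?_)
  rw [interior_union_isClosed_of_interior_empty
      ((isClosed_coord_eq _ _).union (isClosed_coord_eq _ _)) (interior_coord_eq _ _),
    interior_union_isClosed_of_interior_empty (isClosed_coord_eq _ _) (interior_coord_eq _ _),
    interior_coord_eq]

theorem Scales.interior_pieces {r : ℝ} {V : Equiv.Perm Plane} (hV : Scales r V) :
    interior ((V * f₁ : Equiv.Perm Plane) '' G ∩ (V * f₂ : Equiv.Perm Plane) '' G) = ∅ := by
  rw [Equiv.Perm.coe_mul, Equiv.Perm.coe_mul, Set.image_comp, Set.image_comp,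
    ← Set.image_inter V.injective, ← hV.image_interior, Ammann.interior_pieces, Set.image_empty]

theorem image_G_eq_union (V : Equiv.Perm Plane) :
    V '' G = (V * f₁ : Equiv.Perm Plane) '' G ∪ (V * f₂ : Equiv.Perm Plane) '' G := by
  conv_lhs => rw [G_eq_union]
  rw [Set.image_union, Equiv.Perm.coe_mul, Equiv.Perm.coe_mul, Set.image_comp, Set.image_comp]

theorem image_f_subset (V : Equiv.Perm Plane) (d : Digit) :
    (V * f d : Equiv.Perm Plane) '' G ⊆ V '' G := by
  rw [image_G_eq_union V]
  cases d
  · exact Set.subset_union_left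
  · exact Set.subset_union_right

theorem subset_of_mem_substitute_singleton {t u : Set Plane} (h : t ∈ substitute {u}) :
    t ⊆ (scS⁻¹ : Equiv.Perm Plane) '' u := by
  rcases mem_substitute.mp h with ⟨V, hV, hT, rfl⟩ | ⟨V, d, hV, hT, rfl⟩
  · rw [← (hT : V '' G = u), Equiv.Perm.coe_mul, Set.image_comp]
  · rw [← (hT : V '' G = u), ← Set.image_comp, ← Equiv.Perm.coe_mul]
    exact image_f_subset _ d

theorem noOverlap_substitute {T : TileSet} (hT : NoOverlap T) : NoOverlap (substitute T) := by
  intro t ht u hu hne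
  obtain ⟨t', ht', h1⟩ := mem_substitute_iff_exists.mp ht
  obtain ⟨u', hu', h2⟩ := mem_substitute_iff_exists.mp hu
  by_cases h : t' = u'
  · subst h
    rcases mem_substitute.mp h1 with ⟨V, hV, hT, rfl⟩ | ⟨V, d, hV, hT, rfl⟩ <;>
    rcases mem_substitute.mp h2 with ⟨W, hW, hT', rfl⟩ | ⟨W, d', hW, hT', rfl⟩
    · obtain rfl := hV.eq_of_image hW (hT.trans hT'.symm)
      exact (hne rfl).elim
    · obtain rfl := hV.eq_of_image hW (hT.trans hT'.symm)
      exact absurd (hV.ratio_eq hW) s_sq_lt.ne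
    · obtain rfl := hV.eq_of_image hW (hT.trans hT'.symm)
      exact absurd (hV.ratio_eq hW) s_sq_lt.ne'
    · obtain rfl := hV.eq_of_image hW (hT.trans hT'.symm)
      have h3 := (scales_sub_large hV).interior_pieces
      cases d <;> cases d'
      · exact (hne rfl).elim
      · exact h3
      · rw [Set.inter_comm]; exact h3
      · exact (hne rfl).elim
  · have h3 := Set.inter_subset_inter (subset_of_mem_substitute_singleton h1)
      (subset_of_mem_substitute_singleton h2)
    rw [← Set.image_inter (Equiv.injective _)] at h3
    refine Set.subset_empty_iff.mp ((interior_mono h3).trans ?_)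
    rw [← scales_scS_inv.image_interior, hT t' ht' u' hu' h, Set.image_empty]

theorem sUnion_substitute {T : TileSet} (hT : ∀ t ∈ T, IsTile t) :
    ⋃₀ substitute T = (scS⁻¹ : Equiv.Perm Plane) '' ⋃₀ T := by
  apply Set.Subset.antisymm
  · rintro p ⟨t, ht, hp⟩
    obtain ⟨u, hu, h⟩ := mem_substitute_iff_exists.mp ht
    exact Set.image_mono (Set.subset_sUnion_of_mem hu) (subset_of_mem_substitute_singleton h hp)
  · rintro _ ⟨p, ⟨t, ht, hp⟩, rfl⟩
    rcases hT t ht with h | h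
    · obtain ⟨V, hV, rfl⟩ := isLarge_iff.mp h
      have h1 : scS⁻¹ p ∈ (scS⁻¹ * V : Equiv.Perm Plane) '' G := by
        rw [Equiv.Perm.coe_mul, Set.image_comp]; exact ⟨p, hp, rfl⟩
      rw [image_G_eq_union] at h1
      rcases h1 with h1 | h1
      · exact ⟨_, mem_substitute.mpr (Or.inr ⟨V, .one, hV, ht, rfl⟩), h1⟩
      · exact ⟨_, mem_substitute.mpr (Or.inr ⟨V, .two, hV, ht, rfl⟩), h1⟩
    · obtain ⟨V, hV, rfl⟩ := isSmall_iff.mp h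
      refine ⟨_, mem_substitute.mpr (Or.inl ⟨V, hV, ht, rfl⟩), ?_⟩
      rw [Equiv.Perm.coe_mul, Set.image_comp]; exact ⟨p, hp, rfl⟩

/-! ### Local finiteness -/

theorem image_mul_G (V W : Equiv.Perm Plane) (A : Set Plane) :
    (V * W : Equiv.Perm Plane) '' A = V '' (W '' A) := by rw [Equiv.Perm.coe_mul, Set.image_comp]

theorem Scales.image_ball {r : ℝ} {V : Equiv.Perm Plane} (hV : Scales r V) (c : Plane) (δ : ℝ) :
    Metric.ball (V c) (r * δ) ⊆ V '' Metric.ball c δ := by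
  intro x hx
  refine ⟨V⁻¹ x, ?_, perm_apply_inv V x⟩
  have h := hV.2 (V⁻¹ x) c
  rw [perm_apply_inv] at h
  rw [Metric.mem_ball, h] at hx
  exact lt_of_mul_lt_mul_left hx hV.1.le

/-- Every tile contains a disc of a fixed radius. -/
theorem exists_ball : ∃ δ > 0, ∀ t, IsTile t → ∃ c ∈ t, Metric.ball c δ ⊆ interior t := by
  obtain ⟨c, hc⟩ := scales_one.nonempty_interior
  rw [Equiv.Perm.coe_one, Set.image_id] at hc
  obtain ⟨ε, hε, hb⟩ := Metric.isOpen_iff.mp isOpen_interior c hc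
  have key : ∀ {r : ℝ} {V : Equiv.Perm Plane}, Scales r V → s ^ 2 ≤ r →
      ∃ c ∈ V '' G, Metric.ball c (s ^ 2 * ε) ⊆ interior (V '' G) := fun {r V} hV hr =>
    ⟨V c, ⟨c, interior_subset hc, rfl⟩, by
      rw [← hV.image_interior]
      exact (Metric.ball_subset_ball (mul_le_mul_of_nonneg_right hr hε.le)).trans
        ((hV.image_ball c ε).trans (Set.image_mono hb))⟩
  refine ⟨s ^ 2 * ε, mul_pos (pow_pos s_pos 2) hε, fun t ht => ?_⟩
  rcases ht with h | h
  · obtain ⟨V, hV, rfl⟩ := isLarge_iff.mp h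
    exact key hV s_sq_lt.le
  · obtain ⟨V, hV, rfl⟩ := isSmall_iff.mp h
    exact key hV le_rfl

theorem IsTile.diam_le {t : Set Plane} (ht : IsTile t) {p q : Plane} (hp : p ∈ t) (hq : q ∈ t) :
    dist p q ≤ 2 := by
  have key : ∀ {r : ℝ} {V : Equiv.Perm Plane}, Scales r V → r ≤ 1 → ∀ p ∈ V '' G, ∀ q ∈ V '' G,
      dist p q ≤ 2 := by
    rintro r V hV hr _ ⟨p, hp, rfl⟩ _ ⟨q, hq, rfl⟩
    rw [hV.2]
    have h := dist_sq_le_of_mem_G hp hq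
    have h2 : dist p q ≤ 2 := by nlinarith [s_sq_bounds.2, dist_nonneg (x := p) (y := q)]
    nlinarith [dist_nonneg (x := p) (y := q)]
  rcases ht with h | h
  · obtain ⟨V, hV, rfl⟩ := isLarge_iff.mp h
    exact key hV s_lt_one.le p hp q hq
  · obtain ⟨V, hV, rfl⟩ := isSmall_iff.mp h
    exact key hV (s_sq_lt.trans s_lt_one).le p hp q hq

/-- Every tile contains a disc of a fixed radius δ. The centres of the discs in question lie in a
bounded set, which has a finite δ/2-net; two tiles assigned to the same net point would overlap. -/
theorem finite_touching {T : TileSet} (ht : ∀ t ∈ T, IsTile t) (hT : NoOverlap T) {B : Set Plane}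
    (hB : Bornology.IsBounded B) : {t ∈ T | (t ∩ B).Nonempty}.Finite := by
  obtain ⟨δ, hδ, hball⟩ := exists_ball
  obtain ⟨R, hR⟩ := hB.subset_closedBall (0 : Plane)
  have htb : TotallyBounded (Metric.closedBall (0 : Plane) (R + 2)) :=
    (isCompact_closedBall _ _).totallyBounded
  obtain ⟨F, hF, hcov⟩ := Metric.totallyBounded_iff.mp htb (δ / 2) (half_pos hδ)
  have hex : ∀ t ∈ {t ∈ T | (t ∩ B).Nonempty}, ∃ y ∈ F, ∃ c ∈ t, Metric.ball c δ ⊆ interior t ∧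
      dist c y < δ / 2 := by
    rintro t ⟨htT, p, hpt, hpB⟩
    obtain ⟨c, hct, hc⟩ := hball t (ht t htT)
    have h1 := (ht t htT).diam_le hct hpt
    have h2 : dist p 0 ≤ R := hR hpB
    have h3 : c ∈ Metric.closedBall (0 : Plane) (R + 2) := by
      rw [Metric.mem_closedBall]
      linarith [dist_triangle c p 0]
    obtain ⟨y, hy, hcy⟩ := Set.mem_iUnion₂.mp (hcov h3)
    exact ⟨y, hy, c, hct, hc, hcy⟩
  choose! y hy using hex
  refine Set.Finite.of_injOn (f := y) (fun t h => (hy t h).1) ?_ hF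
  intro t h u h' e
  obtain ⟨-, c, hct, hc, hcy⟩ := hy t h
  obtain ⟨-, d, hdu, hd, hdy⟩ := hy u h'
  rw [← e] at hdy
  refine hT.eq h.1 h'.1 (ht u h'.1).regular (hc ?_) hdu
  rw [Metric.mem_ball]
  linarith [dist_triangle_right d c (y t)]

theorem isClosed_sUnion {T : TileSet} (ht : ∀ t ∈ T, IsTile t) (hT : NoOverlap T) :
    IsClosed (⋃₀ T) := by
  rw [Set.sUnion_eq_iUnion]
  refine LocallyFinite.isClosed_iUnion (fun p => ?_) fun t => (ht t t.2).isCompact.isClosed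
  refine ⟨Metric.ball p 1, Metric.ball_mem_nhds p one_pos, ?_⟩
  refine Set.Finite.of_finite_image ((finite_touching ht hT
    (Metric.isBounded_ball (x := p) (r := 1))).subset ?_) Subtype.val_injective.injOn
  rintro _ ⟨t, h, rfl⟩
  exact ⟨t.2, h⟩

theorem countable_of_noOverlap {T : TileSet} (ht : ∀ t ∈ T, IsTile t) (hT : NoOverlap T) :
    T.Countable := by
  refine (Set.countable_iUnion fun n : ℕ => (finite_touching ht hT
    (Metric.isBounded_closedBall (x := (0 : Plane)) (r := n))).countable).mono fun t h => ?_
  obtain ⟨p, hp⟩ := (ht t h).nonempty_interior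
  obtain ⟨n, hn⟩ := exists_nat_ge (dist p 0)
  exact Set.mem_iUnion.mpr ⟨n, h, p, interior_subset hp, hn⟩

/-! ### Partners and desubstitution -/

/-- By `decomposition_unique`, a small and a large tile that form a bee are its two standard pieces,
so a single isometry places both. -/
theorem isPartner_iff {T : TileSet} {a b : Set Plane} : IsPartner T a b ↔
    ∃ V, Scales 1 V ∧ a = (V * f₂ : Equiv.Perm Plane) '' G ∧ b = (V * f₁ : Equiv.Perm Plane) '' G ∧
      a ∈ T ∧ b ∈ T := by
  constructor
  · rintro ⟨ha, hb, hsa, hlb, hc⟩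
    obtain ⟨V, hV, e⟩ := congruent_G_iff.mp hc
    obtain ⟨A, hA, rfl⟩ := isSmall_iff.mp hsa
    obtain ⟨B, hB, rfl⟩ := isLarge_iff.mp hlb
    have h1 : Scales (s ^ 2) (V⁻¹ * A) := by simpa using hV.inv.mul hA
    have h2 : Scales s (V⁻¹ * B) := by simpa using hV.inv.mul hB
    have h3 : (V⁻¹ * A : Equiv.Perm Plane) '' G ∪ (V⁻¹ * B : Equiv.Perm Plane) '' G = G := by
      rw [image_mul_G, image_mul_G, ← Set.image_union, ← e, ← image_mul_G, inv_mul_cancel,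
        Equiv.Perm.coe_one, Set.image_id]
    obtain ⟨e1, e2⟩ := decomposition_unique h1 h2 h3
    rw [inv_mul_eq_iff_eq_mul] at e1 e2
    subst e1 e2
    exact ⟨V, hV, rfl, rfl, ha, hb⟩
  · rintro ⟨V, hV, rfl, rfl, ha, hb⟩
    refine ⟨ha, hb, isSmall_iff.mpr ⟨_, by simpa using hV.mul scales_f₂, rfl⟩,
      isLarge_iff.mpr ⟨_, by simpa using hV.mul scales_f₁, rfl⟩,
      congruent_G_iff.mpr ⟨V, hV, ?_⟩⟩
    rw [image_G_eq_union V, Set.union_comm]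

/-- The two pieces of the copy `V(G)` belong to `T`. -/
def Pair (T : TileSet) (V : Equiv.Perm Plane) : Prop :=
  Scales 1 V ∧ (V * f₁ : Equiv.Perm Plane) '' G ∈ T ∧ (V * f₂ : Equiv.Perm Plane) '' G ∈ T

theorem Pair.isPartner {T : TileSet} {V : Equiv.Perm Plane} (h : Pair T V) :
    IsPartner T ((V * f₂ : Equiv.Perm Plane) '' G) ((V * f₁ : Equiv.Perm Plane) '' G) :=
  isPartner_iff.mpr ⟨V, h.1, rfl, rfl, h.2.2, h.2.1⟩

theorem Pair.scales_one {T : TileSet} {V : Equiv.Perm Plane} (h : Pair T V) :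
    Scales s (V * f₁) := by simpa using h.1.mul scales_f₁

theorem Pair.scales_two {T : TileSet} {V : Equiv.Perm Plane} (h : Pair T V) :
    Scales (s ^ 2) (V * f₂) := by simpa using h.1.mul scales_f₂

/-- Desubstitution: unite the partners, keep the unpartnered large tiles, and shrink by `s`. -/
def desub (T : TileSet) : TileSet :=
  {t | ∃ V, Pair T V ∧ t = (scS * V : Equiv.Perm Plane) '' G} ∪
  {t | ∃ V, Scales s V ∧ V '' G ∈ T ∧ (∀ W, Pair T W → V ≠ W * f₁) ∧
    t = (scS * V : Equiv.Perm Plane) '' G}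

/-- A small tile of a substituted collection can only be a second child, and its placement
determines that of the parent. The small piece alone thus reveals the parent. -/
theorem Pair.of_substitute {S : TileSet} {V : Equiv.Perm Plane} (h : Pair (substitute S) V) :
    (scS * V : Equiv.Perm Plane) '' G ∈ S := by
  have h2 := h.scales_two
  rcases mem_substitute.mp h.2.2 with ⟨W, hW, hS, e⟩ | ⟨W, d, hW, hS, e⟩
  · have e' := h2.eq_of_image (scales_sub_small hW) e
    rw [e'] at h2
    exact absurd (h2.ratio_eq (scales_sub_small hW)) s_sq_lt.ne
  · have e' := h2.eq_of_image (scales_sub_digit hW d) e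
    cases d
    · rw [e'] at h2
      have := h2.ratio_eq (scales_sub_digit hW .one)
      rw [Digit.val, pow_one] at this
      exact absurd this s_sq_lt.ne
    · have : V = scS⁻¹ * W := mul_right_cancel e'
      rwa [this, mul_inv_cancel_left]

theorem scales_scS_mul {V : Equiv.Perm Plane} (hV : Scales s V) : Scales (s ^ 2) (scS * V) := by
  simpa [sq] using scales_scS.mul hV

theorem Scales.scS_mul {V : Equiv.Perm Plane} (hV : Scales 1 V) : Scales s (scS * V) := by
  simpa using scales_scS.mul hV

theorem pair_substitute {S : TileSet} {V : Equiv.Perm Plane} (hV : Scales s V) (h : V '' G ∈ S) :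
    Pair (substitute S) (scS⁻¹ * V) :=
  ⟨scales_sub_large hV, mem_substitute.mpr (Or.inr ⟨V, .one, hV, h, rfl⟩),
    mem_substitute.mpr (Or.inr ⟨V, .two, hV, h, rfl⟩)⟩

theorem Scales.not_subset_of_lt {r r' : ℝ} {V W : Equiv.Perm Plane} (hV : Scales r V)
    (hW : Scales r' W) {S : TileSet} (hS : NoOverlap S) (h1 : V '' G ∈ S) (h2 : W '' G ∈ S)
    (h : V '' G ⊆ W '' G) (hr : r < r') : False := by
  obtain ⟨p, hp⟩ := hV.nonempty_interior
  have := hS.eq h1 h2 hW.regular hp (h (interior_subset hp))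
  have e := hV.eq_of_image hW this
  subst e
  exact hr.ne (hV.ratio_eq hW)

/-- Large tiles come back as pairs, small ones as large tiles without partner. A small tile whose
enlargement had a partner would lie inside a large tile of `S`. -/
theorem desub_substitute {S : TileSet} (ht : ∀ t ∈ S, IsTile t) (hS : NoOverlap S) :
    desub (substitute S) = S := by
  apply Set.Subset.antisymm
  · rintro t (⟨V, hV, rfl⟩ | ⟨V, hV, hVS, hno, rfl⟩)
    · exact hV.of_substitute
    · rcases mem_substitute.mp hVS with ⟨W, hW, hWS, e⟩ | ⟨W, d, hW, hWS, e⟩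
      · rw [hV.eq_of_image (scales_sub_small hW) e, mul_inv_cancel_left]
        exact hWS
      · exfalso
        have e' := hV.eq_of_image (scales_sub_digit hW d) e
        cases d
        · exact hno _ (pair_substitute hW hWS) e'
        · rw [e'] at hV
          exact s_sq_lt.ne' (hV.ratio_eq (scales_sub_digit hW .two))
  · intro t h
    rcases ht t h with hl | hs
    · obtain ⟨V, hV, rfl⟩ := isLarge_iff.mp hl
      exact Or.inl ⟨_, pair_substitute hV h, by rw [mul_inv_cancel_left]⟩
    · obtain ⟨V, hV, rfl⟩ := isSmall_iff.mp hs
      refine Or.inr ⟨scS⁻¹ * V, scales_sub_small hV, mem_substitute.mpr (Or.inl ⟨V, hV, h, rfl⟩), ?_,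
        by rw [mul_inv_cancel_left]⟩
      intro W hW e
      refine hV.not_subset_of_lt hW.1.scS_mul hS h hW.of_substitute ?_ s_sq_lt
      rw [inv_mul_eq_iff_eq_mul] at e
      rw [e, ← mul_assoc]
      exact image_f_subset (scS * W) .one

theorem isTile_of_mem_desub {T : TileSet} {t : Set Plane} (h : t ∈ desub T) : IsTile t := by
  rcases h with ⟨V, hV, rfl⟩ | ⟨V, hV, -, -, rfl⟩
  · exact Or.inl (isLarge_iff.mpr ⟨_, hV.1.scS_mul, rfl⟩)
  · exact Or.inr (isSmall_iff.mpr ⟨_, scales_scS_mul hV, rfl⟩)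

/-- Every small tile of `T` has a partner. -/
def Partnered (T : TileSet) : Prop :=
  ∀ A, Scales (s ^ 2) A → A '' G ∈ T → ∃ V, Pair T V ∧ A = V * f₂

theorem substitute_desub {T : TileSet} (ht : ∀ t ∈ T, IsTile t) (hp : Partnered T) :
    substitute (desub T) = T := by
  apply Set.Subset.antisymm
  · intro t h
    rcases mem_substitute.mp h with ⟨W, hW, hS, rfl⟩ | ⟨W, d, hW, hS, rfl⟩
    · rcases hS with ⟨V, hV, e⟩ | ⟨V, hV, hVT, -, e⟩
      · exfalso
        have e' := hW.eq_of_image hV.1.scS_mul e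
        rw [e'] at hW
        exact s_sq_lt.ne (hW.ratio_eq hV.1.scS_mul)
      · rw [hW.eq_of_image (scales_scS_mul hV) e, inv_mul_cancel_left]
        exact hVT
    · rcases hS with ⟨V, hV, e⟩ | ⟨V, hV, hVT, -, e⟩
      · rw [hW.eq_of_image hV.1.scS_mul e, inv_mul_cancel_left]
        cases d
        · exact hV.2.1
        · exact hV.2.2
      · exfalso
        have e' := hW.eq_of_image (scales_scS_mul hV) e
        rw [e'] at hW
        exact s_sq_lt.ne' (hW.ratio_eq (scales_scS_mul hV))
  · have hpair : ∀ V, Pair T V → ∀ d, (V * f d : Equiv.Perm Plane) '' G ∈ substitute (desub T) := by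
      intro V hV d
      refine mem_substitute.mpr (Or.inr ⟨scS * V, d, hV.1.scS_mul, Or.inl ⟨V, hV, rfl⟩, ?_⟩)
      rw [inv_mul_cancel_left]
    intro t h
    rcases ht t h with hl | hs
    · obtain ⟨V, hV, rfl⟩ := isLarge_iff.mp hl
      by_cases hW : ∃ W, Pair T W ∧ V = W * f₁
      · obtain ⟨W, hW, rfl⟩ := hW
        exact hpair W hW .one
      · push Not at hW
        refine mem_substitute.mpr (Or.inl ⟨scS * V, scales_scS_mul hV, Or.inr ⟨V, hV, h, hW, rfl⟩, ?_⟩)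
        rw [inv_mul_cancel_left]
    · obtain ⟨A, hA, rfl⟩ := isSmall_iff.mp hs
      obtain ⟨V, hV, rfl⟩ := hp A hA h
      exact hpair V hV .two

theorem sUnion_desub {T : TileSet} (ht : ∀ t ∈ T, IsTile t) (hp : Partnered T) :
    ⋃₀ desub T = scS '' ⋃₀ T := by
  have h := sUnion_substitute (T := desub T) fun t h => isTile_of_mem_desub h
  rw [substitute_desub ht hp] at h
  rw [h, ← image_mul_G, mul_inv_cancel, Equiv.Perm.coe_one, Set.image_id]

/-- Two tiles of the desubstitution with a common child agree. -/
theorem eq_of_common_child {T : TileSet}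
    {P Q c : Set Plane} (hP : P ∈ desub T) (hQ : Q ∈ desub T) (h1 : c ∈ substitute {P})
    (h2 : c ∈ substitute {Q}) : P = Q := by
  have key : ∀ P ∈ desub T, c ∈ substitute {P} →
      (∃ V d, Pair T V ∧ P = (scS * V : Equiv.Perm Plane) '' G ∧
        c = (V * f d : Equiv.Perm Plane) '' G) ∨
      (∃ V, Scales s V ∧ (∀ W, Pair T W → V ≠ W * f₁) ∧ P = (scS * V : Equiv.Perm Plane) '' G ∧
        c = V '' G) := by
    intro P hP hc
    rcases hP with ⟨V, hV, rfl⟩ | ⟨V, hV, hVT, hno, rfl⟩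
    · left
      rcases mem_substitute.mp hc with ⟨W, hW, hS, rfl⟩ | ⟨W, d, hW, hS, rfl⟩
      · exfalso
        have e' := hW.eq_of_image hV.1.scS_mul hS
        rw [e'] at hW
        exact s_sq_lt.ne (hW.ratio_eq hV.1.scS_mul)
      · exact ⟨V, d, hV, rfl, by rw [hW.eq_of_image hV.1.scS_mul hS, inv_mul_cancel_left]⟩
    · right
      rcases mem_substitute.mp hc with ⟨W, hW, hS, rfl⟩ | ⟨W, d, hW, hS, rfl⟩
      · exact ⟨V, hV, hno, rfl,
          by rw [hW.eq_of_image (scales_scS_mul hV) hS, inv_mul_cancel_left]⟩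
      · exfalso
        have e' := hW.eq_of_image (scales_scS_mul hV) hS
        rw [e'] at hW
        exact s_sq_lt.ne' (hW.ratio_eq (scales_scS_mul hV))
  have hsc : ∀ {V}, Pair T V → ∀ d, Scales (s ^ d.val) (V * f d) := fun hV d => by
    simpa using hV.1.mul (scales_f d)
  have mixed : ∀ V d W, Pair T V → Scales s W → (∀ X, Pair T X → W ≠ X * f₁) →
      (V * f d : Equiv.Perm Plane) '' G = W '' G → False := by
    intro V d W hV hW hno e
    have e' := (hsc hV d).eq_of_image hW e
    cases d
    · exact hno V hV e'.symm
    · have h2 := hsc hV .two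
      rw [e'] at h2
      exact s_sq_lt.ne (h2.ratio_eq hW)
  rcases key P hP h1 with ⟨V, d, hV, rfl, hc⟩ | ⟨V, hV, hno, rfl, hc⟩ <;>
  rcases key Q hQ h2 with ⟨V', d', hV', rfl, hc'⟩ | ⟨V', hV', hno', rfl, hc'⟩
  · have e := (hsc hV d).eq_of_image (hsc hV' d') (hc ▸ hc')
    cases d <;> cases d'
    · rw [mul_right_cancel e]
    · have h2 := hsc hV .one
      rw [e] at h2
      have := h2.ratio_eq (hsc hV' .two)
      rw [Digit.val, pow_one] at this
      exact absurd this s_sq_lt.ne'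
    · have h2 := hsc hV .two
      rw [e] at h2
      have := h2.ratio_eq (hsc hV' .one)
      rw [Digit.val, Digit.val, pow_one] at this
      exact absurd this s_sq_lt.ne
    · rw [mul_right_cancel e]
  · exact (mixed V d V' hV hV' hno' (hc ▸ hc')).elim
  · exact (mixed V' d' V hV' hV hno (hc' ▸ hc)).elim
  · rw [hV.eq_of_image hV' (hc ▸ hc')]

/-- If two parents overlap, then a child of one overlaps a child of the other. These children are
equal because `T` has no overlaps, and a common child determines the parent. -/
theorem noOverlap_desub {T : TileSet} (ht : ∀ t ∈ T, IsTile t) (hT : NoOverlap T)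
    (hp : Partnered T) : NoOverlap (desub T) := by
  intro P hP Q hQ hne
  by_contra hov
  rw [← ne_eq, ← Set.nonempty_iff_ne_empty] at hov
  have cov : ∀ P ∈ desub T, (scS⁻¹ : Equiv.Perm Plane) '' P ⊆ ⋃₀ substitute {P} := by
    intro P hP
    rw [sUnion_substitute (by rintro t rfl; exact isTile_of_mem_desub hP), Set.sUnion_singleton]
  have sub : ∀ P ∈ desub T, substitute {P} ⊆ T := by
    intro P hP
    conv_rhs => rw [← substitute_desub ht hp]
    exact substitute_mono (Set.singleton_subset_iff.mpr hP)
  obtain ⟨x, hx⟩ := hov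
  have hx' : (scS⁻¹ : Equiv.Perm Plane) x ∈ interior ((scS⁻¹ : Equiv.Perm Plane) '' (P ∩ Q)) := by
    rw [← scales_scS_inv.image_interior]; exact ⟨x, hx, rfl⟩
  set y := (scS⁻¹ : Equiv.Perm Plane) x
  obtain ⟨c, hc, hyc⟩ := cov P hP (Set.image_mono Set.inter_subset_left (interior_subset hx'))
  have hcT := sub P hP hc
  obtain ⟨z, hz1, hz2⟩ := mem_closure_iff.mp ((ht c hcT).regular hyc) _ isOpen_interior hx'
  obtain ⟨c', hc', hzc⟩ := cov Q hQ (Set.image_mono Set.inter_subset_right (interior_subset hz1))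
  have e := hT.eq hcT (sub Q hQ hc') (ht c' (sub Q hQ hc')).regular hz2 hzc
  exact hne (eq_of_common_child hP hQ hc (e ▸ hc'))

/-! ### Supertiles -/

theorem supertile_succ (n : ℕ) : supertile (n + 1) = substitute (supertile n) :=
  Function.iterate_succ_apply' _ _ _

theorem isTile_of_mem_supertile {n : ℕ} {t : Set Plane} (h : t ∈ supertile n) : IsTile t := by
  cases n with
  | zero =>
    rw [show t = scS '' G from h]
    exact Or.inl (isLarge_iff.mpr ⟨_, scales_scS, rfl⟩)
  | succ n =>
    rw [supertile_succ] at h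
    exact isTile_of_mem_substitute h

theorem noOverlap_supertile (n : ℕ) : NoOverlap (supertile n) := by
  induction n with
  | zero => rintro t rfl u rfl h; exact absurd rfl h
  | succ n ih => rw [supertile_succ]; exact noOverlap_substitute ih

theorem isTile_of_mem_copy {n : ℕ} {U : Equiv.Perm Plane} (hU : Scales 1 U) {t : Set Plane}
    (h : t ∈ mapTiles U (supertile n)) : IsTile t := by
  obtain ⟨u, hu, rfl⟩ := h
  exact hU.isTile (isTile_of_mem_supertile hu)

theorem scales_conj {U : Equiv.Perm Plane} (hU : Scales 1 U) : Scales 1 (scS⁻¹ * U * scS) := by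
  have := (scales_scS.inv.mul hU).mul scales_scS
  rwa [mul_one, inv_mul_cancel₀ s_ne] at this

theorem scales_conj' {U : Equiv.Perm Plane} (hU : Scales 1 U) : Scales 1 (scS * U * scS⁻¹) := by
  have := (scales_scS.mul hU).mul scales_scS.inv
  rwa [mul_one, mul_inv_cancel₀ s_ne] at this

theorem copy_succ {U : Equiv.Perm Plane} (hU : Scales 1 U) (n : ℕ) :
    mapTiles U (supertile (n + 1)) =
      substitute (mapTiles (scS * U * scS⁻¹ : Equiv.Perm Plane) (supertile n)) := by
  rw [substitute_mapTiles (scales_conj' hU), supertile_succ]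
  congr 2
  group

/-- The large piece `f₁(G)` of the bee is congruent to the initial tile; substitution carries this
inclusion to all levels. -/
theorem supertile_subset_succ (n : ℕ) :
    ∃ U, Scales 1 U ∧ supertile n ⊆ mapTiles U (supertile (n + 1)) := by
  induction n with
  | zero =>
    refine ⟨scS * f₁⁻¹, ?_, ?_⟩
    · have := scales_scS.mul scales_f₁.inv
      rwa [mul_inv_cancel₀ s_ne] at this
    · rintro t rfl
      refine ⟨f₁ '' G, mem_substitute.mpr (Or.inr ⟨scS, .one, scales_scS, rfl, ?_⟩), ?_⟩
      · rw [inv_mul_cancel, one_mul, f]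
      · change (scS * f₁⁻¹ : Equiv.Perm Plane) '' (f₁ '' G) = s • G
        rw [← image_mul_G, inv_mul_cancel_right]; rfl
  | succ n ih =>
    obtain ⟨U, hU, h⟩ := ih
    refine ⟨scS⁻¹ * U * scS, scales_conj hU, ?_⟩
    rw [supertile_succ (n + 1), ← substitute_mapTiles hU]
    conv_lhs => rw [supertile_succ n]
    exact substitute_mono h

theorem supertile_subset_add (n k : ℕ) :
    ∃ U, Scales 1 U ∧ supertile n ⊆ mapTiles U (supertile (n + k)) := by
  induction k with
  | zero => exact ⟨1, scales_one, by rw [mapTiles_one, add_zero]⟩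
  | succ k ih =>
    obtain ⟨U, hU, h⟩ := ih
    obtain ⟨W, hW, h'⟩ := supertile_subset_succ (n + k)
    refine ⟨U * W, by simpa using hU.mul hW, h.trans ?_⟩
    rw [← mapTiles_mul]
    exact mapTiles_mono h'

theorem small_of_substitute {S : TileSet} {A : Equiv.Perm Plane} (hA : Scales (s ^ 2) A)
    (h : A '' G ∈ substitute S) : ∃ W, Scales s W ∧ W '' G ∈ S ∧ A = scS⁻¹ * W * f₂ := by
  rcases mem_substitute.mp h with ⟨W, hW, hS, e⟩ | ⟨W, d, hW, hS, e⟩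
  · have e' := hA.eq_of_image (scales_sub_small hW) e
    rw [e'] at hA
    exact absurd (hA.ratio_eq (scales_sub_small hW)) s_sq_lt.ne
  · have e' := hA.eq_of_image (scales_sub_digit hW d) e
    cases d
    · rw [e'] at hA
      have := hA.ratio_eq (scales_sub_digit hW .one)
      rw [Digit.val, pow_one] at this
      exact absurd this s_sq_lt.ne
    · exact ⟨W, hW, hS, e'⟩

theorem pieces_touch (V : Equiv.Perm Plane) :
    ((V * f₁ : Equiv.Perm Plane) '' G ∩ (V * f₂ : Equiv.Perm Plane) '' G).Nonempty := by
  rw [image_mul_G, image_mul_G, ← Set.image_inter V.injective]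
  have h := s_pos
  refine Set.Nonempty.image _ ⟨pt 0 (s ^ 4), (mem_f₁_image _).mpr (Or.inl ?_),
    (mem_f₂_image _).mpr (Or.inr ?_)⟩
  · simp; exact ⟨h.le, by positivity⟩
  · simp
    exact ⟨by positivity, pow_le_one₀ h.le s_lt_one.le⟩

/-! ### Desubstitution preserves Ammann tilings -/

/-! ### Local structure of Ammann tilings -/

/-- A tiling that looks locally like large supertiles: around finitely many of its tiles it agrees
with a copy of a supertile. -/
structure LocallyAmmann (T : TileSet) : Prop where
  tile : ∀ t ∈ T, IsTile t
  noOverlap : NoOverlap T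
  loc : ∀ X ⊆ T, X.Finite → ∀ N, ∃ n ≥ N, ∃ U, Scales 1 U ∧
    ∀ x ∈ X, ∀ u, (x ∩ u).Nonempty → (u ∈ T ↔ u ∈ mapTiles U (supertile n))

theorem finite_neighbours {T : TileSet} (ht : ∀ t ∈ T, IsTile t) (hT : NoOverlap T) {X : TileSet}
    (hX : X ⊆ T) (hf : X.Finite) : {u ∈ T | ∃ x ∈ X, (x ∩ u).Nonempty}.Finite := by
  have hb : Bornology.IsBounded (⋃₀ X) :=
    (Bornology.isBounded_sUnion hf).mpr fun x hx => (ht x (hX hx)).isCompact.isBounded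
  refine (finite_touching ht hT hb).subset ?_
  rintro u ⟨hu, x, hx, p, hp1, hp2⟩
  exact ⟨hu, p, hp2, x, hx, hp1⟩

/-- A copy of a supertile that contains `X` and its neighbours exists by definition, and larger
supertiles contain it. Conversely, a tile of the copy that touches `X` belongs to `T`, because `T`
leaves no room for another tile. -/
theorem IsPlaneAmmann.locallyAmmann {T : TileSet} (h : IsPlaneAmmann T) : LocallyAmmann T := by
  obtain ⟨⟨hno, hcov⟩, ht, hfin⟩ := h
  replace ht : ∀ t ∈ T, IsTile t := ht
  refine ⟨ht, hno, fun X hX hXf N => ?_⟩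
  set F := {u ∈ T | ∃ x ∈ X, (x ∩ u).Nonempty} with hF
  obtain ⟨n, P, hP, U, hU⟩ := hfin F (finite_neighbours ht hno hX hXf) fun u hu => hu.1
  obtain ⟨W, hW, hsub⟩ := supertile_subset_add n N
  refine ⟨n + N, by omega, U.toEquiv * W, by simpa using (scales_isometry U).mul hW, ?_⟩
  have hFS : F ⊆ mapTiles (U.toEquiv * W : Equiv.Perm Plane) (supertile (n + N)) := by
    rw [← hU, ← mapTiles_mul]
    exact mapTiles_mono (hP.trans hsub)
  have hU1 : Scales 1 (U.toEquiv * W) := by simpa using (scales_isometry U).mul hW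
  rintro x hx u ⟨p, hpx, hpu⟩
  refine ⟨fun hu => hFS ⟨hu, x, hx, p, hpx, hpu⟩, fun hu => ?_⟩
  -- Near `p` there are only tiles of `F`. An interior point of `u` near `p` is covered by one of
  -- them, which belongs to the supertile as well and so equals `u`.
  have hcl : IsClosed (⋃₀ (T \ F)) :=
    isClosed_sUnion (fun t h => ht t h.1) (NoOverlap.mono hno Set.sdiff_subset)
  have hpn : p ∈ (⋃₀ (T \ F))ᶜ := by
    rintro ⟨v, hv, hpv⟩
    exact hv.2 ⟨hv.1, x, hx, p, hpx, hpv⟩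
  have hut : IsTile u := isTile_of_mem_copy hU1 hu
  obtain ⟨z, hz1, hz2⟩ := mem_closure_iff.mp (hut.regular hpu) _ hcl.isOpen_compl hpn
  obtain ⟨v, hv, hzv⟩ : z ∈ ⋃₀ T := hcov ▸ Set.mem_univ z
  have hvF : v ∈ F := by
    by_contra hvF
    exact hz1 ⟨v, ⟨hv, hvF⟩, hzv⟩
  rw [(hU1.noOverlap (noOverlap_supertile _)).eq hu (hFS hvF) (ht v hv).regular hz2 hzv]
  exact hv

theorem CongruentTilings.exists_scales {S T : TileSet} (h : CongruentTilings S T) :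
    ∃ U, Scales 1 U ∧ mapTiles U S = T := by
  obtain ⟨U, hU⟩ := h
  exact ⟨U.toEquiv, scales_isometry U, hU⟩

theorem Scales.congruentTilings {U : Equiv.Perm Plane} (hU : Scales 1 U) (S : TileSet) :
    CongruentTilings S (mapTiles U S) := ⟨hU.toIso, rfl⟩

theorem IsNestedUnion.tile {T : TileSet} (h : IsNestedUnion T) : ∀ t ∈ T, IsTile t := by
  obtain ⟨m, P, -, -, hc, rfl⟩ := h
  intro t ht
  obtain ⟨n, hn⟩ := Set.mem_iUnion.mp ht
  obtain ⟨U, hU, e⟩ := (hc n).exists_scales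
  exact isTile_of_mem_copy hU (e ▸ hn)

theorem finite_subset_of_monotone {P : ℕ → TileSet} (hP : Monotone P) {F : TileSet} (hF : F.Finite)
    (h : F ⊆ ⋃ n, P n) : ∃ n, F ⊆ P n := by
  have h' : ∀ t ∈ F, ∃ n, t ∈ P n := fun t ht => Set.mem_iUnion.mp (h ht)
  choose! k hk using h'
  obtain ⟨n, hn⟩ := (hF.image k).bddAbove
  exact ⟨n, fun t ht => hP (hn ⟨t, ht, rfl⟩) (hk t ht)⟩

theorem IsNestedUnion.locallyAmmann {T : TileSet} (h : IsNestedUnion T) (hno : NoOverlap T) :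
    LocallyAmmann T := by
  have ht := h.tile
  obtain ⟨m, P, hm, hP, hc, rfl⟩ := h
  refine ⟨ht, hno, fun X hX hXf N => ?_⟩
  obtain ⟨k, hk⟩ := finite_subset_of_monotone hP (finite_neighbours ht hno hX hXf) fun u hu => hu.1
  obtain ⟨U, hU, e⟩ := (hc (max k N)).exists_scales
  refine ⟨m (max k N), (le_max_right k N).trans (hm.id_le _), U, hU, ?_⟩
  intro x hx u hxu
  rw [e]
  exact ⟨fun hu => hP (le_max_left k N) (hk ⟨hu, x, hx, hxu⟩), fun hu => Set.mem_iUnion.mpr ⟨_, hu⟩⟩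

theorem IsAmmann.locallyAmmann {T : TileSet} (h : IsAmmann T) : LocallyAmmann T := by
  rcases h with h | ⟨h, D, -, hD⟩
  · exact h.1.locallyAmmann
  · exact h.locallyAmmann hD.1

theorem LocallyAmmann.partnered {T : TileSet} (h : LocallyAmmann T) : Partnered T := by
  intro A hA hAT
  obtain ⟨n, hn, U, hU, hloc⟩ := h.loc {A '' G} (by simpa using hAT) (Set.finite_singleton _) 1
  obtain ⟨n, rfl⟩ : ∃ k, n = k + 1 := ⟨n - 1, by omega⟩
  rw [copy_succ hU] at hloc
  have hne : (A '' G).Nonempty := ⟨_, _, mem_G_zero, rfl⟩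
  obtain ⟨W, hW, hWS, rfl⟩ := small_of_substitute hA
    ((hloc _ rfl _ (by rwa [Set.inter_self])).mp hAT)
  have hp := pair_substitute hW hWS
  exact ⟨_, ⟨hp.1, (hloc _ rfl _ (by rw [Set.inter_comm]; exact pieces_touch _)).mpr hp.2.1, hAT⟩,
    rfl⟩

theorem LocallyAmmann.substitute_desub {T : TileSet} (h : LocallyAmmann T) :
    substitute (desub T) = T := Ammann.substitute_desub h.tile h.partnered

theorem LocallyAmmann.noOverlap_desub {T : TileSet} (h : LocallyAmmann T) : NoOverlap (desub T) :=
  Ammann.noOverlap_desub h.tile h.noOverlap h.partnered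

theorem image_scS_univ : scS '' (Set.univ : Set Plane) = Set.univ :=
  Set.image_univ_of_surjective scS.surjective

theorem substitute_singleton_subset {T : TileSet} (h : LocallyAmmann T) {P : Set Plane}
    (hP : P ∈ desub T) : substitute {P} ⊆ T := by
  conv_rhs => rw [← h.substitute_desub]
  exact substitute_mono (Set.singleton_subset_iff.mpr hP)

/-- A finite set of parents has a finite set `X` of children. Around `X` the tiling agrees with a
copy of a supertile of level n + 1, and desubstituting this copy gives a copy of level n that
contains the parents. -/
theorem IsPlaneAmmann.desub {T : TileSet} (h : IsPlaneAmmann T) : IsPlaneAmmann (desub T) := by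
  have hl := h.locallyAmmann
  refine ⟨⟨hl.noOverlap_desub, ?_⟩, fun t => isTile_of_mem_desub, fun F hF hFT => ?_⟩
  · rw [sUnion_desub hl.tile hl.partnered, h.1.2, image_scS_univ]
  set X := ⋃ P ∈ F, substitute {P} with hX
  have hXT : X ⊆ T := Set.iUnion₂_subset fun P hP => substitute_singleton_subset hl (hFT hP)
  have hXf : X.Finite := by
    refine hF.biUnion fun P hP => ?_
    refine (finite_touching hl.tile hl.noOverlap (B := (scS⁻¹ : Equiv.Perm Plane) '' P) ?_).subset ?_
    · exact ((isTile_of_mem_desub (hFT hP)).isCompact.image scales_scS_inv.continuous).isBounded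
    · intro t ht
      have h2 := substitute_singleton_subset hl (hFT hP) ht
      obtain ⟨p, hp⟩ := (hl.tile t h2).nonempty_interior
      exact ⟨h2, p, interior_subset hp,
        subset_of_mem_substitute_singleton ht (interior_subset hp)⟩
  obtain ⟨n, hn, U, hU, hloc⟩ := hl.loc X hXT hXf 1
  obtain ⟨n, rfl⟩ : ∃ k, n = k + 1 := ⟨n - 1, by omega⟩
  rw [copy_succ hU] at hloc
  set U' := scS * U * scS⁻¹
  have hU' : Scales 1 U' := scales_conj' hU
  set S := mapTiles U' (supertile n)
  have hXS : ∀ x ∈ X, x ∈ substitute S := fun x hx => by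
    obtain ⟨p, hp⟩ := (hl.tile x (hXT hx)).nonempty_interior
    exact (hloc x hx x ⟨p, interior_subset hp, interior_subset hp⟩).mp (hXT hx)
  have hFS : F ⊆ S := by
    intro P hP
    rw [← desub_substitute (S := S) (fun t ht => isTile_of_mem_copy hU' ht)
      (hU'.noOverlap (noOverlap_supertile _))]
    have hmem : ∀ t ∈ substitute {P}, t ∈ X := fun t ht => Set.mem_biUnion hP ht
    rcases hFT hP with ⟨V, hV, rfl⟩ | ⟨V, hV, hVT, hno, rfl⟩
    · have hp := pair_substitute (S := {(scS * V : Equiv.Perm Plane) '' G}) hV.1.scS_mul rfl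
      rw [inv_mul_cancel_left] at hp
      exact Or.inl ⟨V, ⟨hV.1, hXS _ (hmem _ hp.2.1), hXS _ (hmem _ hp.2.2)⟩, rfl⟩
    · have hVX : V '' G ∈ X := hmem _ (mem_substitute.mpr (Or.inl ⟨scS * V, scales_scS_mul hV, rfl,
        by rw [inv_mul_cancel_left]⟩))
      refine Or.inr ⟨V, hV, hXS _ hVX, ?_, rfl⟩
      -- A partner inside the supertile would touch this child, hence belong to `T`, where the child
      -- has no partner.
      rintro W hW rfl
      exact hno W ⟨hW.1, hVT, (hloc _ hVX _ (pieces_touch W)).mpr hW.2.2⟩ rfl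
  refine ⟨n, mapTiles (U'⁻¹ : Equiv.Perm Plane) F, ?_, hU'.toIso, ?_⟩
  · rintro _ ⟨P, hP, rfl⟩
    obtain ⟨Q, hQ, rfl⟩ := hFS hP
    change (U'⁻¹ : Equiv.Perm Plane) '' (U' '' Q) ∈ _
    rwa [← image_mul_G, inv_mul_cancel, Equiv.Perm.coe_one, Set.image_id]
  · change mapTiles U' _ = _
    rw [mapTiles_mul, mul_inv_cancel, mapTiles_one]

/-! ### Substitution of nested unions and of reflected tilings -/

theorem CongruentTilings.substitute {S T : TileSet} (h : CongruentTilings S T) :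
    CongruentTilings (substitute S) (substitute T) := by
  obtain ⟨U, hU, rfl⟩ := h.exists_scales
  rw [substitute_mapTiles hU]
  exact (scales_conj hU).congruentTilings _

theorem IsNestedUnion.substitute {S : TileSet} (h : IsNestedUnion S) :
    IsNestedUnion (substitute S) := by
  obtain ⟨m, P, hm, hP, hc, rfl⟩ := h
  refine ⟨fun n => m n + 1, fun n => Ammann.substitute (P n), fun a b hab => by
    simpa using hm hab, fun a b hab => substitute_mono (hP hab), fun n => ?_, substitute_iUnion _⟩
  rw [supertile_succ]
  exact (hc n).substitute

theorem image_scS_inv_upperHalf : (scS⁻¹ : Equiv.Perm Plane) '' upperHalf = upperHalf := by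
  have h := tau_pos
  rw [image_scS_inv]
  ext p
  rw [Set.mem_smul_set_iff_inv_smul_mem₀ h.ne']
  simp [upperHalf, h]

theorem image_scS_inv_quadrant : (scS⁻¹ : Equiv.Perm Plane) '' quadrant = quadrant := by
  have h := tau_pos
  rw [image_scS_inv]
  ext p
  rw [Set.mem_smul_set_iff_inv_smul_mem₀ h.ne']
  simp [quadrant, h]

theorem IsTilingOf.substitute {S : TileSet} {D : Set Plane} (h : IsTilingOf S D)
    (ht : ∀ t ∈ S, IsTile t) :
    IsTilingOf (Ammann.substitute S) ((scS⁻¹ : Equiv.Perm Plane) '' D) :=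
  ⟨noOverlap_substitute h.1, by rw [sUnion_substitute ht, h.2]⟩

/-- The reflection `reflX` as a permutation. -/
def permX : Equiv.Perm Plane := ⟨reflX, reflX, fun p => plane_ext (by simp [reflX]) (by simp [reflX]),
  fun p => plane_ext (by simp [reflX]) (by simp [reflX])⟩

/-- The reflection `reflY` as a permutation. -/
def permY : Equiv.Perm Plane := ⟨reflY, reflY, fun p => plane_ext (by simp [reflY]) (by simp [reflY]),
  fun p => plane_ext (by simp [reflY]) (by simp [reflY])⟩

theorem coe_permX : ⇑permX = reflX := rfl

theorem coe_permY : ⇑permY = reflY := rfl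

theorem scales_permX : Scales 1 permX := Scales.of_sq one_pos fun x y => by
  rw [dist_sq, dist_sq]; simp [coe_permX, reflX]; ring

theorem scales_permY : Scales 1 permY := Scales.of_sq one_pos fun x y => by
  rw [dist_sq, dist_sq]; simp [coe_permY, reflY]; ring

theorem conj_permX : scS⁻¹ * permX * scS = permX := by
  rw [mul_assoc, inv_mul_eq_iff_eq_mul]
  ext1 p
  apply plane_ext <;> simp [coe_permX, reflX, scS_apply]

theorem conj_permY : scS⁻¹ * permY * scS = permY := by
  rw [mul_assoc, inv_mul_eq_iff_eq_mul]
  ext1 p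
  apply plane_ext <;> simp [coe_permY, reflY, scS_apply]

theorem substitute_reflX (S : TileSet) : substitute (mapTiles reflX S) = mapTiles reflX (substitute S) := by
  rw [← coe_permX, substitute_mapTiles scales_permX, conj_permX]

theorem substitute_reflY (S : TileSet) : substitute (mapTiles reflY S) = mapTiles reflY (substitute S) := by
  rw [← coe_permY, substitute_mapTiles scales_permY, conj_permY]

/-- The coordinate reflections commute with the homothety, so mirrored parts are substituted alike.
Used in contrapositive form: desubstitution does not lead to reflected tilings. -/
theorem IsReflected.substitute {T : TileSet} (h : IsReflected T) : IsReflected (substitute T) := by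
  rcases h with ⟨S, hS, hD, hc⟩ | ⟨S, hS, hD, hc⟩
  · left
    refine ⟨Ammann.substitute S, hS.substitute, ?_, ?_⟩
    · have := hD.substitute hS.tile
      rwa [image_scS_inv_upperHalf] at this
    · have := hc.substitute
      rwa [substitute_union, substitute_reflX] at this
  · right
    refine ⟨Ammann.substitute S, hS.substitute, ?_, ?_⟩
    · have := hD.substitute hS.tile
      rwa [image_scS_inv_quadrant] at this
    · have := hc.substitute
      rwa [substitute_union, substitute_union, substitute_union, substitute_reflX, substitute_reflY,
        ← mapTiles_comp, substitute_reflX, substitute_reflY, mapTiles_comp] at this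

/-! ### Desubstitution of nested unions -/

/-- If `f₂(G)` were the large piece of a bee, this bee would be the image of G under `f₂ * f₁⁻¹`.
Its small piece would then reach into `f₁(G)`. -/
theorem notch_subset {p : Plane} (hp : p ∈ rectOpen 0 (s ^ 3) 0 1) :
    (f₂ * f₁⁻¹ * f₂) p ∈ f₁ '' G := by
  obtain ⟨h1, h2, h3, h4⟩ := hp
  have hs := s_pos
  have h := tau_mul_s
  have hf := s_four
  have e0 : (f₂ * f₁⁻¹ * f₂) p 0 = s - s ^ 3 * p 1 := by
    change f₂ (f₁.symm (f₂ p)) 0 = _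
    simp [f₁]
    linear_combination s * (1 - s ^ 2 * p 1) * h
  have e1 : (f₂ * f₁⁻¹ * f₂) p 1 = s ^ 4 + s ^ 3 * p 0 := by
    change f₂ (f₁.symm (f₂ p)) 1 = _
    simp [f₁]
    linear_combination s ^ 3 * p 0 * h - hf
  rw [mem_f₁_image, e0, e1]
  right
  have hs3 : 0 < s ^ 3 := pow_pos hs 3
  refine ⟨?_, ?_, ?_, ?_⟩
  · have : s ^ 5 = s - s ^ 3 := by linear_combination s * hf
    nlinarith
  · nlinarith
  · positivity
  · have : s ^ 3 * s ^ 3 = s ^ 2 - s ^ 4 := by linear_combination s ^ 2 * hf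
    nlinarith

/-- A tile that used to be a second child cannot act as the large tile of a pair when the children
of its sibling are present: the small tile of that pair would overlap one of them. -/
theorem not_pair_of_notch {T : TileSet} (hT : NoOverlap T) {r : ℝ} {Z X : Equiv.Perm Plane}
    (hZ : Scales r Z) (h : ∀ d, (Z * f₁ * f d : Equiv.Perm Plane) '' G ∈ T) (hX : Pair T X)
    (e : Z * f₂ = X * f₁) : False := by
  have eX : X * f₂ = Z * (f₂ * f₁⁻¹ * f₂) := by
    rw [← mul_assoc, ← mul_assoc, e, mul_inv_cancel_right]
  have hs3 : 0 < s ^ 3 := pow_pos s_pos 3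
  have hp : pt (s ^ 3 / 2) (1 / 2) ∈ rectOpen 0 (s ^ 3) 0 1 := by
    simp [rectOpen, hs3]; norm_num
  set p := pt (s ^ 3 / 2) (1 / 2)
  have h1 : (X * f₂) p ∈ interior ((X * f₂ : Equiv.Perm Plane) '' G) := by
    rw [← hX.scales_two.image_interior]
    exact ⟨p, rectOpen_subset_interior Set.subset_union_right hp, rfl⟩
  have h2 : (X * f₂) p ∈ (Z * f₁ : Equiv.Perm Plane) '' G := by
    rw [eX, image_mul_G]
    exact ⟨_, notch_subset hp, rfl⟩
  have hsc : ∀ d, Scales (r * s * s ^ d.val) (Z * f₁ * f d) := fun d =>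
    (hZ.mul scales_f₁).mul (scales_f d)
  have hd : ∃ d, (X * f₂) p ∈ (Z * f₁ * f d : Equiv.Perm Plane) '' G := by
    rw [image_G_eq_union] at h2
    exact h2.elim (fun h => ⟨.one, h⟩) fun h => ⟨.two, h⟩
  obtain ⟨d, hd⟩ := hd
  have e2 := hX.scales_two.eq_of_image (hsc d) (hT.eq hX.2.2 (h d) (hsc d).regular h1 hd)
  have hr : r * s ^ 2 = s := by
    have h1 := hZ.mul scales_f₂
    rw [e] at h1
    exact h1.ratio_eq hX.scales_one
  cases d
  · have h3 := hX.scales_two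
    rw [e2] at h3
    have := h3.ratio_eq (hsc .one)
    rw [Digit.val, pow_one, mul_assoc, ← sq, hr] at this
    exact s_sq_lt.ne this
  -- The ratios leave only this case, in which `f₂` would equal `f₁ * f₁`. At the origin their first
  -- coordinates are 0 and s.
  · have e3 : X = Z * f₁ := mul_right_cancel e2
    rw [e3, mul_assoc] at e
    have e4 := congrArg (fun V : Equiv.Perm Plane => V (pt 0 0) 0) (mul_left_cancel e)
    simp at e4
    exact s_ne e4.symm

/-- Only the tiles of the copy are known here, so a partner from elsewhere in `T` has to be
excluded. As the level is at least one, each small tile of the copy has its sibling in the copy, and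
`not_pair_of_notch` applies. -/
theorem subset_desub_of_copy {T : TileSet} (hT : NoOverlap T) {U : Equiv.Perm Plane}
    (hU : Scales 1 U) {n : ℕ}
    (h : substitute (mapTiles U (supertile (n + 1))) ⊆ T) :
    mapTiles U (supertile (n + 1)) ⊆ desub T := by
  intro t ht
  rcases isTile_of_mem_copy hU ht with hl | hsm
  · obtain ⟨V, hV, rfl⟩ := isLarge_iff.mp hl
    have hp := pair_substitute hV ht
    exact Or.inl ⟨_, ⟨hp.1, h hp.2.1, h hp.2.2⟩, by rw [mul_inv_cancel_left]⟩
  · obtain ⟨V, hV, rfl⟩ := isSmall_iff.mp hsm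
    refine Or.inr ⟨scS⁻¹ * V, scales_sub_small hV,
      h (mem_substitute.mpr (Or.inl ⟨V, hV, ht, rfl⟩)), ?_, by rw [mul_inv_cancel_left]⟩
    intro X hX e
    have ht' := ht
    rw [copy_succ hU] at ht'
    obtain ⟨Y, hY, hYS, rfl⟩ := small_of_substitute hV ht'
    have hp := pair_substitute hY hYS
    rw [← copy_succ hU] at hp
    refine not_pair_of_notch hT (Z := scS⁻¹ * (scS⁻¹ * Y))
      (scales_scS.inv.mul (scales_sub_large hY)) (fun d => ?_) hX (by rw [← e]; group)
    refine h (mem_substitute.mpr (Or.inr ⟨scS⁻¹ * Y * f₁, d, hp.scales_one, hp.2.1, ?_⟩))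
    rw [mul_assoc scS⁻¹]

theorem IsNestedUnion.desub {T : TileSet} (h : IsNestedUnion T) (hT : NoOverlap T) :
    IsNestedUnion (desub T) := by
  obtain ⟨m, P, hm, hP, hc, rfl⟩ := h
  have hm2 : ∀ n, n ≤ m n := fun n => hm.id_le n
  choose U hU hUP using fun n => (hc (n + 2)).exists_scales
  -- The shift by two keeps the level of each desubstituted copy at least one, as
  -- `subset_desub_of_copy` requires.
  set m' : ℕ → ℕ := fun n => m (n + 2) - 2
  have hmm : ∀ n, m (n + 2) = m' n + 1 + 1 := fun n => by have := hm2 (n + 2); simp only [m']; omega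
  set Q : ℕ → TileSet :=
    fun n => mapTiles (scS * U n * scS⁻¹ : Equiv.Perm Plane) (supertile (m' n + 1))
  have hPQ : ∀ n, Ammann.substitute (Q n) = P (n + 2) := fun n => by
    rw [← hUP n, hmm n, copy_succ (hU n)]
  have hQt : ∀ n, ∀ t ∈ Q n, IsTile t := fun n t ht => isTile_of_mem_copy (scales_conj' (hU n)) ht
  have hQno : ∀ n, NoOverlap (Q n) := fun n =>
    (scales_conj' (hU n)).noOverlap (noOverlap_supertile _)
  have hQmono : Monotone Q := by
    refine monotone_nat_of_le_succ fun n => ?_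
    rw [← desub_substitute (hQt (n + 1)) (hQno (n + 1))]
    refine subset_desub_of_copy (noOverlap_substitute (hQno _)) (scales_conj' (hU n)) ?_
    change Ammann.substitute (Q n) ⊆ _
    rw [hPQ, hPQ]
    exact hP (by omega)
  have hU' : (⋃ n, P n) = Ammann.substitute (⋃ n, Q n) := by
    rw [substitute_iUnion]
    simp only [hPQ]
    exact (Monotone.iUnion_nat_add hP 2).symm
  have hno : NoOverlap (⋃ n, Q n) := by
    intro t ht u hu
    obtain ⟨i, hi⟩ := Set.mem_iUnion.mp ht
    obtain ⟨j, hj⟩ := Set.mem_iUnion.mp hu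
    exact hQno (max i j) t (hQmono (le_max_left i j) hi) u (hQmono (le_max_right i j) hj)
  refine ⟨fun n => m' n + 1, Q, ?_, hQmono, fun n => (scales_conj' (hU n)).congruentTilings _, ?_⟩
  · intro a b hab
    have h1 := hm (show a + 2 < b + 2 by omega)
    have h2 := hm2 (a + 2)
    simp only [m']
    omega
  · rw [hU', desub_substitute (fun t ht => by
      obtain ⟨i, hi⟩ := Set.mem_iUnion.mp ht
      exact hQt i t hi) hno]

theorem CongruentSets.scS {A D : Set Plane} (hA : (scS⁻¹ : Equiv.Perm Plane) '' A = A)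
    (h : CongruentSets A D) : CongruentSets A (Ammann.scS '' D) := by
  obtain ⟨U, rfl⟩ := h
  refine ⟨(scales_conj' (scales_isometry U)).toIso, ?_⟩
  rw [Scales.coe_toIso, image_mul_G, hA, image_mul_G]
  rfl

theorem IsAmmann.desub {T : TileSet} (h : IsAmmann T) : IsAmmann (desub T) := by
  have hl := h.locallyAmmann
  rcases h with ⟨h, hr⟩ | ⟨h, D, hD, hDT⟩
  · refine Or.inl ⟨h.desub, fun hr' => hr ?_⟩
    rw [← hl.substitute_desub]
    exact hr'.substitute
  · refine Or.inr ⟨h.desub hDT.1, scS '' D, ?_, hl.noOverlap_desub, ?_⟩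
    · exact hD.imp (CongruentSets.scS image_scS_inv_upperHalf) (CongruentSets.scS image_scS_inv_quadrant)
    · rw [sUnion_desub hl.tile hl.partnered, hDT.2]

/-! ### Relative positions and neighbourhood types, checked by computation -/

/-! ### Exact arithmetic in `ℤ[s²]` -/

/-- The pair `(a, b)` stands for the number `a + b s²`. -/
abbrev Zq : Type := ℤ × ℤ

/-- The real number denoted by a pair. -/
def zv (x : Zq) : ℝ := x.1 + x.2 * s ^ 2

/-- Multiplication of pairs, according to `s⁴ = 1 - s²`. -/
def zmul (x y : Zq) : Zq := (x.1 * y.1 + x.2 * y.2, x.1 * y.2 + x.2 * y.1 - x.2 * y.2)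

/-- A sufficient test for `zv x < zv y`. -/
def zlt (x y : Zq) : Bool :=
  decide (0 < 10000 * (y.1 - x.1) + (if x.2 ≤ y.2 then 6180 else 6181) * (y.2 - x.2))

theorem zv_add (x y : Zq) : zv (x + y) = zv x + zv y := by
  simp [zv]; ring

theorem zv_mul (x y : Zq) : zv (zmul x y) = zv x * zv y := by
  simp [zv, zmul]; linear_combination (-(x.2 * y.2 : ℝ)) * s_four

/-- The difference is multiplied by 10000, and s² is replaced by that one of its bounds 0.6180 and
0.6181 which makes the difference smaller. -/
theorem zv_lt {x y : Zq} (h : zlt x y = true) : zv x < zv y := by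
  have h1 := s_sq_bounds
  unfold zlt at h
  rw [decide_eq_true_eq] at h
  have h' : (0 : ℝ) < 10000 * (y.1 - x.1) + (if x.2 ≤ y.2 then 6180 else 6181) * (y.2 - x.2) := by
    split_ifs at h ⊢ <;> exact_mod_cast h
  unfold zv
  split_ifs at h' with hc
  · have hc' : (x.2 : ℝ) ≤ y.2 := by exact_mod_cast hc
    nlinarith
  · have hc' : (y.2 : ℝ) ≤ x.2 := by exact_mod_cast (not_le.mp hc).le
    nlinarith

/-- An affine map in the coordinates `(X, Y) = (x / s, y)`, namely
`(X, Y) ↦ (a X + c, b Y + d)` or, if `sw` holds, `(X, Y) ↦ (a Y + c, b X + d)`. -/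
structure Sym where
  sw : Bool
  a : Zq
  b : Zq
  c : Zq
  d : Zq
  deriving DecidableEq

/-- The map of the plane denoted by a symbol. -/
def Sym.act (R : Sym) (p : Plane) : Plane :=
  pt (s * (zv R.a * (if R.sw then p 1 else tau * p 0) + zv R.c))
    (zv R.b * (if R.sw then tau * p 0 else p 1) + zv R.d)

/-- Composition of symbols. -/
def Sym.comp (A B : Sym) : Sym :=
  if A.sw then ⟨!B.sw, zmul A.a B.b, zmul A.b B.a, zmul A.a B.d + A.c, zmul A.b B.c + A.d⟩
  else ⟨B.sw, zmul A.a B.a, zmul A.b B.b, zmul A.a B.c + A.c, zmul A.b B.d + A.d⟩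

theorem Sym.act_comp (A B : Sym) (p : Plane) : (A.comp B).act p = A.act (B.act p) := by
  obtain ⟨sa, a, b, c, d⟩ := A
  obtain ⟨sb, a', b', c', d'⟩ := B
  have h := tau_mul_s
  cases sa <;> cases sb <;> apply plane_ext <;>
    simp [Sym.comp, Sym.act, zv_add, zv_mul, ← mul_assoc, h] <;> first | ring1 | (left; ring1)

/-- The symbol of the map `f₁`, `f₂`, or the identity, with which a large (`b = false`) or small
(`b = true`) tile is replaced by its `i`-th child. -/
def stepSym : Bool → Bool → Sym
  | false, false => ⟨true, (-1, 0), (0, 1), (1, 0), (0, 0)⟩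
  | false, true => ⟨false, (0, 1), (0, -1), (0, 0), (1, 0)⟩
  | true, _ => ⟨false, (1, 0), (1, 0), (0, 0), (0, 0)⟩

/-- The symbol of the inverse of the map of `stepSym`. -/
def stepInv : Bool → Bool → Sym
  | false, false => ⟨true, (1, 1), (-1, 0), (0, 0), (1, 0)⟩
  | false, true => ⟨false, (1, 1), (-1, -1), (0, 0), (1, 1)⟩
  | true, _ => ⟨false, (1, 0), (1, 0), (0, 0), (0, 0)⟩

/-- The map relating a tile (small if `b`) to its `i`-th child. -/
def step : Bool → Bool → Equiv.Perm Plane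
  | false, false => f₁
  | false, true => f₂
  | true, _ => 1

theorem act_stepSym (b i : Bool) (p : Plane) : (stepSym b i).act p = step b i p := by
  have h := tau_mul_s
  cases b <;> cases i <;> apply plane_ext <;>
    simp [stepSym, step, Sym.act, zv, ← mul_assoc, mul_comm s tau, h] <;>
    first | ring1 | (left; linear_combination s * h) | (left; linear_combination s ^ 2 * h)

theorem act_stepInv (b i : Bool) (p : Plane) : (stepInv b i).act (step b i p) = p := by
  rw [← act_stepSym, ← Sym.act_comp]
  have h := tau_mul_s
  have e : (stepInv b i).comp (stepSym b i) = ⟨false, (1, 0), (1, 0), (0, 0), (0, 0)⟩ := by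
    cases b <;> cases i <;> rfl
  rw [e]
  apply plane_ext <;> simp [Sym.act, zv, ← mul_assoc, mul_comm s tau, h]

/-- `W = V ∘ R`. -/
def Rel (V W : Equiv.Perm Plane) (R : Sym) : Prop := ∀ x, W x = V (R.act x)

theorem Rel.step {V W : Equiv.Perm Plane} {R : Sym} (h : Rel V W R) (b i b' j : Bool) :
    Rel (V * step b i) (W * step b' j) (((stepInv b i).comp R).comp (stepSym b' j)) := by
  intro x
  rw [Equiv.Perm.mul_apply, Equiv.Perm.mul_apply, Sym.act_comp, Sym.act_comp, act_stepSym, h]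
  obtain ⟨y, hy⟩ : ∃ y, Ammann.step b i y = R.act (Ammann.step b' j x) :=
    (Ammann.step b i).surjective _
  rw [← hy, act_stepInv]

theorem Rel.siblings (V : Equiv.Perm Plane) (b i b' j : Bool) :
    Rel (V * Ammann.step b i) (V * Ammann.step b' j) ((stepInv b i).comp (stepSym b' j)) := by
  intro x
  rw [Equiv.Perm.mul_apply, Equiv.Perm.mul_apply, Sym.act_comp, act_stepSym]
  obtain ⟨y, hy⟩ : ∃ y, Ammann.step b i y = Ammann.step b' j x := (Ammann.step b i).surjective _
  rw [← hy, act_stepInv]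

theorem Rel.mul_left {V W : Equiv.Perm Plane} {R : Sym} (h : Rel V W R) (M : Equiv.Perm Plane) :
    Rel (M * V) (M * W) R := fun x => by
  rw [Equiv.Perm.mul_apply, Equiv.Perm.mul_apply, h x]

theorem Rel.image {V W : Equiv.Perm Plane} {R : Sym} (h : Rel V W R) :
    W '' G = V '' (R.act '' G) := by
  rw [Set.image_image]
  exact Set.image_congr fun x _ => h x

theorem Rel.inter {V W : Equiv.Perm Plane} {R : Sym} (h : Rel V W R) :
    V '' G ∩ W '' G = V '' (G ∩ R.act '' G) := by
  rw [h.image, Set.image_inter V.injective]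

/-! ### Intersection patterns of boxes -/

/-- The box `[x₀, x₁] × [y₀, y₁]` in the coordinates `(x / s, y)`. -/
structure Box where
  x₀ : Zq
  x₁ : Zq
  y₀ : Zq
  y₁ : Zq

/-- The set of points denoted by a box. -/
def Box.pts (B : Box) : Set Plane :=
  {p | (zv B.x₀ ≤ tau * p 0 ∧ tau * p 0 ≤ zv B.x₁) ∧ (zv B.y₀ ≤ p 1 ∧ p 1 ≤ zv B.y₁)}

/-- The two boxes that make up `G`. -/
def boxes : List Box := [⟨(0, 0), (1, 0), (0, 0), (0, 1)⟩, ⟨(0, 0), (0, 1), (0, 0), (1, 0)⟩]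

theorem mem_G_iff {p : Plane} : p ∈ G ↔ ∃ B ∈ boxes, p ∈ B.pts := by
  have h1 := mul_le_iff_of_mul_eq_one tau_pos tau_mul_s (p 0)
  have h2 := le_mul_iff_of_mul_eq_one tau_pos tau_mul_s (p 0)
  have e : s * s ^ 2 = s ^ 3 := by ring
  simp [boxes, Box.pts, zv, h1, h2, G, e, and_assoc]

/-- The image of an interval under `u ↦ a u + c`. -/
def ivImage (a c l r : Zq) : Zq × Zq :=
  if zlt (0, 0) a then (zmul a l + c, zmul a r + c) else (zmul a r + c, zmul a l + c)

theorem zv_zero : zv (0, 0) = 0 := by simp [zv]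

theorem mem_ivImage {a c l r : Zq} (ha : (zlt (0, 0) a || zlt a (0, 0)) = true) (u : ℝ) :
    (zv (ivImage a c l r).1 ≤ zv a * u + zv c ∧ zv a * u + zv c ≤ zv (ivImage a c l r).2) ↔
      zv l ≤ u ∧ u ≤ zv r := by
  unfold ivImage
  by_cases h : zlt (0, 0) a = true
  · have h0 := zv_lt h
    rw [zv_zero] at h0
    simp only [h, if_true, zv_add, zv_mul, add_le_add_iff_right, mul_le_mul_iff_right₀ h0]
  · have h' : zlt a (0, 0) = true := by simpa [h] using ha
    have h0 := zv_lt h'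
    rw [zv_zero] at h0
    simp only [h, zv_add, zv_mul, add_le_add_iff_right, Bool.false_eq_true, if_false,
      mul_le_mul_left_of_neg h0]
    exact and_comm

/-- The image of a box. -/
def Sym.box (R : Sym) (B : Box) : Box :=
  let X := if R.sw then ivImage R.a R.c B.y₀ B.y₁ else ivImage R.a R.c B.x₀ B.x₁
  let Y := if R.sw then ivImage R.b R.d B.x₀ B.x₁ else ivImage R.b R.d B.y₀ B.y₁
  ⟨X.1, X.2, Y.1, Y.2⟩

/-- The signs of the linear coefficients can be certified. -/
def Sym.ok (R : Sym) : Bool :=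
  (zlt (0, 0) R.a || zlt R.a (0, 0)) && (zlt (0, 0) R.b || zlt R.b (0, 0))

theorem Sym.act_mem_box {R : Sym} (h : R.ok = true) (B : Box) (p : Plane) :
    R.act p ∈ (R.box B).pts ↔ p ∈ B.pts := by
  obtain ⟨sw, a, b, c, d⟩ := R
  rw [Sym.ok, Bool.and_eq_true] at h
  have e := tau_mul_s
  cases sw
  · simp only [Sym.box, Sym.act, Box.pts, Set.mem_ofPred_eq, pt_zero, pt_one, ← mul_assoc, e, one_mul,
      Bool.false_eq_true, if_false, mem_ivImage h.2]
    simp only [mul_assoc, mem_ivImage h.1]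
  · simp only [Sym.box, Sym.act, Box.pts, Set.mem_ofPred_eq, pt_zero, pt_one, ← mul_assoc, e, one_mul,
      if_true, mem_ivImage h.1]
    simp only [mul_assoc, mem_ivImage h.2]
    exact and_comm

theorem Sym.act_surjective {R : Sym} (h : R.ok = true) : Function.Surjective R.act := by
  obtain ⟨sw, a, b, c, d⟩ := R
  simp only [Sym.ok, Bool.and_eq_true, Bool.or_eq_true] at h
  have hs := tau_mul_s
  have ha : zv a ≠ 0 := h.1.elim (fun h => by have := zv_lt h; rw [zv_zero] at this; exact this.ne')
    fun h => by have := zv_lt h; rw [zv_zero] at this; exact this.ne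
  have hb : zv b ≠ 0 := h.2.elim (fun h => by have := zv_lt h; rw [zv_zero] at this; exact this.ne')
    fun h => by have := zv_lt h; rw [zv_zero] at this; exact this.ne
  intro p
  cases sw
  · refine ⟨pt (s * ((tau * p 0 - zv c) / zv a)) ((p 1 - zv d) / zv b), plane_ext ?_ ?_⟩
    · simp only [Sym.act, Bool.false_eq_true, if_false, pt_zero, ← mul_assoc, hs, one_mul]
      rw [mul_div_cancel₀ _ ha]
      linear_combination p 0 * hs
    · simp only [Sym.act, Bool.false_eq_true, if_false, pt_one]
      rw [mul_div_cancel₀ _ hb]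
      ring
  · refine ⟨pt (s * ((p 1 - zv d) / zv b)) ((tau * p 0 - zv c) / zv a), plane_ext ?_ ?_⟩
    · simp only [Sym.act, if_true, pt_zero, pt_one]
      rw [mul_div_cancel₀ _ ha]
      linear_combination p 0 * hs
    · simp only [Sym.act, if_true, pt_zero, pt_one, ← mul_assoc, hs, one_mul]
      rw [mul_div_cancel₀ _ hb]
      ring

theorem Sym.mem_image_G {R : Sym} (h : R.ok = true) (p : Plane) :
    p ∈ R.act '' G ↔ ∃ B ∈ boxes, p ∈ (R.box B).pts := by
  constructor
  · rintro ⟨q, hq, rfl⟩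
    obtain ⟨B, hB, hq⟩ := mem_G_iff.mp hq
    exact ⟨B, hB, (R.act_mem_box h B q).mpr hq⟩
  · rintro ⟨B, hB, hp⟩
    obtain ⟨q, rfl⟩ := R.act_surjective h p
    exact ⟨q, mem_G_iff.mpr ⟨B, hB, (R.act_mem_box h B q).mp hp⟩, rfl⟩

/-- The intervals are certified to be disjoint. -/
def ivMiss (l r l' r' : Zq) : Bool := zlt r l' || zlt r' l

/-- The intervals have a common end point, one lying on each side of it. -/
def ivPoint (l r l' r' : Zq) : Bool := zlt l r && zlt l' r' && (decide (r = l') || decide (r' = l))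

/-- The intervals are certified to overlap. -/
def ivFat (l r l' r' : Zq) : Bool := zlt l r && zlt l' r' && zlt l r' && zlt l' r

theorem ivMiss_spec {l r l' r' : Zq} (h : ivMiss l r l' r' = true) {x : ℝ}
    (h1 : zv l ≤ x ∧ x ≤ zv r) (h2 : zv l' ≤ x ∧ x ≤ zv r') : False := by
  rw [ivMiss, Bool.or_eq_true] at h
  rcases h with h | h
  · linarith [zv_lt h]
  · linarith [zv_lt h]

theorem ivPoint_spec {l r l' r' : Zq} (h : ivPoint l r l' r' = true) :
    ∃ c, ∀ x, ((zv l ≤ x ∧ x ≤ zv r) ∧ (zv l' ≤ x ∧ x ≤ zv r')) ↔ x = c := by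
  simp only [ivPoint, Bool.and_eq_true, Bool.or_eq_true, decide_eq_true_eq] at h
  obtain ⟨⟨h1, h2⟩, h3⟩ := h
  have h1 := zv_lt h1
  have h2 := zv_lt h2
  rcases h3 with rfl | rfl
  · exact ⟨zv r, fun x => ⟨fun h => le_antisymm h.1.2 h.2.1, by rintro rfl; exact ⟨⟨h1.le, le_rfl⟩, le_rfl, h2.le⟩⟩⟩
  · exact ⟨zv r', fun x => ⟨fun h => le_antisymm h.2.2 h.1.1, by rintro rfl; exact ⟨⟨le_rfl, h1.le⟩, h2.le, le_rfl⟩⟩⟩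

theorem ivFat_spec {l r l' r' : Zq} (h : ivFat l r l' r' = true) :
    ∃ c d, c < d ∧ ∀ x, c ≤ x → x ≤ d → (zv l ≤ x ∧ x ≤ zv r) ∧ (zv l' ≤ x ∧ x ≤ zv r') := by
  simp only [ivFat, Bool.and_eq_true] at h
  obtain ⟨⟨⟨h1, h2⟩, h3⟩, h4⟩ := h
  refine ⟨max (zv l) (zv l'), min (zv r) (zv r'), ?_, fun x hc hd => ?_⟩
  · rw [max_lt_iff, lt_min_iff, lt_min_iff]
    exact ⟨⟨zv_lt h1, zv_lt h3⟩, zv_lt h4, zv_lt h2⟩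
  · rw [max_le_iff] at hc
    rw [le_min_iff] at hd
    exact ⟨⟨hc.1, hd.1⟩, hc.2, hd.2⟩

/-- The boxes are certified to be disjoint. -/
def Box.miss (B C : Box) : Bool :=
  ivMiss B.x₀ B.x₁ C.x₀ C.x₁ || ivMiss B.y₀ B.y₁ C.y₀ C.y₁

/-- The boxes are certified to have a common corner only. -/
def Box.corner (B C : Box) : Bool :=
  ivPoint B.x₀ B.x₁ C.x₀ C.x₁ && ivPoint B.y₀ B.y₁ C.y₀ C.y₁

/-- The boxes are certified to have infinitely many common points. -/
def Box.edge (B C : Box) : Bool :=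
  (ivFat B.x₀ B.x₁ C.x₀ C.x₁ && (ivFat B.y₀ B.y₁ C.y₀ C.y₁ || ivPoint B.y₀ B.y₁ C.y₀ C.y₁)) ||
  (ivFat B.y₀ B.y₁ C.y₀ C.y₁ && ivPoint B.x₀ B.x₁ C.x₀ C.x₁)

theorem Box.miss_spec {B C : Box} (h : B.miss C = true) : B.pts ∩ C.pts = ∅ := by
  rw [Box.miss, Bool.or_eq_true] at h
  rw [Set.eq_empty_iff_forall_notMem]
  rintro p ⟨h1, h2⟩
  exact h.elim (fun h => ivMiss_spec h h1.1 h2.1) fun h => ivMiss_spec h h1.2 h2.2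

theorem Box.corner_spec {B C : Box} (h : B.corner C = true) : ∃ p, B.pts ∩ C.pts = {p} := by
  rw [Box.corner, Bool.and_eq_true] at h
  obtain ⟨x, hx⟩ := ivPoint_spec h.1
  obtain ⟨y, hy⟩ := ivPoint_spec h.2
  have ht := tau_mul_s
  refine ⟨pt (s * x) y, ?_⟩
  ext p
  have e : p ∈ B.pts ∩ C.pts ↔ tau * p 0 = x ∧ p 1 = y := by
    rw [← hx, ← hy]
    simp only [Box.pts, Set.mem_inter_iff, Set.mem_ofPred_eq]
    tauto
  rw [e, Set.mem_singleton_iff]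
  constructor
  · rintro ⟨h1, h2⟩
    refine plane_ext ?_ (by simpa using h2)
    rw [pt_zero, ← h1]
    linear_combination (-p 0) * ht
  · rintro rfl
    simp [← mul_assoc, ht]

theorem infinite_of_segment {A : Set Plane} {x x' y y' : ℝ} (hx : x ≤ x') (hy : y ≤ y')
    (hxy : x < x' ∨ y < y')
    (h : ∀ u v, x ≤ u → u ≤ x' → y ≤ v → v ≤ y' → pt (s * u) v ∈ A) : A.Infinite := by
  have hs := s_pos
  rcases hxy with hxy | hxy
  · refine ((Set.Icc_infinite hxy).image (f := fun u => pt (s * u) y) ?_).mono ?_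
    · intro u _ v _ e
      have := congrArg (fun p : Plane => p 0) e
      simpa [s_ne] using this
    · rintro _ ⟨u, hu, rfl⟩
      exact h u y hu.1 hu.2 le_rfl hy
  · refine ((Set.Icc_infinite hxy).image (f := fun v => pt (s * x) v) ?_).mono ?_
    · intro u _ v _ e
      have := congrArg (fun p : Plane => p 1) e
      simpa using this
    · rintro _ ⟨v, hv, rfl⟩
      exact h x v le_rfl hx hv.1 hv.2

theorem Box.edge_spec {B C : Box} (h : B.edge C = true) : (B.pts ∩ C.pts).Infinite := by
  have ht := tau_mul_s
  have key : ∀ {x x' y y' : ℝ}, x ≤ x' → y ≤ y' → (x < x' ∨ y < y') →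
      (∀ u, x ≤ u → u ≤ x' → (zv B.x₀ ≤ u ∧ u ≤ zv B.x₁) ∧ (zv C.x₀ ≤ u ∧ u ≤ zv C.x₁)) →
      (∀ u, y ≤ u → u ≤ y' → (zv B.y₀ ≤ u ∧ u ≤ zv B.y₁) ∧ (zv C.y₀ ≤ u ∧ u ≤ zv C.y₁)) →
      (B.pts ∩ C.pts).Infinite := by
    intro x x' y y' hx hy hxy h1 h2
    refine infinite_of_segment hx hy hxy fun u v a b c d => ?_
    simp only [Box.pts, Set.mem_inter_iff, Set.mem_ofPred_eq, pt_zero, pt_one, ← mul_assoc, ht,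
      one_mul]
    exact ⟨⟨(h1 u a b).1, (h2 v c d).1⟩, (h1 u a b).2, (h2 v c d).2⟩
  simp only [Box.edge, Bool.and_eq_true, Bool.or_eq_true] at h
  rcases h with ⟨h1, h2 | h2⟩ | ⟨h1, h2⟩
  · obtain ⟨x, x', hx, h1⟩ := ivFat_spec h1
    obtain ⟨y, y', hy, h2⟩ := ivFat_spec h2
    exact key hx.le hy.le (Or.inl hx) h1 h2
  · obtain ⟨x, x', hx, h1⟩ := ivFat_spec h1
    obtain ⟨y, h2⟩ := ivPoint_spec h2
    exact key hx.le le_rfl (Or.inl hx) h1 fun u a b => (h2 u).mpr (le_antisymm b a)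
  · obtain ⟨x, x', hx, h1⟩ := ivFat_spec h1
    obtain ⟨y, h2⟩ := ivPoint_spec h2
    exact key le_rfl hx.le (Or.inr hx) (fun u a b => (h2 u).mpr (le_antisymm b a)) h1

/-- `G` and its image are certified to be disjoint. -/
def Sym.miss (R : Sym) : Bool := R.ok && boxes.all fun B => boxes.all fun C => B.miss (R.box C)

/-- `G` and its image are certified to have infinitely many common points. -/
def Sym.edge (R : Sym) : Bool := R.ok && boxes.any fun B => boxes.any fun C => B.edge (R.box C)

/-- `G` and its image are certified to have finitely many common points, and at least one. -/
def Sym.corner (R : Sym) : Bool :=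
  R.ok && (boxes.all fun B => boxes.all fun C => B.miss (R.box C) || B.corner (R.box C)) &&
    boxes.any fun B => boxes.any fun C => B.corner (R.box C)

theorem Sym.mem_inter {R : Sym} (h : R.ok = true) (p : Plane) :
    p ∈ G ∩ R.act '' G ↔ ∃ B ∈ boxes, ∃ C ∈ boxes, p ∈ B.pts ∩ (R.box C).pts := by
  rw [Set.mem_inter_iff, mem_G_iff, R.mem_image_G h]
  constructor
  · rintro ⟨⟨B, hB, h1⟩, C, hC, h2⟩
    exact ⟨B, hB, C, hC, h1, h2⟩
  · rintro ⟨B, hB, C, hC, h1, h2⟩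
    exact ⟨⟨B, hB, h1⟩, C, hC, h2⟩

theorem Sym.miss_spec {R : Sym} (h : R.miss = true) : G ∩ R.act '' G = ∅ := by
  simp only [Sym.miss, Bool.and_eq_true, List.all_eq_true] at h
  rw [Set.eq_empty_iff_forall_notMem]
  intro p hp
  obtain ⟨B, hB, C, hC, hp⟩ := (R.mem_inter h.1 p).mp hp
  rwa [Box.miss_spec (h.2 B hB C hC)] at hp

theorem Sym.edge_spec {R : Sym} (h : R.edge = true) : (G ∩ R.act '' G).Infinite := by
  simp only [Sym.edge, Bool.and_eq_true, List.any_eq_true] at h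
  obtain ⟨h, B, hB, C, hC, e⟩ := h
  exact (Box.edge_spec e).mono fun p hp => (R.mem_inter h p).mpr ⟨B, hB, C, hC, hp⟩

theorem Sym.corner_spec {R : Sym} (h : R.corner = true) :
    (G ∩ R.act '' G).Finite ∧ (G ∩ R.act '' G).Nonempty := by
  simp only [Sym.corner, Bool.and_eq_true, List.any_eq_true, List.all_eq_true, Bool.or_eq_true] at h
  obtain ⟨⟨h, hall⟩, B, hB, C, hC, e⟩ := h
  constructor
  · have hfin : (⋃ B ∈ {B | B ∈ boxes}, ⋃ C ∈ {C | C ∈ boxes}, B.pts ∩ (R.box C).pts).Finite := by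
      refine (List.finite_toSet boxes).biUnion fun B hB => (List.finite_toSet boxes).biUnion
        fun C hC => ?_
      rcases hall B hB C hC with h | h
      · rw [Box.miss_spec h]; exact Set.finite_empty
      · obtain ⟨p, hp⟩ := Box.corner_spec h
        rw [hp]; exact Set.finite_singleton p
    refine hfin.subset fun p hp => ?_
    obtain ⟨B, hB, C, hC, hp⟩ := (R.mem_inter h p).mp hp
    exact Set.mem_biUnion (s := {B | B ∈ boxes}) hB (Set.mem_biUnion (s := {B | B ∈ boxes}) hC hp)
  · obtain ⟨p, hp⟩ := Box.corner_spec e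
    exact ⟨p, (R.mem_inter h p).mpr ⟨B, hB, C, hC, hp ▸ rfl⟩⟩

/-! ### Relative positions of neighbouring tiles -/

/-- The possible relative positions of two different tiles of a supertile that meet: whether the
first tile is small, and the position of the second one relative to the first one. The first 25
codes belong to pairs with infinitely many common points, and the codes `0` and `1` to the two
children of a large tile. -/
def codeList : List (Bool × Sym) := [
  (false, ⟨true, (-1, 0), (0, -1), (1, 1), (1, 0)⟩),
  (true, ⟨true, (-1, -1), (-1, 0), (1, 1), (1, 1)⟩),
  (false, ⟨false, (-1, 0), (1, 0), (1, 1), (0, -1)⟩),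
  (true, ⟨true, (-1, -1), (1, 0), (2, 1), (0, 0)⟩),
  (false, ⟨false, (-1, 0), (1, 0), (1, 1), (0, 1)⟩),
  (false, ⟨true, (1, 0), (0, -1), (0, 0), (1, 1)⟩),
  (false, ⟨false, (1, 0), (-1, 0), (-1, 0), (1, -1)⟩),
  (false, ⟨true, (-1, 0), (0, 1), (0, 1), (0, -1)⟩),
  (false, ⟨true, (1, 0), (0, 1), (1, 0), (0, 0)⟩),
  (false, ⟨false, (1, 0), (-1, 0), (1, 0), (1, -1)⟩),
  (true, ⟨true, (1, 1), (-1, 0), (1, 0), (0, 1)⟩),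
  (true, ⟨true, (1, 1), (1, 0), (0, 0), (-1, 0)⟩),
  (false, ⟨false, (-1, 0), (1, 0), (0, 1), (1, 0)⟩),
  (false, ⟨false, (1, 0), (1, 0), (-1, 0), (1, -1)⟩),
  (false, ⟨false, (1, 0), (-1, 0), (0, 0), (0, 0)⟩),
  (false, ⟨false, (-1, 0), (1, 0), (0, 1), (-1, 0)⟩),
  (false, ⟨false, (1, 0), (1, 0), (1, 0), (-1, 1)⟩),
  (true, ⟨true, (1, 1), (-1, 0), (0, -1), (0, 0)⟩),
  (true, ⟨true, (-1, -1), (-1, 0), (0, 0), (1, 0)⟩),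
  (false, ⟨false, (-1, 0), (1, 0), (0, 0), (0, 0)⟩),
  (false, ⟨true, (-1, 0), (0, 1), (0, 0), (1, -1)⟩),
  (false, ⟨true, (-1, 0), (0, -1), (1, 0), (0, 0)⟩),
  (false, ⟨false, (1, 0), (-1, 0), (0, 0), (2, 0)⟩),
  (true, ⟨false, (-1, 0), (1, 0), (0, 0), (0, 0)⟩),
  (true, ⟨false, (1, 0), (-1, 0), (0, 0), (0, 0)⟩),
  (true, ⟨true, (-1, -1), (1, 0), (0, 0), (1, 0)⟩),
  (false, ⟨true, (1, 0), (0, -1), (-1, 0), (0, 0)⟩),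
  (false, ⟨false, (-1, 0), (-1, 0), (0, 0), (2, 0)⟩),
  (false, ⟨false, (1, 0), (1, 0), (0, 1), (1, 0)⟩),
  (false, ⟨false, (1, 0), (1, 0), (0, -1), (-1, 0)⟩),
  (true, ⟨false, (-1, 0), (-1, 0), (0, 0), (0, 0)⟩),
  (true, ⟨true, (-1, -1), (-1, 0), (2, 1), (0, 0)⟩),
  (false, ⟨true, (-1, 0), (0, 1), (1, 1), (1, 0)⟩),
  (true, ⟨true, (1, 1), (-1, 0), (-1, -1), (1, 1)⟩),
  (false, ⟨true, (-1, 0), (0, -1), (0, 0), (1, 1)⟩),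
  (false, ⟨false, (-1, 0), (-1, 0), (0, 0), (0, 0)⟩),
  (false, ⟨true, (1, 0), (0, -1), (1, 0), (0, 0)⟩),
  (true, ⟨true, (-1, -1), (1, 0), (0, 0), (-1, 0)⟩)]

/-- The table behind `child`. -/
def childList : List (List ℕ) := [
  [3, 0, 4, 0], [5, 6, 0, 0], [7, 8, 0, 0], [0, 9, 0, 0], [10, 0, 11, 0], [0, 0, 12, 0],
  [13, 0, 26, 0], [14, 0, 0, 0], [15, 0, 0, 0], [16, 27, 0, 0], [17, 0, 0, 0], [15, 0, 0, 0],
  [0, 0, 18, 0], [29, 0, 19, 0], [20, 0, 0, 0], [0, 21, 0, 0], [30, 22, 0, 0], [30, 22, 0, 0],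
  [20, 0, 0, 0], [23, 33, 34, 24], [29, 0, 19, 0], [20, 0, 0, 0], [0, 0, 0, 25], [20, 0, 0, 0],
  [15, 0, 0, 0], [28, 0, 0, 0], [28, 0, 0, 0], [0, 0, 0, 31], [0, 0, 32, 0], [0, 35, 0, 0],
  [36, 0, 0, 0], [0, 37, 0, 0], [0, 0, 32, 0], [0, 35, 0, 0], [0, 0, 38, 0], [28, 0, 0, 0],
  [36, 0, 0, 0], [36, 0, 0, 0]]

/-- The first tile of a pair with the given code is small. -/
def codeSmall (p : ℕ) : Bool := (codeList.getD p (false, stepSym true true)).1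

/-- The position of the second tile relative to the first one. -/
def codeSym (p : ℕ) : Sym := (codeList.getD p (false, stepSym true true)).2

/-- The second tile of a pair with the given code is small. -/
def codeSmall' (p : ℕ) : Bool := xor (codeSmall p) (codeSym p).sw

/-- The code of the pair of the `i`-th child of the first and the `j`-th child of the second tile of
a pair with code `p`, increased by `1`, or `0` if these children do not meet. -/
def child (p : ℕ) (i j : Bool) : ℕ :=
  (childList.getD p []).getD (2 * i.toNat + j.toNat) 0

/-- The `i`-th child exists. -/
def hasChild (small i : Bool) : Bool := !(small && i)

/-- The `i`-th child is small. -/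
def childSmall (small i : Bool) : Bool := !small && i

/-- The consistency of `childList` with `codeList`. -/
def childCheck (p : ℕ) (i j : Bool) : Bool :=
  let R := ((stepInv (codeSmall p) i).comp (codeSym p)).comp (stepSym (codeSmall' p) j)
  match child p i j with
  | 0 => R.miss
  | q + 1 => decide (q < 38) && decide (codeSmall q = childSmall (codeSmall p) i) &&
      decide (codeSmall' q = childSmall (codeSmall' p) j) && decide (codeSym q = R)

/-- The 38 codes are closed under passing to children: two children are either disjoint or again in
a listed position. Their sizes differ exactly when the axes are exchanged, since `f₁` has ratio s
and exchanges the axes, while `f₂` has ratio s² and does not. -/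
theorem childCheck_all : ∀ p < 38, ∀ i j, hasChild (codeSmall p) i = true →
    hasChild (codeSmall' p) j = true → childCheck p i j = true := by decide +kernel

/-- Contact along an edge is expressed as an infinite intersection, a notion that survives
homeomorphisms; contact at corners gives a finite intersection. -/
theorem codeSym_edge : ∀ p < 25, (codeSym p).edge = true := by decide +kernel

theorem codeSym_corner : ∀ p < 38, 25 ≤ p → (codeSym p).corner = true := by decide +kernel

/-- The symbol is certified not to be the identity. -/
def Sym.moves (R : Sym) : Bool :=
  zlt R.c (0, 0) || zlt (0, 0) R.c || zlt R.d (0, 0) || zlt (0, 0) R.d ||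
    zlt R.a (1, 0) || zlt (1, 0) R.a || zlt R.b (1, 0) || zlt (1, 0) R.b

theorem Sym.moves_spec {R : Sym} (h : R.moves = true) : ∃ p, R.act p ≠ p := by
  by_contra! hid
  have e0 := congrArg (fun p : Plane => p 0) (hid (pt 0 0))
  have e1 := congrArg (fun p : Plane => p 1) (hid (pt 0 0))
  have e2 := congrArg (fun p : Plane => p 0) (hid (pt s 1))
  have e3 := congrArg (fun p : Plane => p 1) (hid (pt s 1))
  simp [Sym.act, s_ne] at e0 e1 e2 e3
  simp [tau_mul_s, e0, e1] at e2 e3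
  have h1 : zv (1, 0) = 1 := by simp [zv]
  simp only [Sym.moves, Bool.or_eq_true] at h
  rcases h with ((((((h | h) | h) | h) | h) | h) | h) | h <;> have h := zv_lt h <;>
    first
    | (rw [zv_zero] at h; linarith)
    | (rw [h1] at h; linarith)

/-- No listed position is the identity, so tiles reached by different paths of equal length are
different. -/
theorem codeSym_moves : ∀ p < 38, (codeSym p).moves = true := by decide +kernel

/-! ### The tiles of a supertile -/

/-- The tile reached by a path of children, listed with the last step first, is small. -/
def small : List Bool → Bool
  | [] => false
  | i :: w => childSmall (small w) i

/-- All steps of the path are possible. -/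
def valid : List Bool → Prop
  | [] => True
  | i :: w => valid w ∧ hasChild (small w) i = true

/-- The position of the tile reached by a path. -/
def place : List Bool → Equiv.Perm Plane
  | [] => 1
  | i :: w => place w * step (small w) i

/-- The tile reached by a path in the copy of a supertile positioned by `M`. -/
def tileAt (M : Equiv.Perm Plane) (w : List Bool) : Set Plane := (M * place w : Equiv.Perm Plane) '' G

/-- The copy of a subdivided `G` positioned by `M`. -/
def level (M : Equiv.Perm Plane) (n : ℕ) : TileSet := {t | ∃ w, valid w ∧ w.length = n ∧ t = tileAt M w}

theorem scales_step (b i : Bool) (h : hasChild b i = true) :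
    Scales (if childSmall b i then s ^ 2 else if b then 1 else s) (step b i) := by
  cases b <;> cases i
  · exact scales_f₁
  · exact scales_f₂
  · exact scales_one
  · cases h

theorem scales_place {n : ℕ} {V : Equiv.Perm Plane} (hV : Scales s V) {w : List Bool} (hw : valid w)
    (hn : w.length = n) :
    Scales (if small w then s ^ 2 else s) (scS⁻¹ ^ n * V * place w) := by
  induction w generalizing n with
  | nil => simpa [← hn, small, place] using hV
  | cons i w ih =>
    obtain ⟨m, rfl⟩ : ∃ m, n = m + 1 := ⟨w.length, by rw [← hn, List.length_cons]⟩
    have h1 := ih hw.1 (by simpa using hn)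
    have e : scS⁻¹ ^ (m + 1) * V * place (i :: w) =
        scS⁻¹ * (scS⁻¹ ^ m * V * place w) * step (small w) i := by
      rw [pow_succ']; simp only [place, mul_assoc]
    rw [e, small]
    have h2 := hw.2
    cases hs : small w <;> rw [hs] at h1 h2
    · have := scales_sub_digit h1 (if i then .two else .one)
      cases i
      · simpa [childSmall, Digit.val, f, step] using this
      · simpa [childSmall, Digit.val, f, step] using this
    · cases i
      · simpa [childSmall, step] using scales_sub_small h1
      · cases h2

/-- Each substitution multiplies a placement by `scS⁻¹` on the left and by a step map on the right,
so the homotheties collect on the left and the path on the right. -/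
theorem substitute_iterate {V : Equiv.Perm Plane} (hV : Scales s V) (n : ℕ) :
    substitute^[n] {V '' G} = level (scS⁻¹ ^ n * V) n := by
  induction n with
  | zero =>
    ext t
    constructor
    · rintro rfl
      exact ⟨[], trivial, rfl, by simp [tileAt, place]⟩
    · rintro ⟨w, -, hw, rfl⟩
      rw [List.length_eq_zero_iff] at hw
      subst hw
      simp [tileAt, place]
  | succ n ih =>
    rw [Function.iterate_succ_apply', ih]
    have e : ∀ i w, tileAt (scS⁻¹ ^ (n + 1) * V) (i :: w) =
        (scS⁻¹ * (scS⁻¹ ^ n * V * place w) * step (small w) i : Equiv.Perm Plane) '' G := by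
      intro i w
      rw [tileAt, pow_succ']; simp only [place, mul_assoc]
    ext t
    rw [mem_substitute]
    constructor
    · rintro (⟨W, hW, ⟨w, hw, hn, hWw⟩, rfl⟩ | ⟨W, d, hW, ⟨w, hw, hn, hWw⟩, rfl⟩)
      · have h1 := scales_place hV hw hn
        have e1 := hW.eq_of_image h1 hWw
        have hsm : small w = true := by
          by_contra hc
          rw [e1] at hW
          rw [if_neg hc] at h1
          exact s_sq_lt.ne (hW.ratio_eq h1)
        refine ⟨false :: w, ⟨hw, by simp [hasChild]⟩, by simpa using hn, ?_⟩
        rw [e, hsm, e1]; rfl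
      · have h1 := scales_place hV hw hn
        have e1 := hW.eq_of_image h1 hWw
        have hsm : small w = false := by
          by_contra hc
          rw [e1] at hW
          rw [if_pos (by simpa using hc)] at h1
          exact s_sq_lt.ne' (hW.ratio_eq h1)
        cases d
        · refine ⟨false :: w, ⟨hw, by simp [hasChild]⟩, by simpa using hn, ?_⟩
          rw [e, hsm, e1]; rfl
        · refine ⟨true :: w, ⟨hw, by simp [hasChild, hsm]⟩, by simpa using hn, ?_⟩
          rw [e, hsm, e1]; rfl
    · rintro ⟨w, hw, hn, rfl⟩
      obtain ⟨i, w, rfl⟩ : ∃ i v, w = i :: v := by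
        cases w with
        | nil => cases hn
        | cons i w => exact ⟨i, w, rfl⟩
      have hn' : w.length = n := by simpa using hn
      have h1 := scales_place hV hw.1 hn'
      have h2 := hw.2
      rw [e]
      cases hs : small w <;> rw [hs] at h1 h2
      · refine Or.inr ⟨_, if i then .two else .one, h1, ⟨w, hw.1, hn', rfl⟩, ?_⟩
        cases i <;> rfl
      · refine Or.inl ⟨_, h1, ⟨w, hw.1, hn', rfl⟩, ?_⟩
        rw [step, mul_one]

theorem mapTiles_level (U M : Equiv.Perm Plane) (n : ℕ) : mapTiles U (level M n) = level (U * M) n := by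
  ext t
  constructor
  · rintro ⟨_, ⟨w, hw, hn, rfl⟩, rfl⟩
    exact ⟨w, hw, hn, by simp only [tileAt, image_mul_G]⟩
  · rintro ⟨w, hw, hn, rfl⟩
    exact ⟨_, ⟨w, hw, hn, rfl⟩, by simp only [tileAt, image_mul_G]⟩

theorem copy_eq_level (U : Equiv.Perm Plane) (n : ℕ) :
    mapTiles U (supertile n) = level (U * (scS⁻¹ ^ n * scS)) n := by
  have h := substitute_iterate scales_scS n
  rw [image_scS] at h
  rw [supertile, h, mapTiles_level]

theorem place_scales {w : List Bool} (hw : valid w) : ∃ r, Scales r (place w) := by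
  induction w with
  | nil => exact ⟨1, scales_one⟩
  | cons i w ih =>
    obtain ⟨r, hr⟩ := ih hw.1
    exact ⟨_, hr.mul (scales_step _ i hw.2)⟩

theorem place_cons_subset (i : Bool) (w : List Bool) : place (i :: w) '' G ⊆ place w '' G := by
  rw [place]
  cases small w
  · cases i
    · exact image_f_subset (place w) .one
    · exact image_f_subset (place w) .two
  · rw [step, mul_one]

/-! ### Neighbours in a supertile -/

/-- The tiles reached by two paths of equal length have the relative position with code `p`. -/
inductive Nb : ℕ → List Bool → List Bool → Prop
  | left {w : List Bool} : valid w → small w = false → Nb 0 (false :: w) (true :: w)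
  | right {w : List Bool} : valid w → small w = false → Nb 1 (true :: w) (false :: w)
  | desc {p q : ℕ} {i j : Bool} {w v : List Bool} : Nb p w v → hasChild (small w) i = true →
      hasChild (small v) j = true → child p i j = q + 1 → Nb q (i :: w) (j :: v)

theorem Nb.spec {p : ℕ} {w v : List Bool} (h : Nb p w v) :
    p < 38 ∧ valid w ∧ valid v ∧ w.length = v.length ∧ w ≠ v ∧ small w = codeSmall p ∧
      small v = codeSmall' p ∧ Rel (place w) (place v) (codeSym p) := by
  induction h with
  | @left w hw hs =>
    refine ⟨by norm_num, ⟨hw, by simp [hasChild]⟩, ⟨hw, by simp [hasChild, hs]⟩, rfl, by simp, ?_, ?_, ?_⟩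
    · simp only [small, hs]; rfl
    · simp only [small, hs]; rfl
    · simp only [place, hs]
      exact Rel.siblings _ false false false true
  | @right w hw hs =>
    refine ⟨by norm_num, ⟨hw, by simp [hasChild, hs]⟩, ⟨hw, by simp [hasChild]⟩, rfl, by simp, ?_, ?_, ?_⟩
    · simp only [small, hs]; rfl
    · simp only [small, hs]; rfl
    · simp only [place, hs]
      exact Rel.siblings _ false true false false
  | @desc p q i j w v _ hi hj hc ih =>
    obtain ⟨hp, hw, hv, hl, hne, e1, e2, hR⟩ := ih
    have hck := childCheck_all p hp i j (e1 ▸ hi) (e2 ▸ hj)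
    simp only [childCheck, hc, Bool.and_eq_true, decide_eq_true_eq] at hck
    obtain ⟨⟨⟨h1, h2⟩, h3⟩, h4⟩ := hck
    refine ⟨h1, ⟨hw, hi⟩, ⟨hv, hj⟩, by simp [hl], ?_, ?_, ?_, ?_⟩
    · intro e
      exact hne (List.cons.inj e).2
    · rw [h2, small, e1]
    · rw [h3, small, e2]
    · rw [h4, place, place, e1, e2]
      exact hR.step _ _ _ _

/-- Tiles that meet have ancestors that meet. Below the last common ancestor the positions follow
the table `child`, whose entry 0 certifies disjointness. -/
theorem Nb.of_touch {w v : List Bool} (hw : valid w) (hv : valid v) (hl : w.length = v.length)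
    (hne : w ≠ v) (h : (place w '' G ∩ place v '' G).Nonempty) : ∃ p, Nb p w v := by
  induction w generalizing v with
  | nil => exact absurd (List.length_eq_zero_iff.mp hl.symm).symm hne
  | cons i w ih =>
    obtain ⟨j, v, rfl⟩ : ∃ j u, v = j :: u := by
      cases v with
      | nil => cases hl
      | cons j v => exact ⟨j, v, rfl⟩
    by_cases e : w = v
    · subst e
      have hs : small w = false := by
        by_contra hs
        have h1 := hw.2
        have h2 := hv.2
        rw [Bool.not_eq_false] at hs
        rw [hs] at h1 h2
        cases i <;> cases j <;> simp_all [hasChild]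
      cases i <;> cases j
      · exact absurd rfl hne
      · exact ⟨0, .left hw.1 hs⟩
      · exact ⟨1, .right hw.1 hs⟩
      · exact absurd rfl hne
    · obtain ⟨p, hp⟩ := ih hw.1 hv.1 (by simpa using hl) e
        (h.mono (Set.inter_subset_inter (place_cons_subset i w) (place_cons_subset j v)))
      obtain ⟨hp38, -, -, -, -, e1, e2, hR⟩ := hp.spec
      have hck := childCheck_all p hp38 i j (e1 ▸ hw.2) (e2 ▸ hv.2)
      cases hc : child p i j with
      | zero =>
        exfalso
        simp only [childCheck, hc] at hck
        have hR' := hR.step (small w) i (small v) j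
        rw [← e1, ← e2] at hck
        have hin := hR'.inter
        rw [Sym.miss_spec hck, Set.image_empty] at hin
        exact h.ne_empty hin
      | succ q => exact ⟨q, .desc hp hw.2 hv.2 hc⟩

theorem Nb.code_unique {p q : ℕ} {w v : List Bool} (h : Nb p w v) (h' : Nb q w v) : p = q := by
  induction h generalizing q with
  | left => cases h' with
    | left => rfl
    | desc h => exact absurd rfl h.spec.2.2.2.2.1
  | right => cases h' with
    | right => rfl
    | desc h => exact absurd rfl h.spec.2.2.2.2.1
  | desc h _ _ hc ih => cases h' with
    | left => exact absurd rfl h.spec.2.2.2.2.1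
    | right => exact absurd rfl h.spec.2.2.2.2.1
    | desc h' _ _ hc' =>
      rw [ih h'] at hc
      omega

/-- Equal tiles meet, so two different paths to the same tile would have a code. By rigidity the
relative position is the identity, which is not in the list. -/
theorem place_injective {w v : List Bool} (hw : valid w) (hv : valid v) (hl : w.length = v.length)
    (h : place w '' G = place v '' G) : w = v := by
  by_contra hne
  obtain ⟨p, hp⟩ := Nb.of_touch hw hv hl hne (by
    rw [h, Set.inter_self]; exact ⟨_, _, mem_G_zero, rfl⟩)
  obtain ⟨hp38, -, -, -, -, -, -, hR⟩ := hp.spec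
  obtain ⟨r, hr⟩ := place_scales hw
  obtain ⟨r', hr'⟩ := place_scales hv
  obtain ⟨x, hx⟩ := Sym.moves_spec (codeSym_moves p hp38)
  have := hR x
  rw [← hr.eq_of_image hr' h] at this
  exact hx ((place w).injective this.symm)

theorem tileAt_injective (M : Equiv.Perm Plane) {w v : List Bool} (hw : valid w) (hv : valid v)
    (hl : w.length = v.length) (h : tileAt M w = tileAt M v) : w = v := by
  rw [tileAt, tileAt, image_mul_G, image_mul_G] at h
  exact place_injective hw hv hl (Set.image_injective.mpr M.injective h)

theorem Nb.touch {p : ℕ} {w v : List Bool} (h : Nb p w v) (M : Equiv.Perm Plane) :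
    (tileAt M w ∩ tileAt M v).Nonempty := by
  obtain ⟨hp, -, -, -, -, -, -, hR⟩ := h.spec
  rw [tileAt, tileAt, (hR.mul_left M).inter]
  refine Set.Nonempty.image _ ?_
  by_cases hp' : p < 25
  · exact (Sym.edge_spec (codeSym_edge p hp')).nonempty
  · exact (Sym.corner_spec (codeSym_corner p hp (not_lt.mp hp'))).2

theorem Nb.infinite_iff {p : ℕ} {w v : List Bool} (h : Nb p w v) (M : Equiv.Perm Plane) :
    (tileAt M w ∩ tileAt M v).Infinite ↔ p < 25 := by
  obtain ⟨hp, -, -, -, -, -, -, hR⟩ := h.spec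
  rw [tileAt, tileAt, (hR.mul_left M).inter,
    Set.infinite_image_iff (Equiv.injective _).injOn]
  by_cases hp' : p < 25
  · exact iff_of_true (Sym.edge_spec (codeSym_edge p hp')) hp'
  · exact iff_of_false (fun h => h (Sym.corner_spec (codeSym_corner p hp (not_lt.mp hp'))).1) hp'

theorem exists_nb_of_touch {M : Equiv.Perm Plane} {w v : List Bool} (hw : valid w) (hv : valid v)
    (hl : w.length = v.length) (hne : w ≠ v) (h : (tileAt M w ∩ tileAt M v).Nonempty) :
    ∃ p, Nb p w v := by
  refine Nb.of_touch hw hv hl hne ?_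
  rw [tileAt, tileAt, image_mul_G, image_mul_G, ← Set.image_inter M.injective] at h
  exact Set.image_nonempty.mp h

/-! ### Neighbourhood types of the tiles of a supertile -/

/-- The neighbourhood types: whether the tile is small, the types of its children, and the codes of
its neighbours. -/
def nodeList : List (Bool × ℕ × ℕ × List ℕ) := [
  (false, 1, 2, []), (false, 3, 4, [0]), (true, 5, 0, [1]), (false, 6, 7, [0, 2]),
  (true, 8, 0, [1, 3]), (false, 9, 10, [4, 5]), (false, 11, 12, [0, 2, 6, 7]),
  (true, 13, 0, [1, 3]), (false, 14, 15, [4, 5, 8]), (false, 16, 17, [0, 9]),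
  (true, 18, 0, [1, 10, 11]), (false, 19, 20, [0, 2, 6, 7, 12, 13]), (true, 21, 0, [1, 3, 25]),
  (false, 22, 23, [4, 5, 8]), (false, 24, 25, [0, 9, 14]), (true, 26, 0, [1, 10, 11]),
  (false, 27, 28, [0, 2, 15, 26]), (true, 29, 0, [1, 3]), (false, 30, 31, [4, 5, 14, 16]),
  (false, 32, 33, [0, 2, 6, 7, 12, 13, 28]), (true, 34, 0, [1, 3, 17, 18, 25]),
  (false, 35, 36, [4, 5, 8, 27]), (false, 24, 25, [0, 9, 14]), (true, 26, 0, [1, 10, 11]),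
  (false, 37, 38, [0, 2, 15, 19, 26]), (true, 39, 0, [1, 3]), (false, 40, 41, [4, 5, 14, 16]),
  (false, 42, 43, [0, 2, 6, 7, 20, 27]), (true, 44, 0, [1, 3]), (false, 22, 45, [4, 5, 8]),
  (false, 46, 47, [0, 9, 19, 21, 29]), (true, 48, 0, [1, 10, 11]),
  (false, 49, 50, [0, 2, 6, 7, 12, 13, 28]), (true, 51, 0, [1, 3, 17, 18, 25, 31]),
  (false, 52, 53, [4, 5, 8, 19, 21, 27, 29]), (false, 54, 55, [0, 9, 14]),
  (true, 56, 0, [1, 10, 11, 30]), (false, 57, 58, [0, 2, 6, 7, 20, 22, 27, 32]),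
  (true, 59, 0, [1, 3, 23, 33]), (false, 22, 60, [4, 5, 8]), (false, 61, 47, [0, 9, 19, 21, 29]),
  (true, 48, 0, [1, 10, 11]), (false, 62, 63, [0, 2, 6, 7, 12, 13, 28]),
  (true, 64, 0, [1, 3, 18, 25, 30]), (false, 22, 65, [4, 5, 8]), (true, 26, 0, [1, 10, 11]),
  (false, 66, 67, [0, 2, 15, 19, 22, 26, 32, 34]), (true, 68, 0, [1, 3, 23, 33]),
  (false, 40, 69, [4, 5, 14, 16]), (false, 70, 71, [0, 2, 6, 7, 12, 13, 28]),
  (true, 51, 0, [1, 3, 17, 18, 25, 31]), (false, 72, 73, [4, 5, 8, 19, 21, 27, 29, 36]),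
  (false, 74, 75, [0, 9, 14, 19, 22, 32, 34]), (true, 76, 0, [1, 10, 11, 23, 30, 33]),
  (false, 77, 38, [0, 2, 15, 19, 26]), (true, 39, 0, [1, 3]),
  (false, 78, 79, [4, 5, 14, 16, 35]), (false, 80, 81, [0, 2, 6, 7, 12, 13, 28]),
  (true, 82, 0, [1, 3, 18, 24, 25, 30, 31]), (false, 83, 84, [4, 5, 8, 19, 34]),
  (true, 85, 0, [1, 10, 11]), (false, 86, 67, [0, 2, 15, 19, 22, 26, 32, 34]),
  (false, 87, 50, [0, 2, 6, 7, 12, 13, 28]), (true, 51, 0, [1, 3, 17, 18, 25, 31]),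
  (false, 88, 89, [4, 5, 8, 19, 27, 35]), (true, 90, 0, [1, 10, 11]),
  (false, 91, 92, [0, 2, 6, 7, 20, 22, 27, 32]), (true, 93, 0, [1, 3, 23, 24, 31, 33, 37]),
  (false, 83, 94, [4, 5, 8, 19, 34]), (true, 95, 0, [1, 10, 11]),
  (false, 96, 97, [0, 2, 6, 7, 12, 13, 28]), (true, 51, 0, [1, 3, 17, 18, 25, 31]),
  (false, 98, 99, [0, 9, 14, 19, 22, 32, 34, 35]), (true, 100, 0, [1, 10, 11, 23, 30, 33]),
  (false, 101, 102, [0, 2, 15, 19, 22, 26, 32]), (true, 103, 0, [1, 3, 23, 24, 31, 33, 37]),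
  (false, 104, 105, [4, 5, 14, 16, 19, 34, 35]), (false, 57, 58, [0, 2, 6, 7, 20, 22, 27, 32]),
  (false, 106, 107, [0, 9, 19, 21, 27, 29]), (true, 108, 0, [1, 10, 11]),
  (false, 109, 50, [0, 2, 6, 7, 12, 13, 28]), (true, 51, 0, [1, 3, 17, 18, 25, 31]),
  (false, 110, 111, [4, 5, 8, 14, 19, 27, 35, 36]), (false, 112, 113, [0, 9, 14, 22, 32]),
  (true, 114, 0, [1, 10, 11, 23, 33, 37]), (false, 40, 41, [4, 5, 14, 16]),
  (false, 91, 92, [0, 2, 6, 7, 20, 22, 27, 32]), (false, 115, 50, [0, 2, 6, 7, 12, 13, 28]),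
  (false, 116, 117, [0, 9, 14, 22, 27, 32]), (true, 118, 0, [1, 10, 11, 23, 30, 33]),
  (false, 40, 41, [4, 5, 14, 16]), (false, 119, 81, [0, 2, 6, 7, 12, 13, 28]),
  (true, 82, 0, [1, 3, 18, 24, 25, 30, 31]), (false, 120, 121, [4, 5, 8, 14, 19, 34, 35, 36]),
  (true, 114, 0, [1, 10, 11, 23, 33, 37]), (false, 40, 69, [4, 5, 14, 16]),
  (false, 96, 97, [0, 2, 6, 7, 12, 13, 28]), (true, 51, 0, [1, 3, 17, 18, 25, 31]),
  (false, 122, 123, [0, 2, 15, 19, 22, 26, 27, 32]), (true, 124, 0, [1, 3, 23, 24, 31, 33, 37]),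
  (false, 104, 105, [4, 5, 14, 16, 19, 34, 35]), (false, 125, 126, [0, 2, 6, 7, 20, 22, 27, 32]),
  (true, 127, 0, [1, 3, 23, 24, 31, 33]), (false, 120, 128, [4, 5, 8, 14, 19, 34, 35, 36]),
  (false, 129, 130, [0, 9, 19, 21, 22, 27, 29, 32]), (true, 131, 0, [1, 10, 11, 23, 33, 37]),
  (false, 132, 133, [0, 2, 15, 19, 22, 26, 32, 34]), (true, 134, 0, [1, 3, 23, 30, 33]),
  (false, 40, 135, [4, 5, 14, 16]), (false, 96, 97, [0, 2, 6, 7, 12, 13, 28]),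
  (false, 136, 137, [0, 9, 14, 19, 22, 27, 32, 35]), (true, 138, 0, [1, 10, 11, 23, 30, 33]),
  (false, 139, 140, [0, 2, 15, 19, 26]), (true, 141, 0, [1, 3, 24, 31]),
  (false, 142, 143, [4, 5, 14, 16, 19, 34, 35]), (false, 96, 97, [0, 2, 6, 7, 12, 13, 28]),
  (false, 144, 145, [0, 2, 15, 19, 26]), (true, 146, 0, [1, 3, 24, 30, 31]),
  (false, 104, 147, [4, 5, 14, 16, 19, 34, 35]), (false, 148, 97, [0, 2, 6, 7, 12, 13, 28]),
  (false, 136, 137, [0, 9, 14, 19, 22, 27, 32, 35]), (true, 149, 0, [1, 10, 11, 23, 33, 37]),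
  (false, 150, 92, [0, 2, 6, 7, 20, 22, 27, 32]), (true, 151, 0, [1, 3, 23, 24, 30, 31, 33]),
  (false, 120, 152, [4, 5, 8, 14, 19, 34, 35, 36]), (false, 153, 154, [0, 2, 6, 7, 12, 13, 28]),
  (true, 82, 0, [1, 3, 18, 24, 25, 30, 31]), (false, 155, 156, [4, 5, 8, 14, 19, 34, 36]),
  (true, 157, 0, [1, 10, 11, 23, 33, 37]), (false, 158, 159, [0, 2, 15, 19, 22, 26, 32, 34]),
  (true, 160, 0, [1, 3, 23, 24, 30, 31, 33]), (false, 142, 105, [4, 5, 14, 16, 19, 34, 35]),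
  (false, 161, 92, [0, 2, 6, 7, 20, 22, 27, 32]), (true, 93, 0, [1, 3, 23, 24, 31, 33, 37]),
  (false, 162, 163, [4, 5, 8, 19, 34, 35]), (true, 164, 0, [1, 10, 11]),
  (false, 122, 123, [0, 2, 15, 19, 22, 26, 27, 32]), (true, 165, 0, [1, 3, 23, 24, 30, 31, 33]),
  (false, 104, 105, [4, 5, 14, 16, 19, 34, 35]), (false, 166, 58, [0, 2, 6, 7, 20, 22, 27, 32]),
  (true, 59, 0, [1, 3, 23, 33]), (false, 167, 168, [4, 5, 8, 14, 36]),
  (false, 129, 130, [0, 9, 19, 21, 22, 27, 29, 32]), (true, 169, 0, [1, 10, 11, 23, 33, 37]),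
  (false, 170, 58, [0, 2, 6, 7, 20, 22, 27, 32]), (true, 59, 0, [1, 3, 23, 33]),
  (false, 171, 172, [4, 5, 8, 14, 35, 36]), (true, 173, 0, [1, 10, 11, 23, 33, 37]),
  (false, 96, 97, [0, 2, 6, 7, 12, 13, 28]), (false, 142, 105, [4, 5, 14, 16, 19, 34, 35]),
  (false, 174, 154, [0, 2, 6, 7, 12, 13, 28]), (false, 175, 121, [4, 5, 8, 14, 19, 34, 35, 36]),
  (true, 149, 0, [1, 10, 11, 23, 33, 37]), (false, 148, 97, [0, 2, 6, 7, 12, 13, 28]),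
  (true, 51, 0, [1, 3, 17, 18, 25, 31]), (false, 176, 177, [0, 9, 14, 19, 22, 32, 35]),
  (true, 178, 0, [1, 10, 11, 23, 33, 37]), (false, 142, 105, [4, 5, 14, 16, 19, 34, 35]),
  (false, 150, 92, [0, 2, 6, 7, 20, 22, 27, 32]), (true, 93, 0, [1, 3, 23, 24, 31, 33, 37]),
  (false, 175, 152, [4, 5, 8, 14, 19, 34, 35, 36]), (false, 119, 81, [0, 2, 6, 7, 12, 13, 28]),
  (false, 116, 117, [0, 9, 14, 22, 27, 32]), (true, 179, 0, [1, 10, 11, 23, 33, 37]),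
  (false, 40, 69, [4, 5, 14, 16]), (false, 175, 152, [4, 5, 8, 14, 19, 34, 35, 36]),
  (false, 180, 154, [0, 2, 6, 7, 12, 13, 28]), (false, 181, 182, [0, 9, 14, 19, 35]),
  (true, 183, 0, [1, 10, 11]), (false, 142, 105, [4, 5, 14, 16, 19, 34, 35]),
  (false, 180, 154, [0, 2, 6, 7, 12, 13, 28]), (false, 184, 185, [0, 9, 14, 19, 27, 35]),
  (true, 186, 0, [1, 10, 11]), (false, 142, 105, [4, 5, 14, 16, 19, 34, 35]),
  (false, 148, 97, [0, 2, 6, 7, 12, 13, 28]), (false, 136, 137, [0, 9, 14, 19, 22, 27, 32, 35]),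
  (false, 187, 188, [0, 2, 15, 19, 22, 26, 27, 32]), (true, 189, 0, [1, 3, 23, 24, 31, 33]),
  (false, 142, 190, [4, 5, 14, 16, 19, 34, 35]), (false, 142, 147, [4, 5, 14, 16, 19, 34, 35]),
  (false, 109, 50, [0, 2, 6, 7, 12, 13, 28]), (false, 191, 192, [0, 2, 15, 19, 22, 26, 27, 32]),
  (true, 193, 0, [1, 3, 23, 33]), (false, 40, 69, [4, 5, 14, 16]),
  (false, 194, 195, [0, 2, 15, 19, 22, 26, 27, 32]), (true, 196, 0, [1, 3, 23, 30, 33]),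
  (false, 40, 135, [4, 5, 14, 16]), (false, 197, 92, [0, 2, 6, 7, 20, 22, 27, 32]),
  (true, 151, 0, [1, 3, 23, 24, 30, 31, 33]), (false, 155, 198, [4, 5, 8, 14, 19, 34, 36]),
  (true, 199, 0, [1, 10, 11, 23, 33, 37]), (false, 91, 92, [0, 2, 6, 7, 20, 22, 27, 32]),
  (true, 151, 0, [1, 3, 23, 24, 30, 31, 33]), (false, 83, 94, [4, 5, 8, 19, 34]),
  (false, 161, 92, [0, 2, 6, 7, 20, 22, 27, 32]), (true, 151, 0, [1, 3, 23, 24, 30, 31, 33]),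
  (false, 162, 163, [4, 5, 8, 19, 34, 35]), (false, 174, 154, [0, 2, 6, 7, 12, 13, 28]),
  (true, 178, 0, [1, 10, 11, 23, 33, 37]), (false, 142, 105, [4, 5, 14, 16, 19, 34, 35])]

/-- For each neighbourhood type the codes of the neighbours along an edge, with their types. -/
def edgeList : List (List (ℕ × ℕ)) := [
  [], [(0, 2)], [(1, 1)], [(0, 4), (2, 5)], [(1, 3), (3, 5)], [(4, 3), (5, 4)],
  [(0, 7), (2, 8), (6, 9), (7, 10)], [(1, 6), (3, 8)], [(4, 6), (5, 7), (8, 10)],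
  [(0, 10), (9, 6)], [(1, 9), (10, 6), (11, 8)],
  [(0, 12), (2, 13), (6, 14), (7, 15), (12, 16), (13, 18)], [(1, 11), (3, 13)],
  [(4, 11), (5, 12), (8, 15)], [(0, 15), (9, 11), (14, 18)], [(1, 14), (10, 11), (11, 13)],
  [(0, 17), (2, 18), (15, 11)], [(1, 16), (3, 18)], [(4, 16), (5, 17), (14, 14), (16, 11)],
  [(0, 20), (2, 21), (6, 22), (7, 23), (12, 24), (13, 26)],
  [(1, 19), (3, 21), (17, 27), (18, 30)], [(4, 19), (5, 20), (8, 23)],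
  [(0, 23), (0, 45), (0, 60), (0, 65), (9, 19), (9, 42), (9, 57), (9, 62), (14, 26), (14, 48), (14, 108)],
  [(1, 22), (10, 19), (11, 21)],
  [(0, 25), (2, 26), (2, 85), (2, 90), (15, 19), (15, 32), (15, 62), (15, 80), (15, 87), (19, 30), (19, 40)],
  [(1, 24), (3, 26), (3, 85), (3, 90)],
  [(4, 24), (5, 25), (14, 22), (14, 35), (16, 19), (16, 32), (16, 62)],
  [(0, 28), (2, 29), (6, 30), (7, 31), (20, 20)], [(1, 27), (3, 29)],
  [(4, 27), (5, 28), (8, 31)], [(0, 31), (9, 27), (19, 24), (21, 20)],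
  [(1, 30), (10, 27), (11, 29)], [(0, 33), (2, 34), (6, 35), (7, 36), (12, 24), (13, 26)],
  [(1, 32), (3, 34), (17, 37), (18, 40)], [(4, 32), (5, 33), (8, 36), (19, 46), (21, 43)],
  [(0, 36), (9, 32), (14, 26)], [(1, 35), (10, 32), (11, 34)],
  [(0, 38), (2, 39), (6, 40), (7, 41), (20, 33), (20, 50), (22, 46), (22, 61)],
  [(1, 37), (1, 77), (3, 39), (23, 47)], [(4, 37), (4, 77), (5, 38), (8, 41), (8, 79)],
  [(0, 41), (0, 69), (0, 135), (9, 37), (9, 66), (9, 86), (9, 132), (9, 191), (9, 194), (19, 24), (19, 54), (19, 112), (19, 116), (21, 33), (21, 50), (21, 63), (21, 81)],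
  [(1, 40), (10, 37), (11, 39)], [(0, 43), (2, 44), (6, 22), (7, 45), (12, 46), (13, 48)],
  [(1, 42), (3, 44), (18, 34)], [(4, 42), (5, 43), (8, 45)], [(1, 22), (10, 42), (11, 44)],
  [(0, 47), (2, 48), (15, 42), (19, 34), (22, 37)],
  [(1, 46), (1, 61), (3, 48), (3, 95), (3, 164), (23, 38), (23, 140), (23, 145)],
  [(4, 46), (4, 61), (5, 47), (14, 22), (16, 42), (16, 57)],
  [(0, 50), (2, 51), (6, 52), (7, 53), (12, 54), (13, 56)],
  [(1, 49), (1, 87), (1, 109), (1, 115), (3, 51), (17, 37), (17, 191), (17, 194), (18, 40)],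
  [(4, 49), (4, 70), (4, 87), (4, 96), (4, 109), (4, 115), (4, 148), (5, 50), (5, 71), (5, 97), (8, 53), (8, 73), (8, 89), (8, 111), (19, 61), (19, 106), (19, 129), (21, 58), (21, 92), (21, 126)],
  [(0, 53), (9, 49), (14, 56), (19, 64), (22, 66)], [(1, 52), (10, 49), (11, 51), (23, 67)],
  [(0, 55), (2, 56), (15, 49), (19, 40)], [(1, 54), (3, 56)],
  [(4, 54), (5, 55), (14, 52), (16, 49)],
  [(0, 58), (2, 59), (6, 22), (7, 60), (12, 61), (12, 106), (13, 48), (13, 108)],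
  [(1, 57), (1, 166), (1, 170), (3, 59), (18, 51), (24, 67)],
  [(4, 57), (4, 166), (4, 170), (5, 58), (8, 60), (8, 168), (8, 172), (19, 68)],
  [(1, 22), (10, 57), (11, 59)],
  [(0, 47), (2, 48), (2, 95), (2, 164), (15, 57), (15, 91), (15, 161), (19, 51), (22, 37), (22, 77), (22, 139), (22, 144)],
  [(0, 63), (2, 64), (6, 22), (7, 65), (12, 24), (13, 26)],
  [(1, 62), (3, 64), (17, 66), (18, 40)], [(4, 62), (5, 63), (8, 65), (19, 52)],
  [(1, 22), (10, 62), (11, 64)], [(0, 67), (2, 68), (6, 40), (7, 69), (20, 63), (22, 52)],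
  [(1, 66), (1, 86), (3, 68), (23, 53), (23, 73), (24, 58)],
  [(4, 66), (4, 86), (5, 67), (8, 69), (19, 59)],
  [(1, 40), (10, 66), (10, 86), (10, 191), (11, 68), (11, 193)],
  [(0, 71), (2, 51), (6, 72), (7, 73), (12, 74), (13, 76)],
  [(1, 70), (3, 51), (17, 77), (18, 78)],
  [(0, 73), (9, 70), (9, 96), (9, 115), (14, 76), (14, 100), (14, 118), (14, 138), (19, 82), (22, 86), (22, 132), (22, 158)],
  [(1, 72), (10, 70), (10, 96), (10, 115), (11, 51), (23, 67), (23, 133), (23, 159)],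
  [(0, 75), (2, 76), (15, 70), (19, 78), (22, 88)], [(1, 74), (3, 76), (23, 89), (24, 92)],
  [(4, 74), (5, 75), (14, 72), (16, 70), (19, 93)],
  [(0, 38), (2, 39), (6, 78), (7, 79), (20, 71), (22, 61)],
  [(0, 79), (9, 77), (19, 74), (21, 71)], [(1, 78), (10, 77), (11, 39)],
  [(0, 81), (2, 82), (6, 83), (7, 84), (12, 24), (13, 85)],
  [(1, 80), (1, 119), (3, 82), (17, 86), (17, 132), (18, 40)],
  [(4, 80), (4, 119), (4, 153), (4, 174), (4, 180), (5, 81), (5, 154), (8, 84), (8, 121), (8, 156), (14, 93), (14, 103), (14, 124), (19, 72)],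
  [(0, 84), (0, 94), (9, 80), (9, 91), (9, 180), (14, 85), (14, 95), (14, 183), (14, 186), (22, 83)],
  [(1, 83), (10, 80), (10, 180), (11, 82), (23, 94)], [(4, 24), (5, 25), (14, 83), (16, 80)],
  [(0, 67), (2, 68), (6, 40), (7, 69), (20, 81), (22, 72)],
  [(0, 50), (2, 51), (6, 88), (7, 89), (12, 24), (13, 90)],
  [(0, 89), (9, 87), (14, 90), (22, 74)], [(1, 88), (10, 87), (11, 51), (23, 75)],
  [(4, 24), (5, 25), (14, 88), (16, 87)],
  [(0, 92), (2, 93), (2, 151), (6, 83), (7, 94), (12, 61), (13, 95)],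
  [(1, 91), (1, 150), (1, 161), (1, 197), (3, 93), (3, 151), (18, 51), (24, 75), (24, 99), (24, 159)],
  [(4, 91), (4, 150), (4, 161), (5, 92), (8, 94), (8, 152), (8, 163), (14, 82), (19, 76), (19, 100)],
  [(1, 83), (10, 91), (11, 93), (11, 151), (23, 84), (23, 94)],
  [(4, 61), (5, 47), (14, 83), (16, 91)],
  [(0, 97), (2, 51), (6, 72), (7, 73), (12, 98), (12, 136), (13, 100), (13, 138)],
  [(1, 96), (1, 148), (3, 51), (17, 101), (17, 122), (17, 139), (17, 144), (17, 187), (18, 104), (18, 142)],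
  [(0, 99), (2, 100), (15, 96), (19, 104), (22, 110)], [(1, 98), (3, 100), (23, 111), (24, 92)],
  [(4, 98), (5, 99), (14, 72), (16, 96), (19, 93)],
  [(0, 102), (2, 103), (6, 104), (7, 105), (20, 97), (22, 106)],
  [(1, 101), (3, 103), (23, 107), (24, 117)],
  [(4, 101), (5, 102), (8, 105), (14, 82), (19, 118)],
  [(0, 105), (0, 147), (9, 101), (9, 122), (9, 144), (19, 98), (21, 97), (22, 120)],
  [(1, 104), (1, 142), (10, 101), (10, 122), (10, 158), (11, 103), (11, 124), (11, 160), (11, 165), (23, 105), (23, 121), (23, 152)],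
  [(0, 107), (2, 108), (15, 57), (19, 51), (22, 101)], [(1, 106), (3, 108), (23, 102)],
  [(4, 106), (5, 107), (14, 22), (16, 57)],
  [(0, 50), (2, 51), (6, 110), (7, 111), (12, 112), (13, 114)],
  [(0, 111), (9, 109), (9, 148), (14, 114), (14, 149), (14, 178), (19, 120), (22, 98)],
  [(1, 110), (10, 109), (10, 148), (11, 51), (23, 99)],
  [(0, 113), (2, 114), (15, 109), (15, 119), (19, 40)], [(1, 112), (3, 114), (24, 113)],
  [(4, 112), (5, 113), (14, 110), (14, 120), (14, 175), (16, 109), (16, 119), (19, 114)],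
  [(0, 50), (2, 51), (6, 72), (7, 73), (12, 116), (13, 118)],
  [(0, 117), (2, 118), (2, 179), (15, 115), (15, 119), (19, 40)],
  [(1, 116), (3, 118), (3, 179), (24, 102), (24, 177)],
  [(4, 116), (5, 117), (14, 72), (16, 115), (19, 103)],
  [(0, 81), (2, 82), (6, 120), (6, 175), (7, 121), (12, 112), (12, 116), (13, 114), (13, 179)],
  [(0, 121), (0, 128), (0, 152), (9, 119), (9, 125), (9, 150), (9, 174), (14, 114), (14, 131), (14, 149), (14, 179), (19, 110), (22, 104)],
  [(1, 120), (1, 175), (10, 119), (10, 174), (11, 82), (23, 105), (23, 152)],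
  [(0, 123), (2, 124), (2, 165), (6, 104), (6, 142), (7, 105), (20, 97), (22, 129)],
  [(1, 122), (3, 124), (3, 165), (23, 130), (24, 123), (24, 137)],
  [(4, 122), (5, 123), (8, 105), (14, 82), (19, 138)],
  [(0, 126), (2, 127), (6, 120), (7, 128), (12, 129), (13, 131)],
  [(1, 125), (3, 127), (18, 51), (24, 133)],
  [(4, 125), (5, 126), (8, 128), (14, 146), (19, 134)],
  [(1, 120), (10, 125), (11, 127), (23, 147)],
  [(0, 130), (2, 131), (2, 169), (2, 173), (2, 199), (15, 125), (15, 150), (15, 166), (15, 170), (15, 197), (19, 51), (22, 122), (22, 187), (22, 191), (22, 194)],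
  [(1, 129), (3, 131), (3, 169), (3, 173), (3, 199), (23, 123), (23, 188), (23, 192), (23, 195), (24, 130), (24, 137)],
  [(4, 129), (5, 130), (14, 120), (14, 175), (16, 125), (16, 150), (19, 131), (19, 149)],
  [(0, 133), (2, 134), (6, 40), (7, 135), (20, 81), (22, 72)],
  [(1, 132), (3, 134), (23, 73), (24, 126)], [(4, 132), (5, 133), (8, 135), (19, 127)],
  [(1, 40), (10, 132), (10, 194), (11, 134), (11, 196)],
  [(0, 137), (2, 138), (2, 149), (2, 157), (15, 96), (15, 148), (15, 153), (15, 174), (19, 142), (22, 136)],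
  [(1, 136), (3, 138), (3, 149), (3, 157), (23, 137), (24, 123), (24, 130), (24, 137)],
  [(4, 136), (5, 137), (14, 72), (16, 96), (19, 124)],
  [(0, 140), (2, 141), (6, 142), (7, 143), (20, 97), (22, 61)], [(1, 139), (3, 141), (23, 47)],
  [(4, 139), (5, 140), (8, 143), (14, 141)],
  [(0, 105), (0, 143), (0, 147), (0, 190), (9, 122), (9, 139), (9, 144), (9, 158), (9, 187), (19, 136), (19, 176), (19, 181), (19, 184), (21, 97), (21, 154), (22, 142)],
  [(1, 142), (10, 139), (11, 141), (23, 143)],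
  [(0, 145), (2, 146), (6, 104), (6, 142), (7, 147), (20, 97), (22, 61)],
  [(1, 144), (3, 146), (23, 47)], [(4, 144), (5, 145), (8, 147), (14, 127), (14, 189)],
  [(1, 104), (1, 142), (10, 144), (11, 146), (23, 128), (23, 190)],
  [(0, 97), (2, 51), (6, 110), (7, 111), (12, 136), (12, 176), (13, 149), (13, 178)],
  [(4, 136), (5, 137), (14, 110), (14, 120), (14, 175), (16, 148), (16, 174), (19, 131), (19, 149)],
  [(0, 92), (2, 93), (2, 151), (6, 120), (6, 175), (7, 152), (12, 129), (13, 131)],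
  [(4, 91), (4, 150), (4, 161), (4, 197), (5, 92), (8, 94), (8, 152), (8, 163), (8, 198), (14, 151), (14, 165), (19, 160)],
  [(1, 120), (1, 175), (10, 150), (11, 93), (11, 151), (23, 105), (23, 121), (23, 152)],
  [(0, 154), (2, 82), (6, 155), (7, 156), (12, 136), (13, 157)],
  [(1, 153), (1, 174), (1, 180), (3, 82), (17, 158), (18, 142)],
  [(0, 156), (0, 198), (9, 153), (9, 197), (14, 157), (14, 199), (19, 171), (22, 162)],
  [(1, 155), (10, 153), (11, 82), (23, 163)],
  [(4, 136), (5, 137), (14, 155), (16, 153), (19, 173)],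
  [(0, 159), (2, 160), (6, 142), (7, 105), (20, 154), (22, 72)],
  [(1, 158), (3, 160), (23, 73), (24, 92)],
  [(4, 158), (5, 159), (8, 105), (14, 160), (14, 165), (19, 151)],
  [(0, 92), (2, 93), (2, 151), (6, 162), (7, 163), (12, 61), (13, 164)],
  [(0, 163), (9, 161), (14, 164), (22, 155)],
  [(1, 162), (10, 161), (11, 93), (11, 151), (23, 156), (23, 198)],
  [(4, 61), (5, 47), (14, 162), (16, 161)],
  [(4, 122), (5, 123), (8, 105), (14, 151), (14, 160), (14, 165), (19, 165)],
  [(0, 58), (2, 59), (6, 167), (7, 168), (12, 129), (13, 169)],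
  [(0, 168), (9, 166), (14, 169), (19, 167)], [(1, 167), (10, 166), (11, 59)],
  [(4, 129), (5, 130), (14, 167), (16, 166), (19, 169)],
  [(0, 58), (2, 59), (6, 171), (7, 172), (12, 129), (13, 173)],
  [(0, 172), (9, 170), (14, 173), (19, 155)], [(1, 171), (10, 170), (11, 59)],
  [(4, 129), (5, 130), (14, 171), (16, 170), (19, 157), (19, 199)],
  [(0, 154), (2, 82), (6, 120), (6, 175), (7, 121), (12, 136), (12, 176), (13, 149), (13, 178)],
  [(0, 121), (0, 152), (9, 119), (9, 150), (9, 174), (14, 114), (14, 131), (14, 149), (14, 178), (14, 179), (19, 175), (22, 175)],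
  [(0, 177), (2, 178), (15, 148), (15, 174), (19, 142), (22, 184)],
  [(1, 176), (3, 178), (23, 185), (24, 117)],
  [(4, 176), (5, 177), (14, 110), (14, 175), (16, 148), (16, 174), (19, 179)],
  [(4, 116), (5, 117), (14, 120), (14, 175), (16, 119), (19, 178)],
  [(0, 154), (2, 82), (6, 83), (7, 84), (12, 181), (12, 184), (13, 183), (13, 186)],
  [(0, 182), (2, 183), (15, 180), (19, 142), (22, 181)], [(1, 181), (3, 183), (23, 182)],
  [(4, 181), (5, 182), (14, 83), (16, 180)],
  [(0, 185), (2, 186), (15, 180), (19, 142), (22, 176)], [(1, 184), (3, 186), (23, 177)],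
  [(4, 184), (5, 185), (14, 83), (16, 180)],
  [(0, 188), (2, 189), (6, 142), (7, 190), (20, 97), (22, 129)],
  [(1, 187), (3, 189), (23, 130), (24, 195)],
  [(4, 187), (5, 188), (8, 190), (14, 146), (19, 196)],
  [(1, 142), (10, 187), (11, 189), (23, 147)],
  [(0, 192), (2, 193), (6, 40), (7, 69), (20, 50), (22, 129)],
  [(1, 191), (3, 193), (23, 130), (24, 192)], [(4, 191), (5, 192), (8, 69), (19, 193)],
  [(0, 195), (2, 196), (6, 40), (7, 135), (20, 50), (22, 129)],
  [(1, 194), (3, 196), (23, 130), (24, 188)], [(4, 194), (5, 195), (8, 135), (19, 189)],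
  [(0, 92), (2, 151), (6, 155), (7, 198), (12, 129), (13, 199)],
  [(1, 155), (10, 197), (11, 151), (23, 163)],
  [(4, 129), (5, 130), (14, 155), (16, 197), (19, 173)]]

/-- The colours of the neighbourhood types. -/
def colourList : List ℕ := [
  0, 40016, 40016, 80128, 80128, 80128, 160416, 80400, 120464, 80400, 120464, 240938, 90720,
  120801, 120976, 120864, 130896, 80425, 160953, 251291, 171524, 131058, 121025, 120938, 171234,
  80545, 161122, 210930, 80585, 120649, 171163, 120874, 251666, 182074, 221843, 121050, 131253,
  261599, 130989, 120989, 171433, 121109, 251413, 141253, 120965, 120913, 232210, 130954, 161467,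
  252239, 182119, 232163, 222238, 181999, 171267, 80578, 171462, 251723, 191804, 171419, 121058,
  232255, 251481, 181914, 181577, 121093, 261891, 191650, 171470, 121254, 252674, 182154, 232638,
  182044, 222118, 191653, 222528, 261634, 181628, 121144, 252011, 182119, 232331, 171494, 181767,
  161267, 261936, 252046, 181689, 181839, 161302, 252288, 192044, 232323, 181767, 161612, 252719,
  182359, 232528, 191698, 222573, 262559, 181597, 232337, 232382, 182058, 232282, 141109, 161494,
  252479, 232491, 182044, 171567, 130942, 222096, 252479, 171594, 141097, 222168, 252479, 232491,
  182007, 262596, 191927, 232374, 252711, 191999, 221958, 181962, 232675, 191735, 222528, 261971,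
  191685, 181665, 121289, 232528, 191735, 222573, 262164, 131134, 171458, 232382, 181818, 262199,
  131169, 181653, 181853, 252719, 222528, 252756, 232368, 182007, 252674, 182359, 222081, 181962,
  222483, 262596, 191890, 232419, 252323, 181689, 181802, 161647, 232419, 252096, 171542, 121203,
  222288, 252131, 181737, 121238, 222323, 252719, 232491, 232491, 181405, 222491, 222123, 252251,
  232108, 130954, 161612, 232135, 141109, 161639, 262551, 191882, 222009, 182013, 261936, 191687,
  171470, 261971, 191722, 181665, 252711, 181962, 222483]

/-- The colours of a small tile and its partner. -/
def partnerColours : List (ℕ × ℕ) := [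
  (80425, 130896), (80545, 171234), (80578, 171267), (80585, 210930), (90720, 240938),
  (120864, 120976), (120874, 171163), (120913, 121025), (120938, 121025), (121058, 121025),
  (121093, 121025), (121109, 171433), (121144, 181628), (121203, 171542), (121238, 181737),
  (121254, 171433), (121289, 171433), (130942, 171567), (130954, 232108), (130954, 232210),
  (130954, 232255), (130989, 261599), (130989, 261634), (131134, 262164), (131169, 262199),
  (131253, 121050), (141097, 171594), (141109, 232135), (141109, 232282), (141253, 251413),
  (171524, 251291), (181405, 232491), (181597, 262559), (181767, 171494), (181802, 181689),
  (181818, 232382), (181839, 181689), (181853, 232382), (181914, 251481), (181962, 222081),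
  (181962, 232491), (181999, 222238), (182007, 232491), (182013, 232382), (182044, 232491),
  (182044, 232638), (182058, 232382), (182074, 251666), (182119, 252011), (182119, 252046),
  (182119, 252239), (182119, 252479), (182154, 252674), (182359, 252251), (182359, 252674),
  (182359, 252719), (191650, 261891), (191650, 261936), (191653, 222118), (191685, 261971),
  (191687, 261936), (191698, 232528), (191722, 261971), (191735, 232528), (191735, 232675),
  (191804, 251723), (191804, 252096), (191804, 252131), (191882, 262551), (191890, 262596),
  (191927, 262596), (191999, 252711), (192044, 252288), (192044, 252323), (192044, 252711),
  (192044, 252756)]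

/-- The default row of `nodeList`. -/
def nodeRow (m : ℕ) : Bool × ℕ × ℕ × List ℕ := nodeList.getD m (false, 0, 0, [])

/-- A tile of type `m` is small. -/
def nodeSmall (m : ℕ) : Bool := (nodeRow m).1

/-- The type of the `i`-th child of a tile of type `m`. -/
def nodeNext (m : ℕ) (i : Bool) : ℕ := if i then (nodeRow m).2.2.1 else (nodeRow m).2.1

/-- The codes of the neighbours of a tile of type `m`. -/
def nodeCodes (m : ℕ) : List ℕ := (nodeRow m).2.2.2

/-- The codes and types of the edge neighbours of a tile of type `m`. -/
def edgeRow (m : ℕ) : List (ℕ × ℕ) := edgeList.getD m []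

/-- The codes of the neighbours of the `i`-th child of a tile of type `m`. -/
def childCodes (m : ℕ) (i : Bool) : List ℕ :=
  (if nodeSmall m then [] else [i.toNat]) ++ (nodeCodes m).flatMap fun p =>
    [false, true].filterMap fun j =>
      if hasChild (codeSmall' p) j then (if child p i j = 0 then none else some (child p i j - 1))
      else none

/-- The number of neighbours of a tile of type `m`, those along an edge counted four times. -/
def nodeCount (m : ℕ) : ℕ :=
  3 * ((nodeCodes m).filter fun p => decide (p < 25)).length + (nodeCodes m).length

/-- The value of `nodeCount` at the edge neighbour with code `p`. -/
def edgeCount (m p : ℕ) : ℕ :=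
  nodeCount (((edgeRow m).find? fun x => decide (x.1 = p)).getD (0, 0)).2

/-- The colour of a tile of type `m`. -/
def nodeColour (m : ℕ) : ℕ := colourList.getD m 0

theorem node_children : ∀ m < 200, ∀ i, hasChild (nodeSmall m) i = true → nodeNext m i < 200 ∧
    nodeSmall (nodeNext m i) = childSmall (nodeSmall m) i := by decide +kernel

theorem node_nodup : ∀ m < 200, (nodeCodes m).Nodup := by decide +kernel

/-- The types are closed under substitution: the neighbours of a child are its sibling and children
of the neighbours of its parent, so their codes are determined by the type of the parent. -/
theorem node_codes : ∀ m < 200, ∀ i, hasChild (nodeSmall m) i = true →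
    (∀ p ∈ childCodes m i, p ∈ nodeCodes (nodeNext m i)) ∧
    (∀ p ∈ nodeCodes (nodeNext m i), p ∈ childCodes m i) := by decide +kernel

/-- Since `child` stores codes increased by one, the bound 26 there means an edge code. Edge
neighbours thus have parents that are edge neighbours, or siblings. -/
theorem edge_of_child : ∀ p < 38, ∀ i j, child p i j ≠ 0 → child p i j < 26 → p < 25 := by
  decide +kernel

theorem edge_siblings : ∀ m < 200, nodeSmall m = false →
    (0, nodeNext m true) ∈ edgeRow (nodeNext m false) ∧
    (1, nodeNext m false) ∈ edgeRow (nodeNext m true) := by decide +kernel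

/-- The children of edge neighbours that are edge neighbours are listed as such. -/
def edgeCheck (m : ℕ) (x : ℕ × ℕ) (i j : Bool) : Bool :=
  !(hasChild (nodeSmall m) i && hasChild (nodeSmall x.2) j) || child x.1 i j == 0 ||
    Nat.ble 26 (child x.1 i j) ||
    decide ((child x.1 i j - 1, nodeNext x.2 j) ∈ edgeRow (nodeNext m i))

theorem edge_children : ∀ m < 200, ∀ x ∈ edgeRow m, ∀ i j, edgeCheck m x i j = true := by
  decide +kernel

/-- For one code, `edgeRow` may list several types of neighbours. All of them give the same count,
so the count depends on the type and the code only. -/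
theorem edge_count : ∀ m < 200, ∀ x ∈ edgeRow m, nodeCount x.2 = edgeCount m x.1 := by
  decide +kernel

theorem node_colour : ∀ m < 200, nodeColour m = 10000 * nodeCount m +
    (((nodeCodes m).filter fun p => decide (p < 25)).map fun p => edgeCount m p ^ 2).sum := by
  decide +kernel

/-- The numbering of the types follows the first levels: from level four on only types from 11 on
occur, and for these `partner_colours` is valid. -/
theorem node_level : ∀ m < 200, ∀ i, hasChild (nodeSmall m) i = true → 1 ≤ nodeNext m i ∧
    (1 ≤ m → 3 ≤ nodeNext m i) ∧ (3 ≤ m → 6 ≤ nodeNext m i) ∧ (6 ≤ m → 11 ≤ nodeNext m i) := by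
  decide +kernel

/-- The finite check behind the recognition of partners: among edge neighbours, the pair of colours
identifies code 1, the position of a large child relative to its small sibling. -/
theorem partner_colours : ∀ m < 200, 11 ≤ m → ∀ x ∈ edgeRow m,
    ((nodeColour m, nodeColour x.2) ∈ partnerColours ↔ x.1 = 1) := by decide +kernel

/-- The neighbourhood type of the tile reached by a path. -/
def nodeOf : List Bool → ℕ
  | [] => 0
  | i :: w => nodeNext (nodeOf w) i

theorem nodeOf_spec {w : List Bool} (hw : valid w) : nodeOf w < 200 ∧ nodeSmall (nodeOf w) = small w := by
  induction w with
  | nil => exact ⟨by norm_num [nodeOf], rfl⟩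
  | cons i w ih =>
    obtain ⟨h1, h2⟩ := ih hw.1
    have h := node_children _ h1 i (h2 ▸ hw.2)
    exact ⟨h.1, by rw [nodeOf, h.2, h2, small]⟩

theorem nodeOf_level {w : List Bool} (hw : valid w) (h : 4 ≤ w.length) : 11 ≤ nodeOf w := by
  have key : ∀ w : List Bool, valid w → (1 ≤ w.length → 1 ≤ nodeOf w) ∧
      (2 ≤ w.length → 3 ≤ nodeOf w) ∧ (3 ≤ w.length → 6 ≤ nodeOf w) ∧
      (4 ≤ w.length → 11 ≤ nodeOf w) := by
    intro w hw
    induction w with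
    | nil => simp
    | cons i w ih =>
      obtain ⟨h1, h2, h3, h4⟩ := ih hw.1
      have hs := nodeOf_spec hw.1
      obtain ⟨n1, n2, n3, n4⟩ := node_level _ hs.1 i (hs.2 ▸ hw.2)
      rw [List.length_cons, nodeOf]
      refine ⟨fun _ => n1, fun h => n2 (h1 (by omega)), fun h => n3 (h2 (by omega)),
        fun h => n4 (h3 (by omega))⟩
  exact (key w hw).2.2.2 h

theorem mem_childCodes {m : ℕ} {i : Bool} {q : ℕ} : q ∈ childCodes m i ↔
    (nodeSmall m = false ∧ q = i.toNat) ∨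
    ∃ p ∈ nodeCodes m, ∃ j, hasChild (codeSmall' p) j = true ∧ child p i j = q + 1 := by
  have key : ∀ p j, ((if hasChild (codeSmall' p) j = true then
      (if child p i j = 0 then none else some (child p i j - 1)) else none) = some q) ↔
      hasChild (codeSmall' p) j = true ∧ child p i j = q + 1 := by
    intro p j
    split_ifs with h1 h2
    · simp [h1]; omega
    · simp only [Option.some.injEq, h1, true_and]; omega
    · simp [h1]
  rw [childCodes, List.mem_append, List.mem_flatMap]
  refine or_congr ?_ (exists_congr fun p => and_congr_right fun _ => ?_)
  · cases nodeSmall m <;> simp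
  · rw [List.mem_filterMap]
    constructor
    · rintro ⟨j, -, h⟩
      exact ⟨j, (key p j).mp h⟩
    · rintro ⟨j, h⟩
      exact ⟨j, by cases j <;> simp, (key p j).mpr h⟩

/-- Induction along the path: a child inherits its neighbours from its sibling and from the children
of the neighbours of its parent, which is what `childCodes` records. -/
theorem mem_nodeCodes {w : List Bool} (hw : valid w) (p : ℕ) :
    p ∈ nodeCodes (nodeOf w) ↔ ∃ v, Nb p w v := by
  induction w generalizing p with
  | nil =>
    constructor
    · intro h; cases h
    · rintro ⟨v, hv⟩; cases hv
  | cons i w ih =>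
    have hs := nodeOf_spec hw.1
    have hc := node_codes _ hs.1 i (hs.2 ▸ hw.2)
    have e : p ∈ nodeCodes (nodeOf (i :: w)) ↔ p ∈ childCodes (nodeOf w) i := ⟨hc.2 p, hc.1 p⟩
    rw [e, mem_childCodes, hs.2]
    constructor
    · rintro (⟨h1, rfl⟩ | ⟨q, hq, j, hj, hc⟩)
      · cases i
        · exact ⟨_, .left hw.1 h1⟩
        · exact ⟨_, .right hw.1 h1⟩
      · obtain ⟨v, hv⟩ := (ih hw.1 q).mp hq
        exact ⟨_, .desc hv hw.2 (by rw [hv.spec.2.2.2.2.2.2.1]; exact hj) hc⟩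
    · rintro ⟨v, hv⟩
      cases hv with
      | left h h' => exact Or.inl ⟨h', rfl⟩
      | right h h' => exact Or.inl ⟨h', rfl⟩
      | desc h h1 h2 h3 =>
        exact Or.inr ⟨_, (ih hw.1 _).mpr ⟨_, h⟩, _, by rw [← h.spec.2.2.2.2.2.2.1]; exact h2, h3⟩

/-- Only this direction is needed; `edgeRow` serves as an upper bound for the neighbour types that
occur. -/
theorem Nb.mem_edgeRow {p : ℕ} {w v : List Bool} (h : Nb p w v) (hp : p < 25) :
    (p, nodeOf v) ∈ edgeRow (nodeOf w) := by
  induction h with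
  | left hw hs =>
    have h := nodeOf_spec hw
    exact (edge_siblings _ h.1 (h.2.trans hs)).1
  | right hw hs =>
    have h := nodeOf_spec hw
    exact (edge_siblings _ h.1 (h.2.trans hs)).2
  | @desc p q i j w v h hi hj hc ih =>
    obtain ⟨hp38, hw, hv, -⟩ := h.spec
    have hpe := edge_of_child p hp38 i j (by omega) (by omega)
    have hs := nodeOf_spec hw
    have hs' := nodeOf_spec hv
    have := edge_children _ hs.1 _ (ih hpe) i j
    simp only [edgeCheck, hs.2, hs'.2, hi, hj, hc, Bool.or_eq_true, decide_eq_true_eq, Bool.and_self,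
      Bool.not_true, Bool.false_eq_true, false_or, beq_iff_eq, Nat.ble_eq, Nat.add_sub_cancel] at this
    rcases this with (h | h) | h
    · omega
    · omega
    · exact h

/-! ### Recognition of partners by incidences -/

/-! ### Colours -/

/-- The tiles of `T` that meet `t`. -/
def touchSet (T : TileSet) (t : Set Plane) : TileSet := {u ∈ T | u ≠ t ∧ (t ∩ u).Nonempty}

/-- The tiles of `T` that have infinitely many points in common with `t`. -/
def edgeSet (T : TileSet) (t : Set Plane) : TileSet := {u ∈ T | u ≠ t ∧ (t ∩ u).Infinite}

/-- The number of neighbours of `t`, those along an edge counted four times. -/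
def count (T : TileSet) (t : Set Plane) : ℕ := 3 * (edgeSet T t).ncard + (touchSet T t).ncard

/-- A numerical invariant of the second neighbourhood of `t`. -/
def colour (T : TileSet) (t : Set Plane) : ℕ :=
  10000 * count T t + ∑ᶠ u ∈ edgeSet T t, count T u ^ 2

/-- The neighbour with code `p` of the tile reached by a path. -/
def nbTile (M : Equiv.Perm Plane) (w : List Bool) (p : ℕ) : Set Plane :=
  (M * place w : Equiv.Perm Plane) '' ((codeSym p).act '' G)

theorem Nb.tileAt_eq {p : ℕ} {w v : List Bool} (h : Nb p w v) (M : Equiv.Perm Plane) :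
    tileAt M v = nbTile M w p := by
  obtain ⟨-, -, -, -, -, -, -, hR⟩ := h.spec
  exact (hR.mul_left M).image

/-- Different codes belong to different neighbours, so neighbours can be counted by their codes. -/
theorem nbTile_injOn (M : Equiv.Perm Plane) {w : List Bool} (hw : valid w) :
    Set.InjOn (nbTile M w) {p | p ∈ nodeCodes (nodeOf w)} := by
  intro p hp q hq e
  obtain ⟨v, hv⟩ := (mem_nodeCodes hw p).mp hp
  obtain ⟨v', hv'⟩ := (mem_nodeCodes hw q).mp hq
  rw [← hv.tileAt_eq, ← hv'.tileAt_eq] at e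
  obtain ⟨-, -, h1, h2, -⟩ := hv.spec
  obtain ⟨-, -, h3, h4, -⟩ := hv'.spec
  obtain rfl := tileAt_injective M h1 h3 (h2.symm.trans h4) e
  exact hv.code_unique hv'

theorem touchSet_level (M : Equiv.Perm Plane) {w : List Bool} (hw : valid w) :
    touchSet (level M w.length) (tileAt M w) =
      nbTile M w '' ((nodeCodes (nodeOf w)).toFinset : Set ℕ) := by
  ext u
  simp only [touchSet, Set.mem_ofPred_eq, Set.mem_image, SetLike.mem_coe, List.mem_toFinset]
  constructor
  · rintro ⟨⟨v, hv, hl, rfl⟩, hne, ht⟩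
    obtain ⟨p, hp⟩ := exists_nb_of_touch hw hv hl.symm (by rintro rfl; exact hne rfl) ht
    exact ⟨p, (mem_nodeCodes hw p).mpr ⟨v, hp⟩, (hp.tileAt_eq M).symm⟩
  · rintro ⟨p, hp, rfl⟩
    obtain ⟨v, hv⟩ := (mem_nodeCodes hw p).mp hp
    obtain ⟨-, -, h1, h2, h3, -⟩ := hv.spec
    rw [← hv.tileAt_eq M]
    exact ⟨⟨v, h1, h2.symm, rfl⟩, fun e => h3 (tileAt_injective M hw h1 h2 e.symm), hv.touch M⟩

theorem edgeSet_level (M : Equiv.Perm Plane) {w : List Bool} (hw : valid w) :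
    edgeSet (level M w.length) (tileAt M w) =
      nbTile M w '' (((nodeCodes (nodeOf w)).filter fun p => decide (p < 25)).toFinset : Set ℕ) := by
  ext u
  simp only [edgeSet, Set.mem_ofPred_eq, Set.mem_image, SetLike.mem_coe, List.mem_toFinset,
    List.mem_filter, decide_eq_true_eq]
  constructor
  · rintro ⟨⟨v, hv, hl, rfl⟩, hne, ht⟩
    obtain ⟨p, hp⟩ := exists_nb_of_touch hw hv hl.symm (by rintro rfl; exact hne rfl) ht.nonempty
    exact ⟨p, ⟨(mem_nodeCodes hw p).mpr ⟨v, hp⟩, (hp.infinite_iff M).mp ht⟩, (hp.tileAt_eq M).symm⟩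
  · rintro ⟨p, ⟨hp, hp'⟩, rfl⟩
    obtain ⟨v, hv⟩ := (mem_nodeCodes hw p).mp hp
    obtain ⟨-, -, h1, h2, h3, -⟩ := hv.spec
    rw [← hv.tileAt_eq M]
    exact ⟨⟨v, h1, h2.symm, rfl⟩, fun e => h3 (tileAt_injective M hw h1 h2 e.symm),
      (hv.infinite_iff M).mpr hp'⟩

theorem edgeCodes_injOn (M : Equiv.Perm Plane) {w : List Bool} (hw : valid w) :
    Set.InjOn (nbTile M w)
      (((nodeCodes (nodeOf w)).filter fun p => decide (p < 25)).toFinset : Set ℕ) :=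
  (nbTile_injOn M hw).mono fun p hp => by
    simp only [SetLike.mem_coe, List.mem_toFinset, List.mem_filter] at hp
    exact hp.1

theorem count_level (M : Equiv.Perm Plane) {w : List Bool} (hw : valid w) :
    count (level M w.length) (tileAt M w) = nodeCount (nodeOf w) := by
  have hn := node_nodup _ (nodeOf_spec hw).1
  rw [count, edgeSet_level M hw, touchSet_level M hw, (edgeCodes_injOn M hw).ncard_image,
    ((nbTile_injOn M hw).mono fun p hp => by simpa using hp : Set.InjOn _ _).ncard_image,
    Set.ncard_coe_finset, Set.ncard_coe_finset, List.toFinset_card_of_nodup hn,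
    List.toFinset_card_of_nodup (hn.filter _), nodeCount]

/-- The number of neighbours depends on the type, and by `edge_count` so do the numbers for the edge
neighbours. The geometric colour is therefore the tabulated one. -/
theorem colour_level (M : Equiv.Perm Plane) {w : List Bool} (hw : valid w) :
    colour (level M w.length) (tileAt M w) = nodeColour (nodeOf w) := by
  have hm := (nodeOf_spec hw).1
  have hn := node_nodup _ hm
  rw [colour, count_level M hw, node_colour _ hm, edgeSet_level M hw,
    finsum_mem_image (edgeCodes_injOn M hw), finsum_mem_coe_finset,
    List.sum_toFinset _ (hn.filter _)]
  congr 2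
  refine List.map_congr_left fun p hp => ?_
  rw [List.mem_filter, decide_eq_true_eq] at hp
  obtain ⟨v, hv⟩ := (mem_nodeCodes hw p).mp hp.1
  obtain ⟨-, -, h1, h2, -⟩ := hv.spec
  rw [← hv.tileAt_eq M, h2, count_level M h1, edge_count _ hm _ (hv.mem_edgeRow hp.2)]

/-- The partner of a small tile is recognised by the colours. -/
theorem code_eq_one_iff (M : Equiv.Perm Plane) {p : ℕ} {w v : List Bool} (h : Nb p w v)
    (hp : p < 25) (hl : 4 ≤ w.length) :
    (colour (level M w.length) (tileAt M w), colour (level M w.length) (tileAt M v)) ∈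
      partnerColours ↔ p = 1 := by
  obtain ⟨-, hw, hv, h2, -⟩ := h.spec
  rw [colour_level M hw]
  conv_lhs => rw [h2]
  rw [colour_level M hv]
  exact partner_colours _ (nodeOf_spec hw).1 (nodeOf_level hw hl) _ (h.mem_edgeRow hp)

/-! ### Recognition of partners in Ammann tilings -/

theorem touchSet_eq {T S : TileSet} {t : Set Plane}
    (h : ∀ u, (t ∩ u).Nonempty → (u ∈ T ↔ u ∈ S)) : touchSet T t = touchSet S t := by
  ext u
  exact ⟨fun ⟨h1, h2, h3⟩ => ⟨(h u h3).mp h1, h2, h3⟩, fun ⟨h1, h2, h3⟩ => ⟨(h u h3).mpr h1, h2, h3⟩⟩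

theorem edgeSet_eq {T S : TileSet} {t : Set Plane}
    (h : ∀ u, (t ∩ u).Nonempty → (u ∈ T ↔ u ∈ S)) : edgeSet T t = edgeSet S t := by
  ext u
  exact ⟨fun ⟨h1, h2, h3⟩ => ⟨(h u h3.nonempty).mp h1, h2, h3⟩,
    fun ⟨h1, h2, h3⟩ => ⟨(h u h3.nonempty).mpr h1, h2, h3⟩⟩

theorem colour_eq {T S : TileSet} {t : Set Plane} (h : ∀ u, (t ∩ u).Nonempty → (u ∈ T ↔ u ∈ S))
    (h' : ∀ x ∈ edgeSet T t, ∀ u, (x ∩ u).Nonempty → (u ∈ T ↔ u ∈ S)) : colour T t = colour S t := by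
  have hc : ∀ {x}, (∀ u, (x ∩ u).Nonempty → (u ∈ T ↔ u ∈ S)) → count T x = count S x := fun hx => by
    rw [count, count, touchSet_eq hx, edgeSet_eq hx]
  rw [colour, colour, hc h, ← edgeSet_eq h]
  congr 1
  refine finsum_mem_congr rfl fun x hx => ?_
  rw [hc (h' x hx)]

theorem LocallyAmmann.loc_colour {T : TileSet} (h : LocallyAmmann T) {X : TileSet} (hX : X ⊆ T)
    (hf : X.Finite) (N : ℕ) : ∃ n ≥ N, ∃ U, Scales 1 U ∧ ∀ x ∈ X,
      x ∈ mapTiles U (supertile n) ∧ colour T x = colour (mapTiles U (supertile n)) x ∧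
      ∀ u, (x ∩ u).Nonempty → (u ∈ T ↔ u ∈ mapTiles U (supertile n)) := by
  -- Agreement with the supertile is requested around `X` and around its neighbours, since the
  -- colour depends on the second neighbourhood.
  obtain ⟨n, hn, U, hU, hloc⟩ := h.loc {u ∈ T | ∃ x ∈ X, (x ∩ u).Nonempty} (fun u hu => hu.1)
    (finite_neighbours h.tile h.noOverlap hX hf) N
  refine ⟨n, hn, U, hU, fun x hx => ?_⟩
  have hxx : (x ∩ x).Nonempty := by
    rw [Set.inter_self]
    exact (h.tile x (hX hx)).nonempty_interior.mono interior_subset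
  have h1 := hloc x ⟨hX hx, x, hx, hxx⟩
  exact ⟨(h1 x hxx).mp (hX hx),
    colour_eq h1 fun y hy => hloc y ⟨hy.1, x, hx, hy.2.2.nonempty⟩, h1⟩

theorem isPartner_congr {T S : TileSet} {a b : Set Plane} (ha : a ∈ T ↔ a ∈ S) (hb : b ∈ T ↔ b ∈ S) :
    IsPartner T a b ↔ IsPartner S a b := by
  rw [IsPartner, IsPartner, ha, hb]

theorem isPartner_level {V : Equiv.Perm Plane} (hV : Scales s V) {n : ℕ} {w v : List Bool}
    (hw : valid w) (hv : valid v) (hwn : w.length = n) (hvn : v.length = n) :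
    IsPartner (level (scS⁻¹ ^ n * V) n) (tileAt (scS⁻¹ ^ n * V) w) (tileAt (scS⁻¹ ^ n * V) v) ↔
      Nb 1 w v := by
  set M := scS⁻¹ ^ n * V
  rw [isPartner_iff]
  constructor
  · rintro ⟨X, hX, e1, e2, ha, hb⟩
    have h2 : Scales (s ^ 2) (X * f₂) := by simpa using hX.mul scales_f₂
    have h1 : Scales s (X * f₁) := by simpa using hX.mul scales_f₁
    have p1 := (scales_place hV hw hwn).eq_of_image h2 e1
    have p2 := (scales_place hV hv hvn).eq_of_image h1 e2
    have hne : w ≠ v := by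
      rintro rfl
      rw [p1] at p2
      rw [p2] at h2
      exact s_sq_lt.ne (h2.ratio_eq h1)
    have hsw : small w = true := by
      by_contra hs
      have h3 := scales_place hV hw hwn
      rw [if_neg hs, p1] at h3
      exact s_sq_lt.ne (h2.ratio_eq h3)
    cases w with
    | nil => cases hsw
    | cons i w =>
      have hs : small w = false := by
        by_contra hs
        rw [Bool.not_eq_false] at hs
        simp [small, childSmall, hs] at hsw
      have hi : i = true := by
        cases i
        · simp [small, childSmall] at hsw
        · rfl
      subst hi
      have hnb := Nb.right hw.1 hs
      have e : tileAt M (false :: w) = tileAt M v := by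
        have e3 : scS⁻¹ ^ n * V * place w = X := by
          have : scS⁻¹ ^ n * V * place w * f₂ = X * f₂ := by
            rw [← p1]; simp only [place, hs, step, mul_assoc]
          exact mul_right_cancel this
        rw [e2, ← e3, tileAt]
        simp only [place, hs, step, mul_assoc]
        rfl
      obtain ⟨-, -, h3, h4, -⟩ := hnb.spec
      rwa [← tileAt_injective M h3 hv (by rw [← h4, hwn, hvn]) e]
  · intro h
    cases h with
    | @right w _ hs =>
      have hl : w.length + 1 = n := by simpa using hwn
      have h0 : Scales 1 (M * place w) := by
        have := scales_place hV hw.1 (n := w.length) rfl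
        rw [hs] at this
        have h2 := scales_sub_large this
        rw [← mul_assoc, ← mul_assoc, ← pow_succ', hl] at h2
        exact h2
      refine ⟨M * place w, h0, ?_, ?_, ⟨_, hw, hwn, rfl⟩, ⟨_, hv, hvn, rfl⟩⟩
      · simp only [tileAt, place, hs, step, mul_assoc]
      · simp only [tileAt, place, hs, step, mul_assoc]
    | @desc p _ i j w v h hi hj hc =>
      have h1 := h.spec.1
      -- The entry 2 of the table stands for code 1. It does not occur, so code 1 arises between
      -- siblings only.
      have : ∀ p < 38, ∀ i j, child p i j ≠ 2 := by decide +kernel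
      exact absurd hc (this p h1 i j)

theorem exists_copy_eq_level {U : Equiv.Perm Plane} (hU : Scales 1 U) (n : ℕ) :
    ∃ V, Scales s V ∧ mapTiles U (supertile n) = level (scS⁻¹ ^ n * V) n := by
  have key : ∀ n : ℕ, Scales 1 ((scS⁻¹ ^ n)⁻¹ * U * scS⁻¹ ^ n) := by
    intro n
    induction n with
    | zero => simpa using hU
    | succ n ih =>
      have := scales_conj' ih
      rw [pow_succ]
      simpa [mul_assoc] using this
  refine ⟨(scS⁻¹ ^ n)⁻¹ * U * scS⁻¹ ^ n * scS, by simpa using (key n).mul scales_scS, ?_⟩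
  rw [copy_eq_level]
  congr 1
  group

/-- The right-hand side consists of memberships, infinite intersections and numbers of neighbours.
It mentions neither shapes nor sizes, so it is invariant under bijections of the plane. -/
theorem LocallyAmmann.isPartner_iff_colour {T : TileSet} (h : LocallyAmmann T) {a b : Set Plane} :
    IsPartner T a b ↔ a ∈ T ∧ b ∈ T ∧ a ≠ b ∧ (a ∩ b).Infinite ∧
      (colour T a, colour T b) ∈ partnerColours := by
  by_cases hab : a ∈ T ∧ b ∈ T
  swap
  · exact ⟨fun h => absurd ⟨h.1, h.2.1⟩ hab, fun h => absurd ⟨h.1, h.2.1⟩ hab⟩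
  obtain ⟨ha, hb⟩ := hab
  -- A supertile of level at least four is required, so that the colour test is valid for its tiles.
  obtain ⟨n, hn, U, hU, hX⟩ := h.loc_colour (X := {a, b})
    (Set.insert_subset ha (Set.singleton_subset_iff.mpr hb)) (Set.toFinite _) 4
  obtain ⟨ha', hca, -⟩ := hX a (by simp)
  obtain ⟨hb', hcb, -⟩ := hX b (by simp)
  rw [isPartner_congr (iff_of_true ha ha') (iff_of_true hb hb'), hca, hcb]
  simp only [ha, hb, true_and]
  obtain ⟨V, hV, eV⟩ := exists_copy_eq_level hU n
  rw [eV] at ha' hb' ⊢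
  set M := scS⁻¹ ^ n * V
  obtain ⟨w, hw, hwn, rfl⟩ := ha'
  obtain ⟨v, hv, hvn, rfl⟩ := hb'
  rw [isPartner_level hV hw hv hwn hvn]
  subst hwn
  constructor
  · intro hnb
    refine ⟨fun e => hnb.spec.2.2.2.2.1 (tileAt_injective M hw hv hvn.symm e), ?_, ?_⟩
    · exact (hnb.infinite_iff M).mpr (by norm_num)
    · exact (code_eq_one_iff M hnb (by norm_num) hn).mpr rfl
  · rintro ⟨hne, hinf, hcol⟩
    obtain ⟨p, hp⟩ := exists_nb_of_touch hw hv hvn.symm (by rintro rfl; exact hne rfl) hinf.nonempty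
    rw [code_eq_one_iff M hp ((hp.infinite_iff M).mp hinf) hn] at hcol
    exact hcol ▸ hp

/-! ### Invariance under homeomorphisms -/

theorem edgeSet_map (φ : Equiv.Perm Plane) (T : TileSet) (t : Set Plane) :
    edgeSet (mapTiles φ T) (φ '' t) = (fun u => φ '' u) '' edgeSet T t := by
  have hinj : Function.Injective fun u : Set Plane => φ '' u := Set.image_injective.mpr φ.injective
  ext u
  constructor
  · rintro ⟨⟨v, hv, rfl⟩, h2, h3⟩
    refine ⟨v, ⟨hv, fun e => h2 (e ▸ rfl), ?_⟩, rfl⟩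
    change (φ '' t ∩ φ '' v).Infinite at h3
    rw [← Set.image_inter φ.injective] at h3
    exact h3.of_image _
  · rintro ⟨v, ⟨hv, h2, h3⟩, rfl⟩
    refine ⟨⟨v, hv, rfl⟩, fun e => h2 (hinj e), ?_⟩
    change (φ '' t ∩ φ '' v).Infinite
    rw [← Set.image_inter φ.injective]
    exact h3.image φ.injective.injOn

theorem touchSet_map (φ : Equiv.Perm Plane) (T : TileSet) (t : Set Plane) :
    touchSet (mapTiles φ T) (φ '' t) = (fun u => φ '' u) '' touchSet T t := by
  have hinj : Function.Injective fun u : Set Plane => φ '' u := Set.image_injective.mpr φ.injective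
  ext u
  constructor
  · rintro ⟨⟨v, hv, rfl⟩, h2, h3⟩
    refine ⟨v, ⟨hv, fun e => h2 (e ▸ rfl), ?_⟩, rfl⟩
    change (φ '' t ∩ φ '' v).Nonempty at h3
    rw [← Set.image_inter φ.injective] at h3
    exact Set.image_nonempty.mp h3
  · rintro ⟨v, ⟨hv, h2, h3⟩, rfl⟩
    refine ⟨⟨v, hv, rfl⟩, fun e => h2 (hinj e), ?_⟩
    change (φ '' t ∩ φ '' v).Nonempty
    rw [← Set.image_inter φ.injective]
    exact h3.image φ

theorem colour_map (φ : Equiv.Perm Plane) (T : TileSet) (t : Set Plane) :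
    colour (mapTiles φ T) (φ '' t) = colour T t := by
  have hinj : Function.Injective fun u : Set Plane => φ '' u := Set.image_injective.mpr φ.injective
  have hc : ∀ t, count (mapTiles φ T) (φ '' t) = count T t := fun t => by
    rw [count, count, edgeSet_map, touchSet_map, Set.ncard_image_of_injective _ hinj,
      Set.ncard_image_of_injective _ hinj]
  rw [colour, colour, hc, edgeSet_map, finsum_mem_image hinj.injOn]
  simp only [hc]

theorem LocallyAmmann.isPartner_map {T S : TileSet} (hT : LocallyAmmann T) (hS : LocallyAmmann S)
    {φ : Equiv.Perm Plane} (h : mapTiles φ T = S) {a b : Set Plane} :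
    IsPartner S (φ '' a) (φ '' b) ↔ IsPartner T a b := by
  rw [hS.isPartner_iff_colour, hT.isPartner_iff_colour, ← h, mem_mapTiles_iff, mem_mapTiles_iff,
    colour_map, colour_map, ← Set.image_inter φ.injective,
    Set.infinite_image_iff φ.injective.injOn, Ne, (Set.image_injective.mpr φ.injective).eq_iff]

theorem LocallyAmmann.isSmall_iff_partner {T : TileSet} (h : LocallyAmmann T) {a : Set Plane}
    (ha : a ∈ T) : IsSmall a ↔ ∃ b, IsPartner T a b := by
  constructor
  · intro hs
    obtain ⟨A, hA, rfl⟩ := isSmall_iff.mp hs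
    obtain ⟨V, hV, rfl⟩ := h.partnered A hA ha
    exact ⟨_, hV.isPartner⟩
  · rintro ⟨b, hb⟩
    exact hb.2.2.1

/-- A tile is small exactly when it is the small member of a partner pair, and pairs are preserved.
-/
theorem LocallyAmmann.isSmall_map {T S : TileSet} (hT : LocallyAmmann T) (hS : LocallyAmmann S)
    {φ : Equiv.Perm Plane} (h : mapTiles φ T = S) {a : Set Plane} (ha : a ∈ T) :
    IsSmall (φ '' a) ↔ IsSmall a := by
  rw [hS.isSmall_iff_partner (h ▸ ⟨a, ha, rfl⟩), hT.isSmall_iff_partner ha]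
  constructor
  · rintro ⟨b, hb⟩
    obtain ⟨c, hc, rfl⟩ : ∃ c ∈ T, φ '' c = b := by
      have := hb.2.1
      rwa [← h] at this
    exact ⟨c, (hT.isPartner_map hS h).mp hb⟩
  · rintro ⟨b, hb⟩
    exact ⟨_, (hT.isPartner_map hS h).mpr hb⟩

/-! ### Ancestors and classes -/

/-! ### Iterated substitution -/

theorem mem_substitute_iterate (j : ℕ) {S : TileSet} {t : Set Plane} :
    t ∈ substitute^[j] S ↔ ∃ P ∈ S, t ∈ substitute^[j] {P} := by
  induction j generalizing S with
  | zero => simp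
  | succ j ih =>
    rw [Function.iterate_succ_apply, ih]
    constructor
    · rintro ⟨Q, hQ, ht⟩
      obtain ⟨P, hP, hQP⟩ := mem_substitute_iff_exists.mp hQ
      refine ⟨P, hP, ?_⟩
      rw [Function.iterate_succ_apply, ih]
      exact ⟨Q, hQP, ht⟩
    · rintro ⟨P, hP, ht⟩
      rw [Function.iterate_succ_apply, ih] at ht
      obtain ⟨Q, hQ, ht⟩ := ht
      exact ⟨Q, mem_substitute_iff_exists.mpr ⟨P, hP, hQ⟩, ht⟩

theorem substitute_iterate_mono (j : ℕ) {S T : TileSet} (h : S ⊆ T) :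
    substitute^[j] S ⊆ substitute^[j] T := fun t ht => by
  rw [mem_substitute_iterate] at ht ⊢
  obtain ⟨P, hP, ht⟩ := ht
  exact ⟨P, h hP, ht⟩

theorem scales_conj_pow {U : Equiv.Perm Plane} (hU : Scales 1 U) (j : ℕ) :
    Scales 1 (scS⁻¹ ^ j * U * scS ^ j) := by
  induction j with
  | zero => simpa using hU
  | succ j ih =>
    have := scales_conj ih
    rw [pow_succ', pow_succ]
    simpa [mul_assoc] using this

theorem substitute_iterate_mapTiles {U : Equiv.Perm Plane} (hU : Scales 1 U) (S : TileSet) (j : ℕ) :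
    substitute^[j] (mapTiles U S) =
      mapTiles (scS⁻¹ ^ j * U * scS ^ j : Equiv.Perm Plane) (substitute^[j] S) := by
  induction j with
  | zero => simp
  | succ j ih =>
    rw [Function.iterate_succ_apply', ih, substitute_mapTiles (scales_conj_pow hU j),
      Function.iterate_succ_apply', pow_succ', pow_succ]
    simp only [mul_assoc]

theorem isTile_of_mem_iterate {j : ℕ} {S : TileSet} (hS : ∀ t ∈ S, IsTile t) :
    ∀ t ∈ substitute^[j] S, IsTile t := by
  induction j with
  | zero => exact hS
  | succ j ih =>
    rw [Function.iterate_succ_apply']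
    exact fun t ht => isTile_of_mem_substitute ht

theorem sUnion_substitute_iterate (j : ℕ) {P : Set Plane} (hP : IsTile P) :
    ⋃₀ substitute^[j] {P} = (scS⁻¹ ^ j : Equiv.Perm Plane) '' P := by
  induction j with
  | zero => simp
  | succ j ih =>
    rw [Function.iterate_succ_apply', sUnion_substitute (isTile_of_mem_iterate (by
      rintro t rfl; exact hP)), ih, pow_succ', image_mul_G]

/-! ### Ancestors -/

/-- All iterated desubstitutions of `T` look locally like supertiles. -/
def Hereditary (T : TileSet) : Prop := ∀ j, LocallyAmmann (desub^[j] T)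

theorem Hereditary.desub {T : TileSet} (h : Hereditary T) : Hereditary (desub T) :=
  fun j => h (j + 1)

theorem Hereditary.locallyAmmann {T : TileSet} (h : Hereditary T) : LocallyAmmann T := h 0

theorem IsPlaneAmmann.desub_iterate {T : TileSet} (h : IsPlaneAmmann T) (j : ℕ) :
    IsPlaneAmmann (Ammann.desub^[j] T) := by
  induction j with
  | zero => exact h
  | succ j ih => rw [Function.iterate_succ_apply']; exact ih.desub

theorem IsPlaneAmmann.hereditary {T : TileSet} (h : IsPlaneAmmann T) : Hereditary T :=
  fun j => (h.desub_iterate j).locallyAmmann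

theorem IsAmmann.desub_iterate {T : TileSet} (h : IsAmmann T) (j : ℕ) :
    IsAmmann (Ammann.desub^[j] T) := by
  induction j with
  | zero => exact h
  | succ j ih => rw [Function.iterate_succ_apply']; exact ih.desub

theorem IsAmmann.hereditary {T : TileSet} (h : IsAmmann T) : Hereditary T :=
  fun j => (h.desub_iterate j).locallyAmmann

theorem Hereditary.substitute_iterate {T : TileSet} (h : Hereditary T) (j : ℕ) :
    substitute^[j] (Ammann.desub^[j] T) = T := by
  induction j generalizing T with
  | zero => rfl
  | succ j ih =>
    rw [Function.iterate_succ_apply', Function.iterate_succ_apply, ih h.desub]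
    exact h.locallyAmmann.substitute_desub

theorem Hereditary.iterate_subset {T : TileSet} (h : Hereditary T) {j : ℕ} {P : Set Plane}
    (hP : P ∈ Ammann.desub^[j] T) : substitute^[j] {P} ⊆ T := by
  conv_rhs => rw [← h.substitute_iterate j]
  exact substitute_iterate_mono j (Set.singleton_subset_iff.mpr hP)

theorem LocallyAmmann.exists_parent {T : TileSet} (h : LocallyAmmann T) {t : Set Plane}
    (ht : t ∈ T) : ∃ Q ∈ Ammann.desub T, t ∈ substitute {Q} := by
  rw [← h.substitute_desub] at ht
  exact mem_substitute_iff_exists.mp ht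

open Classical in
/-- The tile of the desubstitution of which `t` is a child. -/
def parent (T : TileSet) (t : Set Plane) : Set Plane :=
  if h : ∃ Q ∈ desub T, t ∈ substitute {Q} then h.choose else ∅

theorem LocallyAmmann.parent_spec {T : TileSet} (h : LocallyAmmann T) {t : Set Plane}
    (ht : t ∈ T) : parent T t ∈ Ammann.desub T ∧ t ∈ substitute {parent T t} := by
  have hex := h.exists_parent ht
  rw [parent, dif_pos hex]
  exact hex.choose_spec

theorem parent_eq {T : TileSet} {t Q : Set Plane} (hQ : Q ∈ desub T) (ht : t ∈ substitute {Q}) :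
    parent T t = Q := by
  have hex : ∃ Q ∈ desub T, t ∈ substitute {Q} := ⟨Q, hQ, ht⟩
  rw [parent, dif_pos hex]
  exact eq_of_common_child hex.choose_spec.1 hQ hex.choose_spec.2 ht

/-- The `j`-th ancestor of `t`. -/
def anc : ℕ → TileSet → Set Plane → Set Plane
  | 0, _, t => t
  | j + 1, T, t => anc j (desub T) (parent T t)

theorem Hereditary.anc_mem {T : TileSet} (h : Hereditary T) {t : Set Plane} (ht : t ∈ T) (j : ℕ) :
    anc j T t ∈ Ammann.desub^[j] T := by
  induction j generalizing T t with
  | zero => exact ht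
  | succ j ih => exact ih h.desub (h.locallyAmmann.parent_spec ht).1

theorem Hereditary.mem_anc {T : TileSet} (h : Hereditary T) {t : Set Plane} (ht : t ∈ T) (j : ℕ) :
    t ∈ substitute^[j] {anc j T t} := by
  induction j generalizing T t with
  | zero => rfl
  | succ j ih =>
    have hp := h.locallyAmmann.parent_spec ht
    rw [Function.iterate_succ_apply', mem_substitute_iff_exists]
    exact ⟨_, ih h.desub hp.1, hp.2⟩

/-- Uniqueness of ancestors: by `eq_of_common_child`, each step up the hierarchy is forced. -/
theorem Hereditary.anc_eq {T : TileSet} (h : Hereditary T) {j : ℕ} {t P : Set Plane}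
    (hP : P ∈ Ammann.desub^[j] T) (ht : t ∈ substitute^[j] {P}) : anc j T t = P := by
  induction j generalizing T t with
  | zero => exact ht
  | succ j ih =>
    rw [Function.iterate_succ_apply', mem_substitute_iff_exists] at ht
    obtain ⟨Q, hQ, ht⟩ := ht
    have hQT : Q ∈ Ammann.desub T := h.desub.iterate_subset hP hQ
    rw [anc, parent_eq hQT ht]
    exact ih h.desub hP hQ

theorem anc_succ (j : ℕ) (T : TileSet) (t : Set Plane) :
    anc (j + 1) T t = parent (desub^[j] T) (anc j T t) := by
  induction j generalizing T t with
  | zero => rfl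
  | succ j ih => exact ih (desub T) (parent T t)

theorem Hereditary.anc_mem_succ {T : TileSet} (h : Hereditary T) {t : Set Plane} (ht : t ∈ T)
    (j : ℕ) : anc j T t ∈ substitute {anc (j + 1) T t} := by
  rw [anc_succ]
  exact ((h j).parent_spec (h.anc_mem ht j)).2

theorem anc_eq_of_le {T : TileSet} {t u : Set Plane} {i j : ℕ} (hij : i ≤ j)
    (h : anc i T t = anc i T u) : anc j T t = anc j T u := by
  induction j, hij using Nat.le_induction with
  | base => exact h
  | succ j _ ih => rw [anc_succ, anc_succ, ih]

/-! ### Classes of tiles with common ancestors -/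

/-- The tiles of `T` that have a common ancestor with `t`. -/
def cls (T : TileSet) (t : Set Plane) : TileSet := {u ∈ T | ∃ j, anc j T u = anc j T t}

theorem mem_cls_self {T : TileSet} {t : Set Plane} (ht : t ∈ T) : t ∈ cls T t := ⟨ht, 0, rfl⟩

theorem cls_eq {T : TileSet} {t u : Set Plane} (h : u ∈ cls T t) : cls T u = cls T t := by
  obtain ⟨-, i, hi⟩ := h
  ext v
  constructor
  · rintro ⟨hv, j, hj⟩
    exact ⟨hv, max i j, (anc_eq_of_le (le_max_right i j) hj).trans (anc_eq_of_le (le_max_left i j) hi)⟩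
  · rintro ⟨hv, j, hj⟩
    exact ⟨hv, max i j,
      (anc_eq_of_le (le_max_right i j) hj).trans (anc_eq_of_le (le_max_left i j) hi).symm⟩

theorem Hereditary.mem_cls_iff {T : TileSet} (h : Hereditary T) {t u : Set Plane} (ht : t ∈ T) :
    u ∈ cls T t ↔ ∃ j, u ∈ substitute^[j] {anc j T t} := by
  constructor
  · rintro ⟨hu, j, hj⟩
    exact ⟨j, hj ▸ h.mem_anc hu j⟩
  · rintro ⟨j, hu⟩
    exact ⟨h.iterate_subset (h.anc_mem ht j) hu, j, h.anc_eq (h.anc_mem ht j) hu⟩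

theorem Hereditary.cls_eq_iUnion {T : TileSet} (h : Hereditary T) {t : Set Plane} (ht : t ∈ T) :
    cls T t = ⋃ j, substitute^[j] {anc j T t} := by
  ext u
  rw [h.mem_cls_iff ht, Set.mem_iUnion]

theorem Hereditary.monotone_patches {T : TileSet} (h : Hereditary T) {t : Set Plane} (ht : t ∈ T) :
    Monotone fun j => substitute^[j] {anc j T t} := by
  refine monotone_nat_of_le_succ fun j => ?_
  rw [Function.iterate_succ_apply]
  exact substitute_iterate_mono j (Set.singleton_subset_iff.mpr (h.anc_mem_succ ht j))

theorem congruent_supertile {V : Equiv.Perm Plane} (hV : Scales s V) (j : ℕ) :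
    CongruentTilings (supertile j) (substitute^[j] {V '' G}) := by
  have hU : Scales 1 (V * scS⁻¹) := by
    have := hV.mul scales_scS.inv
    rwa [mul_inv_cancel₀ s_ne] at this
  have e : ({V '' G} : TileSet) = mapTiles (V * scS⁻¹ : Equiv.Perm Plane) {s • G} := by
    rw [mapTiles, Set.image_singleton, ← image_scS, ← image_mul_G, inv_mul_cancel_right]
  rw [e, substitute_iterate_mapTiles hU]
  exact (scales_conj_pow hU j).congruentTilings _

theorem isLarge_of_small_child {a Q : Set Plane} (ha : IsSmall a) (h : a ∈ substitute {Q}) :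
    IsLarge Q := by
  obtain ⟨A, hA, rfl⟩ := isSmall_iff.mp ha
  obtain ⟨W, hW, hQ, -⟩ := small_of_substitute hA h
  exact isLarge_iff.mpr ⟨W, hW, hQ⟩

/-- A class is the increasing union of the subdivided ancestors of one of its tiles. Those of large
ancestors are copies of supertiles. -/
theorem Hereditary.isNestedUnion_cls {T : TileSet} (h : Hereditary T) {t : Set Plane} (ht : t ∈ T) :
    IsNestedUnion (cls T t) := by
  -- A small ancestor has a large parent, so one of any two consecutive ancestors is large.
  have hex : ∀ n, ∃ m, (2 * n ≤ m ∧ m ≤ 2 * n + 1) ∧ IsLarge (anc m T t) := by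
    intro n
    rcases (h (2 * n)).tile _ (h.anc_mem ht _) with hl | hs
    · exact ⟨2 * n, ⟨le_rfl, by omega⟩, hl⟩
    · exact ⟨2 * n + 1, ⟨by omega, le_rfl⟩, isLarge_of_small_child hs (h.anc_mem_succ ht _)⟩
  choose m hm hl using hex
  have hmono : StrictMono m := strictMono_nat_of_lt_succ fun n => by
    have h1 := hm n
    have h2 := hm (n + 1)
    omega
  refine ⟨m, fun n => substitute^[m n] {anc (m n) T t}, hmono,
    (h.monotone_patches ht).comp hmono.monotone, fun n => ?_, ?_⟩
  · obtain ⟨V, hV, e⟩ := isLarge_iff.mp (hl n)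
    change CongruentTilings _ (substitute^[m n] {anc (m n) T t})
    rw [← e]
    exact congruent_supertile hV _
  · rw [h.cls_eq_iUnion ht]
    apply Set.Subset.antisymm
    · exact Set.iUnion_subset fun j => (h.monotone_patches ht (hmono.id_le j)).trans
        (Set.subset_iUnion (fun n => substitute^[m n] {anc (m n) T t}) j)
    · exact Set.iUnion_subset fun n =>
        Set.subset_iUnion (fun j => substitute^[j] {anc j T t}) (m n)

theorem Hereditary.sUnion_cls {T : TileSet} (h : Hereditary T) {t : Set Plane} (ht : t ∈ T) :
    ⋃₀ cls T t = ⋃ j, (scS⁻¹ ^ j : Equiv.Perm Plane) '' anc j T t := by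
  rw [h.cls_eq_iUnion ht, Set.sUnion_iUnion]
  exact Set.iUnion_congr fun j => sUnion_substitute_iterate j ((h j).tile _ (h.anc_mem ht j))

/-! ### Borders between classes are mirror lines -/

/-! ### Descending codes -/

/-- The scaling factor of a tile. -/
def ratio (b : Bool) : ℝ := if b then s ^ 2 else s

/-- The tiles `V(G)` and `W(G)` have the relative position with code `p`. -/
def CodedAt (p : ℕ) (V W : Equiv.Perm Plane) : Prop :=
  p < 38 ∧ Scales (ratio (codeSmall p)) V ∧ Scales (ratio (codeSmall' p)) W ∧ Rel V W (codeSym p)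

theorem LocallyAmmann.exists_code {T : TileSet} (h : LocallyAmmann T) {x y : Set Plane} (hx : x ∈ T)
    (hy : y ∈ T) (hne : x ≠ y) (hinf : (x ∩ y).Infinite) :
    ∃ p < 25, ∃ V W, CodedAt p V W ∧ x = V '' G ∧ y = W '' G := by
  obtain ⟨n, -, U, hU, hX⟩ := h.loc_colour (X := {x, y})
    (Set.insert_subset hx (Set.singleton_subset_iff.mpr hy)) (Set.toFinite _) 0
  obtain ⟨hx', -⟩ := hX x (by simp)
  obtain ⟨hy', -⟩ := hX y (by simp)
  obtain ⟨V, hV, eV⟩ := exists_copy_eq_level hU n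
  rw [eV] at hx' hy'
  obtain ⟨w, hw, hwn, rfl⟩ := hx'
  obtain ⟨v, hv, hvn, rfl⟩ := hy'
  obtain ⟨p, hp⟩ := exists_nb_of_touch hw hv (hwn.trans hvn.symm) (by rintro rfl; exact hne rfl)
    hinf.nonempty
  obtain ⟨h1, -, -, -, -, e1, e2, hR⟩ := hp.spec
  refine ⟨p, (hp.infinite_iff _).mp hinf, _, _, ⟨h1, ?_, ?_, hR.mul_left _⟩, rfl, rfl⟩
  · rw [← e1]; exact scales_place hV hw hwn
  · rw [← e2]; exact scales_place hV hv hvn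

theorem exists_step {b : Bool} {V : Equiv.Perm Plane} (hV : Scales (ratio b) V) {x : Set Plane}
    (hx : x ∈ substitute {V '' G}) : ∃ i, hasChild b i = true ∧
      x = (scS⁻¹ * V * step b i : Equiv.Perm Plane) '' G ∧
      Scales (ratio (childSmall b i)) (scS⁻¹ * V * step b i) := by
  rcases mem_substitute.mp hx with ⟨W, hW, hWS, rfl⟩ | ⟨W, d, hW, hWS, rfl⟩
  · have e := hW.eq_of_image hV hWS
    subst e
    have hb : b = true := by
      by_contra hb
      rw [ratio, if_neg hb] at hV
      exact s_sq_lt.ne (hW.ratio_eq hV)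
    subst hb
    exact ⟨false, rfl, by rw [step, mul_one], by
      rw [step, mul_one]; exact scales_sub_small hW⟩
  · have e := hW.eq_of_image hV hWS
    subst e
    have hb : b = false := by
      by_contra hb
      rw [Bool.not_eq_false] at hb
      subst hb
      exact s_sq_lt.ne' (hW.ratio_eq hV)
    subst hb
    have := scales_sub_digit hW d
    cases d
    · exact ⟨false, rfl, rfl, by simpa [Digit.val, ratio, childSmall, step, f] using this⟩
    · exact ⟨true, rfl, rfl, by simpa [Digit.val, ratio, childSmall, step, f] using this⟩

theorem CodedAt.child {p : ℕ} {V W : Equiv.Perm Plane} (h : CodedAt p V W) {x y : Set Plane}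
    (hx : x ∈ substitute {V '' G}) (hy : y ∈ substitute {W '' G}) (hinf : (x ∩ y).Infinite) :
    ∃ i j q, Ammann.child p i j = q + 1 ∧ q < 25 ∧
      CodedAt q (scS⁻¹ * V * step (codeSmall p) i) (scS⁻¹ * W * step (codeSmall' p) j) ∧
      x = (scS⁻¹ * V * step (codeSmall p) i : Equiv.Perm Plane) '' G ∧
      y = (scS⁻¹ * W * step (codeSmall' p) j : Equiv.Perm Plane) '' G := by
  obtain ⟨hp, hV, hW, hR⟩ := h
  obtain ⟨i, hi, ex, hsx⟩ := exists_step hV hx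
  obtain ⟨j, hj, ey, hsy⟩ := exists_step hW hy
  have hck := childCheck_all p hp i j hi hj
  have hR' := (hR.mul_left scS⁻¹).step (codeSmall p) i (codeSmall' p) j
  cases hc : Ammann.child p i j with
  | zero =>
    simp only [childCheck, hc] at hck
    rw [ex, ey, hR'.inter, Sym.miss_spec hck, Set.image_empty] at hinf
    exact absurd Set.finite_empty hinf
  | succ q =>
    simp only [childCheck, hc, Bool.and_eq_true, decide_eq_true_eq] at hck
    obtain ⟨⟨⟨h1, h2⟩, h3⟩, h4⟩ := hck
    rw [← h4] at hR'
    refine ⟨i, j, q, hc, ?_, ⟨h1, h2 ▸ hsx, h3 ▸ hsy, hR'⟩, ex, ey⟩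
    by_contra hq
    rw [ex, ey, hR'.inter] at hinf
    exact hinf ((Sym.corner_spec (codeSym_corner q h1 (not_lt.mp hq))).1.image _)

/-- The codes of edge neighbours all of whose first `n` ancestors are different. -/
def lateCodes : ℕ → List ℕ
  | 0 => List.range 25
  | n + 1 => (lateCodes n).flatMap fun p => [false, true].flatMap fun i => [false, true].filterMap
      fun j => if child p i j = 0 ∨ 26 ≤ child p i j then none else some (child p i j - 1)

theorem mem_lateCodes_succ {n p q : ℕ} {i j : Bool} (hp : p ∈ lateCodes n)
    (h : child p i j = q + 1) (hq : q < 25) : q ∈ lateCodes (n + 1) := by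
  rw [lateCodes, List.mem_flatMap]
  refine ⟨p, hp, List.mem_flatMap.mpr ⟨i, by cases i <;> simp, List.mem_filterMap.mpr ⟨j, by cases j <;> simp, ?_⟩⟩⟩
  rw [h, if_neg (by omega), Nat.add_sub_cancel]

theorem infinite_parent {x y P Q : Set Plane} (hx : x ∈ substitute {P}) (hy : y ∈ substitute {Q})
    (h : (x ∩ y).Infinite) : (P ∩ Q).Infinite := by
  have h2 := h.mono (Set.inter_subset_inter (subset_of_mem_substitute_singleton hx)
    (subset_of_mem_substitute_singleton hy))
  rw [← Set.image_inter (Equiv.injective _)] at h2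
  exact h2.of_image _

/-- The `n`-th ancestors are different and still have infinitely many common points, so they have an
edge code. Descending from them along edge contacts gives the code of `x` and `y`. -/
theorem Hereditary.exists_lateCode {n : ℕ} {T : TileSet} (h : Hereditary T) {x y : Set Plane}
    (hx : x ∈ T) (hy : y ∈ T) (hne : anc n T x ≠ anc n T y) (hinf : (x ∩ y).Infinite) :
    ∃ p ∈ lateCodes n, ∃ V W, CodedAt p V W ∧ x = V '' G ∧ y = W '' G := by
  induction n generalizing T x y with
  | zero =>
    obtain ⟨p, hp, V, W, hc⟩ := h.locallyAmmann.exists_code hx hy hne hinf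
    exact ⟨p, List.mem_range.mpr hp, V, W, hc⟩
  | succ n ih =>
    have hpx := h.locallyAmmann.parent_spec hx
    have hpy := h.locallyAmmann.parent_spec hy
    obtain ⟨p, hp, V, W, hc, e1, e2⟩ := ih h.desub hpx.1 hpy.1 hne (infinite_parent hpx.2 hpy.2 hinf)
    obtain ⟨i, j, q, hq, hq25, hc', e3, e4⟩ := hc.child (e1 ▸ hpx.2) (e2 ▸ hpy.2) hinf
    exact ⟨q, mem_lateCodes_succ hp hq hq25, _, _, hc', e3, e4⟩

/-! ### Axis-parallel reflections and similarities -/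

/-- The map underlying the reflection in the line on which the `i`-th coordinate is `c`. -/
def reflFun (i : Fin 2) (c : ℝ) (p : Plane) : Plane :=
  pt (if i = 0 then 2 * c - p 0 else p 0) (if i = 0 then p 1 else 2 * c - p 1)

/-- The reflection in the line on which the `i`-th coordinate is `c`. -/
def refl (i : Fin 2) (c : ℝ) : Equiv.Perm Plane :=
  have h : ∀ p, reflFun i c (reflFun i c p) = p := fun p => by
    apply plane_ext <;> fin_cases i <;> simp [reflFun]
  ⟨reflFun i c, reflFun i c, h, h⟩

theorem refl_apply (i : Fin 2) (c : ℝ) (p : Plane) : refl i c p =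
    pt (if i = 0 then 2 * c - p 0 else p 0) (if i = 0 then p 1 else 2 * c - p 1) := rfl

theorem refl_coord (i : Fin 2) (c : ℝ) (p : Plane) : refl i c p i = 2 * c - p i := by
  rw [refl_apply]; fin_cases i <;> simp

theorem refl_refl (i : Fin 2) (c : ℝ) (p : Plane) : refl i c (refl i c p) = p :=
  (refl i c).left_inv p

theorem scales_refl (i : Fin 2) (c : ℝ) : Scales 1 (refl i c) := Scales.of_sq one_pos fun x y => by
  rw [dist_sq, dist_sq, refl_apply, refl_apply]; fin_cases i <;> simp <;> ring

theorem refl_of_coord {i : Fin 2} {c : ℝ} {p : Plane} (h : p i = c) : refl i c p = p := by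
  apply plane_ext <;> fin_cases i <;> simp at h <;> simp [refl_apply, h] <;> ring

/-- `V` maps horizontal and vertical lines to horizontal or vertical lines. -/
def Axis (V : Equiv.Perm Plane) : Prop :=
  (∃ a b c d : ℝ, ∀ p, V p = pt (a * p 0 + c) (b * p 1 + d)) ∨
  (∃ a b c d : ℝ, ∀ p, V p = pt (a * p 1 + c) (b * p 0 + d))

theorem Axis.mul {V W : Equiv.Perm Plane} (hV : Axis V) (hW : Axis W) : Axis (V * W) := by
  rcases hV with ⟨a, b, c, d, hV⟩ | ⟨a, b, c, d, hV⟩ <;>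
  rcases hW with ⟨a', b', c', d', hW⟩ | ⟨a', b', c', d', hW⟩
  · exact Or.inl ⟨a * a', b * b', a * c' + c, b * d' + d, fun p => by
      rw [Equiv.Perm.mul_apply, hV, hW]; apply plane_ext <;> simp <;> ring⟩
  · exact Or.inr ⟨a * a', b * b', a * c' + c, b * d' + d, fun p => by
      rw [Equiv.Perm.mul_apply, hV, hW]; apply plane_ext <;> simp <;> ring⟩
  · exact Or.inr ⟨a * b', b * a', a * d' + c, b * c' + d, fun p => by
      rw [Equiv.Perm.mul_apply, hV, hW]; apply plane_ext <;> simp <;> ring⟩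
  · exact Or.inl ⟨a * b', b * a', a * d' + c, b * c' + d, fun p => by
      rw [Equiv.Perm.mul_apply, hV, hW]; apply plane_ext <;> simp <;> ring⟩

theorem Axis.inv {V : Equiv.Perm Plane} (hV : Axis V) : Axis V⁻¹ := by
  have hne : ∀ x y x' y' : ℝ, V (pt x y) = V (pt x' y') → x = x' ∧ y = y' := by
    intro x y x' y' h
    have e := V.injective h
    have e0 := congrArg (fun p : Plane => p 0) e
    have e1 := congrArg (fun p : Plane => p 1) e
    simpa using ⟨e0, e1⟩
  rcases hV with ⟨a, b, c, d, hV⟩ | ⟨a, b, c, d, hV⟩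
  · have ha : a ≠ 0 := by
      rintro rfl
      exact zero_ne_one (hne 0 0 1 0 (by simp [hV])).1
    have hb : b ≠ 0 := by
      rintro rfl
      exact zero_ne_one (hne 0 0 0 1 (by simp [hV])).2
    refine Or.inl ⟨a⁻¹, b⁻¹, -(a⁻¹ * c), -(b⁻¹ * d), fun p => ?_⟩
    rw [Equiv.Perm.inv_eq_iff_eq, hV]
    apply plane_ext <;> simp <;> field_simp <;> ring
  · have ha : a ≠ 0 := by
      rintro rfl
      exact zero_ne_one (hne 0 0 0 1 (by simp [hV])).2
    have hb : b ≠ 0 := by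
      rintro rfl
      exact zero_ne_one (hne 0 0 1 0 (by simp [hV])).1
    refine Or.inr ⟨b⁻¹, a⁻¹, -(b⁻¹ * d), -(a⁻¹ * c), fun p => ?_⟩
    rw [Equiv.Perm.inv_eq_iff_eq, hV]
    apply plane_ext <;> simp <;> field_simp <;> ring

theorem axis_scS : Axis scS := Or.inl ⟨s, s, 0, 0, fun p => by
  rw [scS_apply]; apply plane_ext <;> simp⟩

theorem axis_one : Axis 1 := Or.inl ⟨1, 1, 0, 0, fun p => by apply plane_ext <;> simp⟩

theorem axis_step (b i : Bool) : Axis (step b i) := by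
  cases b
  · cases i
    · exact Or.inr ⟨-s, s, s, 0, fun p => by apply plane_ext <;> simp [step]; ring⟩
    · exact Or.inl ⟨s ^ 2, -s ^ 2, 0, 1, fun p => by apply plane_ext <;> simp [step]; ring⟩
  · exact axis_one

theorem axis_refl (i : Fin 2) (c : ℝ) : Axis (refl i c) := by
  fin_cases i
  · exact Or.inl ⟨-1, 1, 2 * c, 0, fun p => by
      rw [refl_apply]; apply plane_ext <;> simp; ring⟩
  · exact Or.inl ⟨1, -1, 0, 2 * c, fun p => by
      rw [refl_apply]; apply plane_ext <;> simp; ring⟩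

theorem Axis.mul_refl {V : Equiv.Perm Plane} (hV : Axis V) (i : Fin 2) (c : ℝ) :
    ∃ i' c', V * refl i c = refl i' c' * V ∧ ∀ p : Plane, p i = c → V p i' = c' := by
  rcases hV with ⟨a, b, c', d', hV⟩ | ⟨a, b, c', d', hV⟩ <;> fin_cases i
  · refine ⟨0, a * c + c', ?_, fun p hp => by simp at hp; simp [hV, hp]⟩
    ext1 p
    rw [Equiv.Perm.mul_apply, Equiv.Perm.mul_apply, hV, hV, refl_apply, refl_apply]
    apply plane_ext <;> simp; ring
  · refine ⟨1, b * c + d', ?_, fun p hp => by simp at hp; simp [hV, hp]⟩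
    ext1 p
    rw [Equiv.Perm.mul_apply, Equiv.Perm.mul_apply, hV, hV, refl_apply, refl_apply]
    apply plane_ext <;> simp; ring
  · refine ⟨1, b * c + d', ?_, fun p hp => by simp at hp; simp [hV, hp]⟩
    ext1 p
    rw [Equiv.Perm.mul_apply, Equiv.Perm.mul_apply, hV, hV, refl_apply, refl_apply]
    apply plane_ext <;> simp; ring
  · refine ⟨0, a * c + c', ?_, fun p hp => by simp at hp; simp [hV, hp]⟩
    ext1 p
    rw [Equiv.Perm.mul_apply, Equiv.Perm.mul_apply, hV, hV, refl_apply, refl_apply]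
    apply plane_ext <;> simp; ring

/-- The sides OA and OB are perpendicular, of lengths r s and r after scaling, and an axis map makes
one of them parallel to the `i`-th axis. -/
theorem Axis.wide {V : Equiv.Perm Plane} (hV : Axis V) {r : ℝ} (hr : Scales r V) (i : Fin 2) :
    ∃ p ∈ V '' G, ∃ q ∈ V '' G, r * s ≤ p i - q i := by
  have hs := s_pos
  have hs1 := s_lt_one
  have hr0 := hr.1
  have key : ∀ x ∈ G, ∀ y ∈ G, (r * s) ^ 2 ≤ (V x i - V y i) ^ 2 →
      ∃ p ∈ V '' G, ∃ q ∈ V '' G, r * s ≤ p i - q i := by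
    intro x hx y hy h
    have h := sq_le_sq.mp h
    rw [abs_of_pos (mul_pos hr0 hs)] at h
    rcases le_abs.mp h with h | h
    · exact ⟨_, ⟨x, hx, rfl⟩, _, ⟨y, hy, rfl⟩, h⟩
    · exact ⟨_, ⟨y, hy, rfl⟩, _, ⟨x, hx, rfl⟩, by linarith⟩
  have hA := hr.dist_sq_eq (pt s 0) (pt 0 0)
  have hB := hr.dist_sq_eq (pt 0 1) (pt 0 0)
  rw [dist_sq, dist_sq] at hA hB
  have hle : (r * s) ^ 2 ≤ r ^ 2 := by
    rw [mul_pow]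
    nlinarith [sq_nonneg r, s_sq_bounds.2]
  rcases hV with ⟨a, b, c, d, hV⟩ | ⟨a, b, c, d, hV⟩ <;> simp [hV] at hA hB <;> fin_cases i
  · refine key _ mem_G_A _ mem_G_zero ?_
    simp [hV, mul_pow, hA]
  · refine key _ mem_G_B _ mem_G_zero ?_
    simpa [hV, hB] using hle
  · refine key _ mem_G_B _ mem_G_zero ?_
    simpa [hV, hB] using hle
  · refine key _ mem_G_A _ mem_G_zero ?_
    simp [hV, mul_pow, hA]

/-! ### Mirror pairs -/

/-- The codes that persist at all levels are mirror images in an edge of the first tile. -/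
theorem lateCodes_six : ∀ p ∈ lateCodes 6,
    (codeSym p = ⟨false, (1, 0), (-1, 0), (0, 0), (0, 0)⟩ ∨
      codeSym p = ⟨false, (-1, 0), (1, 0), (0, 0), (0, 0)⟩ ∨
      codeSym p = ⟨false, (1, 0), (-1, 0), (0, 0), (2, 0)⟩) ∧
    codeSmall' p = codeSmall p ∧
    ∀ i j, child p i j ≠ 0 → child p i j < 26 → i = j := by decide +kernel

/-- The three surviving symbols are the reflections in the lines carrying the bottom, left and top
edges of G. As G lies on one side of each line, common points are on the line. -/
theorem exists_refl_of_late {p : ℕ} (hp : p ∈ lateCodes 6) : ∃ i c,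
    (∀ x, (codeSym p).act x = refl i c x) ∧ ∀ x ∈ G ∩ (codeSym p).act '' G, x i = c := by
  have hts := tau_mul_s
  have h1 : ∀ x, s * (tau * x) = x := fun x => by linear_combination x * hts
  rcases (lateCodes_six p hp).1 with e | e | e <;> rw [e]
  · refine ⟨1, 0, fun x => plane_ext ?_ ?_, ?_⟩
    · simp [Sym.act, refl_apply, zv, h1]
    · simp [Sym.act, refl_apply, zv]
    · rintro _ ⟨hx, y, hy, rfl⟩
      have h2 := (G_bounds hx).2.2.1
      have h3 := (G_bounds hy).2.2.1
      simp [Sym.act, zv] at h2 ⊢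
      linarith
  · refine ⟨0, 0, fun x => plane_ext ?_ ?_, ?_⟩
    · simp [Sym.act, refl_apply, zv, h1]
    · simp [Sym.act, refl_apply, zv]
    · rintro _ ⟨hx, y, hy, rfl⟩
      have h2 := (G_bounds hx).1
      have h3 := (G_bounds hy).1
      simp [Sym.act, zv, h1] at h2 ⊢
      linarith
  · refine ⟨1, 1, fun x => plane_ext ?_ ?_, ?_⟩
    · simp [Sym.act, refl_apply, zv, h1]
    · simp [Sym.act, refl_apply, zv]; ring
    · rintro _ ⟨hx, y, hy, rfl⟩
      have h2 := (G_bounds hx).2.2.2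
      have h3 := (G_bounds hy).2.2.2
      simp [Sym.act, zv] at h2 ⊢
      linarith

/-- A late position admits edge contact only between children of the same index. The same step map
then occurs in both placements and cancels, so the mirror relation passes to the parents. -/
theorem Hereditary.mirror_parent {T : TileSet} (h : Hereditary T) {x y : Set Plane} (hx : x ∈ T)
    (hy : y ∈ T) (hne : ∀ n, anc n T x ≠ anc n T y) (hinf : (x ∩ y).Infinite)
    {ρ V : Equiv.Perm Plane} {r r' : ℝ} (hV : Scales r V) (hW : Scales r' (ρ * V)) (ex : x = V '' G)
    (ey : y = (ρ * V : Equiv.Perm Plane) '' G) :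
    ∃ V' r r', Scales r V' ∧ Scales r' (scS * ρ * scS⁻¹ * V') ∧ parent T x = V' '' G ∧
      parent T y = (scS * ρ * scS⁻¹ * V' : Equiv.Perm Plane) '' G := by
  have hpx := h.locallyAmmann.parent_spec hx
  have hpy := h.locallyAmmann.parent_spec hy
  have hinf' := infinite_parent hpx.2 hpy.2 hinf
  -- The sixth ancestors of the parents are the seventh ancestors of the tiles themselves.
  obtain ⟨p, hp, V', W', hc, e1, e2⟩ := h.desub.exists_lateCode (n := 6) hpx.1 hpy.1
    (hne 7) hinf'
  obtain ⟨i, j, q, hq, hq25, hc', e3, e4⟩ := hc.child (e1 ▸ hpx.2) (e2 ▸ hpy.2) hinf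
  obtain ⟨-, hsm, hij⟩ := lateCodes_six p hp
  obtain rfl := hij i j (by omega) (by omega)
  have e5 := hV.eq_of_image hc'.2.1 (ex ▸ e3)
  have e6 := hW.eq_of_image hc'.2.2.1 (ey ▸ e4)
  have e7 : scS * ρ * scS⁻¹ * V' = W' := by
    rw [e5, hsm] at e6
    have e8 : (ρ * (scS⁻¹ * V')) * step (codeSmall p) i = scS⁻¹ * W' * step (codeSmall p) i := by
      rw [mul_assoc]; exact e6
    have e9 := mul_right_cancel e8
    rw [mul_assoc, mul_assoc, e9, mul_inv_cancel_left]
  exact ⟨V', _, _, hc.2.1, e7 ▸ hc.2.2.1, e1, by rw [e7]; exact e2⟩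

theorem anc_anc (i j : ℕ) (T : TileSet) (t : Set Plane) :
    anc i (desub^[j] T) (anc j T t) = anc (i + j) T t := by
  induction j generalizing T t with
  | zero => rfl
  | succ j ih => exact ih (desub T) (parent T t)

theorem Hereditary.iterate {T : TileSet} (h : Hereditary T) (j : ℕ) :
    Hereditary (Ammann.desub^[j] T) := fun i => by
  rw [← Function.iterate_add_apply]; exact h (i + j)

theorem Hereditary.mirror_anc {T : TileSet} (h : Hereditary T) {x y : Set Plane} (hx : x ∈ T)
    (hy : y ∈ T) (hne : ∀ n, anc n T x ≠ anc n T y) (hinf : (x ∩ y).Infinite)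
    {ρ V : Equiv.Perm Plane} {r r' : ℝ} (hV : Scales r V) (hW : Scales r' (ρ * V)) (ex : x = V '' G)
    (ey : y = (ρ * V : Equiv.Perm Plane) '' G) (j : ℕ) :
    anc j T y = (scS ^ j * ρ * scS⁻¹ ^ j : Equiv.Perm Plane) '' anc j T x := by
  have key : ∀ j, (anc j T x ∩ anc j T y).Infinite ∧ ∃ V r r', Scales r V ∧
      Scales r' (scS ^ j * ρ * scS⁻¹ ^ j * V) ∧ anc j T x = V '' G ∧
      anc j T y = (scS ^ j * ρ * scS⁻¹ ^ j * V : Equiv.Perm Plane) '' G := by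
    intro j
    induction j with
    | zero => exact ⟨hinf, V, r, r', hV, by simpa using hW, ex, by simpa [anc] using ey⟩
    | succ j ih =>
      obtain ⟨hi, V, r, r', h1, h2, h3, h4⟩ := ih
      refine ⟨infinite_parent (h.anc_mem_succ hx j) (h.anc_mem_succ hy j) hi, ?_⟩
      have hne' : ∀ n, anc n (Ammann.desub^[j] T) (anc j T x) ≠ anc n (Ammann.desub^[j] T) (anc j T y) :=
        fun n => by rw [anc_anc, anc_anc]; exact hne _
      have := (h.iterate j).mirror_parent (h.anc_mem hx j) (h.anc_mem hy j) hne' hi h1 h2 h3 h4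
      rw [← anc_succ, ← anc_succ] at this
      rw [pow_succ', pow_succ]
      simpa only [mul_assoc] using this
  obtain ⟨-, V, _, _, -, -, h3, h4⟩ := key j
  rw [h4, h3, image_mul_G]

/-- The tile is positioned parallel to the coordinate axes. -/
def AxisTile (t : Set Plane) : Prop := ∃ r V, Scales r V ∧ Axis V ∧ t = V '' G

theorem axisTile_iff {t : Set Plane} {r : ℝ} {V : Equiv.Perm Plane} (hV : Scales r V)
    (e : t = V '' G) : AxisTile t ↔ Axis V := by
  constructor
  · rintro ⟨r', W, hW, hA, e'⟩
    rwa [hV.eq_of_image hW (e ▸ e')]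
  · exact fun hA => ⟨r, V, hV, hA, e⟩

theorem axisTile_child {x P : Set Plane} (hP : IsTile P) (hx : x ∈ substitute {P}) :
    AxisTile x ↔ AxisTile P := by
  obtain ⟨b, V, hV, rfl⟩ : ∃ b V, Scales (ratio b) V ∧ P = V '' G := by
    rcases hP with h | h
    · obtain ⟨V, hV, rfl⟩ := isLarge_iff.mp h
      exact ⟨false, V, hV, rfl⟩
    · obtain ⟨V, hV, rfl⟩ := isSmall_iff.mp h
      exact ⟨true, V, hV, rfl⟩
  obtain ⟨i, -, e, hsc⟩ := exists_step hV hx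
  rw [axisTile_iff hsc e, axisTile_iff hV rfl]
  constructor
  · intro h
    have := (axis_scS.mul h).mul (axis_step b i).inv
    rwa [mul_assoc scS⁻¹, mul_inv_cancel_left, mul_inv_cancel_right] at this
  · exact fun h => (axis_scS.inv.mul h).mul (axis_step b i)

theorem Hereditary.axisTile_anc {T : TileSet} (h : Hereditary T) {t : Set Plane} (ht : t ∈ T) (j : ℕ) :
    AxisTile (anc j T t) ↔ AxisTile t := by
  induction j with
  | zero => rfl
  | succ j ih =>
    rw [← ih, axisTile_child ((h (j + 1)).tile _ (h.anc_mem ht _)) (h.anc_mem_succ ht j)]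

/-- The line on which the `i`-th coordinate is `c` is a border of the class of `t`, across which this
class is reflected. -/
def Wall (T : TileSet) (t : Set Plane) (i : Fin 2) (c : ℝ) : Prop :=
  (∃ p ∈ ⋃₀ cls T t, p i = c) ∧
    ∃ y ∈ T, y ∉ cls T t ∧ AxisTile y ∧ cls T y = mapTiles (refl i c) (cls T t)

theorem scales_scS_pow (j : ℕ) : Scales (s ^ j) (scS ^ j) := by
  induction j with
  | zero => simpa using scales_one
  | succ j ih => rw [pow_succ, pow_succ]; exact ih.mul scales_scS

/-- Two tiles of different classes with infinite contact never acquire a common ancestor, so they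
are mirror images, and so are all pairs of corresponding ancestors. Hence the entire classes are. -/
theorem Hereditary.exists_wall {T : TileSet} (h : Hereditary T) {t x y : Set Plane} (ht : t ∈ T)
    (hA : AxisTile t) (hx : x ∈ cls T t) (hy : y ∈ T) (hyc : y ∉ cls T t) (hinf : (x ∩ y).Infinite) :
    ∃ i c, Wall T t i c ∧ ∀ p ∈ x ∩ y, p i = c := by
  have hAx : AxisTile x := by
    obtain ⟨j, hj⟩ := hx.2
    rwa [← h.axisTile_anc hx.1 j, hj, h.axisTile_anc ht j]
  rw [← cls_eq hx] at hyc
  have hne : ∀ n, anc n T x ≠ anc n T y := fun n e => hyc ⟨hy, n, e.symm⟩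
  obtain ⟨p, hp, V, W, hc, ex, ey⟩ := h.exists_lateCode hx.1 hy (hne 6) hinf
  obtain ⟨i, c, hact, hline⟩ := exists_refl_of_late hp
  have hAV : Axis V := (axisTile_iff hc.2.1 ex).mp hAx
  obtain ⟨i', c', hcomm, hmap⟩ := hAV.mul_refl i c
  have eW : W = refl i' c' * V := by
    rw [← hcomm]
    ext1 z
    rw [hc.2.2.2 z, hact, Equiv.Perm.mul_apply]
  have hpts : ∀ z ∈ x ∩ y, z i' = c' := by
    rw [ex, ey, hc.2.2.2.inter]
    rintro _ ⟨z, hz, rfl⟩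
    exact hmap z (hline z hz)
  refine ⟨i', c', ⟨?_, y, hy, ?_, ?_, ?_⟩, hpts⟩
  · obtain ⟨z, hz⟩ := hinf.nonempty
    exact ⟨z, ⟨x, hx, hz.1⟩, hpts z hz⟩
  · rwa [← cls_eq hx]
  · exact ⟨_, W, hc.2.2.1, eW ▸ (axis_refl i' c').mul hAV, ey⟩
  · rw [← cls_eq hx, h.cls_eq_iUnion hx.1, h.cls_eq_iUnion hy, mapTiles_iUnion]
    refine Set.iUnion_congr fun j => ?_
    -- At level `j` the mirror is conjugated by `scS ^ j`. Subdividing the ancestors `j` times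
    -- undoes the conjugation, so all levels give the same line.
    have hj := h.mirror_anc hx.1 hy hne hinf hc.2.1 (eW ▸ hc.2.2.1) ex (eW ▸ ey) j
    have hρ : Scales 1 (scS ^ j * refl i' c' * scS⁻¹ ^ j) := by
      have e := scales_scS_pow j
      have := (e.mul (scales_refl i' c')).mul e.inv
      rwa [mul_one, mul_inv_cancel₀ (pow_ne_zero j s_ne), ← inv_pow] at this
    have e2 : ({anc j T y} : TileSet) =
        mapTiles (scS ^ j * refl i' c' * scS⁻¹ ^ j : Equiv.Perm Plane) {anc j T x} := by
      rw [mapTiles, Set.image_singleton, ← hj]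
    rw [e2, substitute_iterate_mapTiles hρ]
    congr 2
    group

/-! ### The region covered by a class -/

/-- A connected open part of `G`. -/
def openG : Set Plane := rectOpen 0 s 0 (s ^ 2) ∪ rectOpen 0 (s ^ 3) 0 1

theorem convex_rectOpen (a b c d : ℝ) : Convex ℝ (rectOpen a b c d) := by
  intro p hp q hq u v hu hv huv
  obtain ⟨h1, h2, h3, h4⟩ := hp
  obtain ⟨k1, k2, k3, k4⟩ := hq
  have e : ∀ x : ℝ, x = u * x + v * x := fun x => by rw [← add_mul, huv, one_mul]
  have key : ∀ {x y z : ℝ}, x < y → x < z → x < u * y + v * z := by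
    intro x y z hy hz
    rcases hu.eq_or_lt with rfl | hu'
    · have : v = 1 := by linarith
      subst this; linarith
    · nlinarith [e x]
  have key' : ∀ {x y z : ℝ}, y < x → z < x → u * y + v * z < x := by
    intro x y z hy hz
    rcases hu.eq_or_lt with rfl | hu'
    · have : v = 1 := by linarith
      subst this; linarith
    · nlinarith [e x]
  exact ⟨by simpa using key h1 k1, by simpa using key' h2 k2, by simpa using key h3 k3,
    by simpa using key' h4 k4⟩

theorem isPreconnected_openG : IsPreconnected openG := by
  have h3 : 0 < s ^ 3 := pow_pos s_pos 3
  have h2 : 0 < s ^ 2 := pow_pos s_pos 2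
  have h2' := s_sq_bounds.2
  refine IsPreconnected.union (pt (s ^ 3 / 2) (s ^ 2 / 2)) ?_ ?_
    (convex_rectOpen _ _ _ _).isPreconnected (convex_rectOpen _ _ _ _).isPreconnected
  · simp only [rectOpen, Set.mem_ofPred_eq, pt_zero, pt_one]
    have := s_cube_lt
    refine ⟨by linarith, by linarith, by linarith, by linarith⟩
  · simp only [rectOpen, Set.mem_ofPred_eq, pt_zero, pt_one]
    refine ⟨by linarith, by linarith, by linarith, by linarith⟩

theorem openG_subset : openG ⊆ interior G :=
  Set.union_subset (rectOpen_subset_interior Set.subset_union_left)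
    (rectOpen_subset_interior Set.subset_union_right)

theorem G_subset_closure : G ⊆ closure openG := by
  have hs := s_pos
  rw [G_eq, openG, closure_union]
  exact Set.union_subset_union (rect_subset_closure hs (pow_pos hs 2))
    (rect_subset_closure (pow_pos hs 3) one_pos)

/-- A similar copy of `G` whose interior avoids an axis-parallel line lies on one side of it. -/
theorem one_sided {r : ℝ} {V : Equiv.Perm Plane} (hV : Scales r V) {i : Fin 2} {c : ℝ}
    (h : ∀ p ∈ interior (V '' G), p i ≠ c) :
    (∀ p ∈ V '' G, c ≤ p i) ∨ (∀ p ∈ V '' G, p i ≤ c) := by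
  have hsub : V '' openG ⊆ interior (V '' G) := by
    rw [← hV.image_interior]; exact Set.image_mono openG_subset
  have hcl : V '' G ⊆ closure (V '' openG) := by
    rw [← hV.image_closure]; exact Set.image_mono G_subset_closure
  have hpre : IsPreconnected ((fun p : Plane => p i) '' (V '' openG)) :=
    (isPreconnected_openG.image V hV.continuous.continuousOn).image _
      (continuous_coord i).continuousOn
  have hor : (∀ p ∈ V '' openG, c ≤ p i) ∨ (∀ p ∈ V '' openG, p i ≤ c) := by
    by_contra! hcon
    obtain ⟨⟨p, hp, h1⟩, q, hq, h2⟩ := hcon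
    obtain ⟨z, hz, e⟩ := hpre.ordConnected.out ⟨p, hp, rfl⟩ ⟨q, hq, rfl⟩ ⟨h1.le, h2.le⟩
    exact h z (hsub hz) e
  rcases hor with hor | hor
  · exact Or.inl fun p hp => closure_minimal hor (isClosed_le continuous_const (continuous_coord i))
      (hcl hp)
  · exact Or.inr fun p hp => closure_minimal hor (isClosed_le (continuous_coord i) continuous_const)
      (hcl hp)

/-- Around an interior point on the mirror line, a symmetric neighbourhood would be covered by the
class and by its mirror image. A common tile would then put `y` into the class. -/
theorem Wall.interior_ne {T : TileSet} (h : Hereditary T) {t : Set Plane} {i : Fin 2}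
    {c : ℝ} (hw : Wall T t i c) {z : Plane} (hz : z ∈ interior (⋃₀ cls T t)) : z i ≠ c := by
  intro e
  obtain ⟨-, y, hy, hyc, -, hcl⟩ := hw
  have hl := h.locallyAmmann
  have hcont := (scales_refl i c).continuous
  set N := interior (⋃₀ cls T t) ∩ refl i c ⁻¹' interior (⋃₀ cls T t)
  have hN : IsOpen N := isOpen_interior.inter (isOpen_interior.preimage hcont)
  have hzN : z ∈ N := ⟨hz, by rw [Set.mem_preimage, refl_of_coord e]; exact hz⟩
  obtain ⟨u, hu, hzu⟩ := interior_subset hz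
  obtain ⟨z', hz1, hz2⟩ := mem_closure_iff.mp ((hl.tile u hu.1).regular hzu) N hN hzN
  obtain ⟨u', hu', hzu'⟩ := interior_subset hz1.2
  have hu2 : refl i c '' u' ∈ cls T y := hcl ▸ ⟨u', hu', rfl⟩
  have hz3 : z' ∈ refl i c '' u' := ⟨_, hzu', refl_refl i c z'⟩
  have e2 := hl.noOverlap.eq hu.1 hu2.1 (hl.tile _ hu2.1).regular hz2 hz3
  rw [← e2] at hu2
  have e3 := cls_eq hu2
  rw [cls_eq hu] at e3
  exact hyc (e3 ▸ mem_cls_self hy)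

theorem Hereditary.placement_anc {T : TileSet} (h : Hereditary T) {t : Set Plane} (ht : t ∈ T)
    (j : ℕ) : ∃ b V, Scales (ratio b) V ∧ anc j T t = V '' G := by
  rcases (h j).tile _ (h.anc_mem ht j) with hl | hs
  · obtain ⟨V, hV, e⟩ := isLarge_iff.mp hl
    exact ⟨false, V, hV, e.symm⟩
  · obtain ⟨V, hV, e⟩ := isSmall_iff.mp hs
    exact ⟨true, V, hV, e.symm⟩

theorem ratio_ge (b : Bool) : s ^ 2 ≤ ratio b := by
  cases b
  · exact s_sq_lt.le
  · exact le_rfl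

theorem scales_scS_inv_pow (j : ℕ) : Scales (tau ^ j) (scS⁻¹ ^ j) := by
  have := (scales_scS_pow j).inv
  rwa [← inv_pow, ← inv_pow, s_inv] at this

theorem Hereditary.region_subset {T : TileSet} (h : Hereditary T) {t : Set Plane} (ht : t ∈ T)
    (j : ℕ) : (scS⁻¹ ^ j : Equiv.Perm Plane) '' anc j T t ⊆ ⋃₀ cls T t := by
  rw [h.sUnion_cls ht]
  exact Set.subset_iUnion (fun j => (scS⁻¹ ^ j : Equiv.Perm Plane) '' anc j T t) j

theorem Hereditary.subset_region {T : TileSet} (h : Hereditary T) {t : Set Plane} (ht : t ∈ T)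
    (j : ℕ) : t ⊆ (scS⁻¹ ^ j : Equiv.Perm Plane) '' anc j T t := by
  rw [← sUnion_substitute_iterate j ((h j).tile _ (h.anc_mem ht j))]
  exact Set.subset_sUnion_of_mem (h.mem_anc ht j)

/-- A class lies on one side of each of its walls. -/
theorem Wall.one_sided {T : TileSet} (h : Hereditary T) {t : Set Plane} (ht : t ∈ T) {i : Fin 2}
    {c : ℝ} (hw : Wall T t i c) :
    (∀ p ∈ ⋃₀ cls T t, c ≤ p i) ∨ (∀ p ∈ ⋃₀ cls T t, p i ≤ c) := by
  have hj : ∀ j, (∀ p ∈ (scS⁻¹ ^ j : Equiv.Perm Plane) '' anc j T t, c ≤ p i) ∨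
      (∀ p ∈ (scS⁻¹ ^ j : Equiv.Perm Plane) '' anc j T t, p i ≤ c) := by
    intro j
    obtain ⟨b, V, hV, e⟩ := h.placement_anc ht j
    have hreg := h.region_subset ht j
    rw [e, ← image_mul_G] at hreg ⊢
    exact Ammann.one_sided ((scales_scS_inv_pow j).mul hV) fun p hp =>
      hw.interior_ne h (interior_mono hreg hp)
  obtain ⟨z, hz⟩ := (h.locallyAmmann.tile t ht).nonempty_interior
  have hzne : z i ≠ c := hw.interior_ne h
    (interior_mono (Set.subset_sUnion_of_mem (mem_cls_self ht)) hz)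
  rw [h.sUnion_cls ht]
  rcases lt_or_gt_of_ne hzne with hlt | hgt
  · right
    intro p hp
    obtain ⟨j, hp⟩ := Set.mem_iUnion.mp hp
    refine (hj j).resolve_left (fun h2 => ?_) p hp
    exact absurd (h2 z (h.subset_region ht j (interior_subset hz))) (not_le.mpr hlt)
  · left
    intro p hp
    obtain ⟨j, hp⟩ := Set.mem_iUnion.mp hp
    refine (hj j).resolve_right (fun h2 => ?_) p hp
    exact absurd (h2 z (h.subset_region ht j (interior_subset hz))) (not_le.mpr hgt)

/-- A class is not contained in a strip. -/
theorem Hereditary.not_in_strip {T : TileSet} (h : Hereditary T) {t : Set Plane} (ht : t ∈ T)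
    (hA : AxisTile t) {i : Fin 2} {c c' : ℝ} (h1 : ∀ p ∈ ⋃₀ cls T t, c ≤ p i)
    (h2 : ∀ p ∈ ⋃₀ cls T t, p i ≤ c') : False := by
  have hs3 : 0 < s ^ 2 * s := by have := s_pos; positivity
  -- The region contains the `j`-th ancestor enlarged by τ^j. Its extent in every axis direction is
  -- at least τ^j s² · s, which exceeds the width of the strip for large `j`.
  obtain ⟨j, hj⟩ := pow_unbounded_of_one_lt ((c' - c) / (s ^ 2 * s)) tau_gt_one
  rw [div_lt_iff₀ hs3] at hj
  obtain ⟨b, V, hV, e⟩ := h.placement_anc ht j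
  have hAV : Axis V := (axisTile_iff hV e).mp ((h.axisTile_anc ht j).mpr hA)
  have hAj : Axis (scS⁻¹ ^ j) := by
    clear hj e
    induction j with
    | zero => exact axis_one
    | succ j ih => rw [pow_succ]; exact ih.mul axis_scS.inv
  have hreg := h.region_subset ht j
  rw [e, ← image_mul_G] at hreg
  obtain ⟨p, hp, q, hq, hpq⟩ := (hAj.mul hAV).wide ((scales_scS_inv_pow j).mul hV) i
  have h3 := h1 q (hreg hq)
  have h4 := h2 p (hreg hp)
  have h5 : tau ^ j * (s ^ 2 * s) ≤ tau ^ j * ratio b * s := by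
    have := mul_le_mul_of_nonneg_left (mul_le_mul_of_nonneg_right (ratio_ge b) s_pos.le)
      (pow_pos tau_pos j).le
    linarith
  linarith

/-! ### Generic segments -/

/-- Segments from `p` to different points of a line transversal to the direction of `q₀` meet only
in `p`. Each other point of `N` thus spoils at most one end point, and an interval offers
uncountably many. -/
theorem exists_generic_segment {N : Set Plane} (hN : N.Countable) {O : Set Plane} (hO : IsOpen O)
    {p q₀ : Plane} (hq : q₀ ∈ O) (hne : p ≠ q₀) :
    ∃ q ∈ O, ∀ z ∈ segment ℝ p q, z ≠ p → z ∉ N := by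
  set d := q₀ - p with hd
  set w : Plane := pt (-d 1) (d 0) with hw
  have hdpos : 0 < d 0 ^ 2 + d 1 ^ 2 := by
    by_contra hcon
    apply hne
    have h0 : d 0 = 0 := by nlinarith [sq_nonneg (d 0), sq_nonneg (d 1)]
    have h1 : d 1 = 0 := by nlinarith [sq_nonneg (d 0), sq_nonneg (d 1)]
    simp [hd] at h0 h1
    exact plane_ext (by linarith) (by linarith)
  have hcont : Continuous fun l : ℝ => q₀ + l • w := by fun_prop
  obtain ⟨ε, hε, hball⟩ := Metric.isOpen_iff.mp (hO.preimage hcont) 0 (by simpa using hq)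
  set bad : Set ℝ := ⋃ n ∈ N \ {p}, {l | n ∈ segment ℝ p (q₀ + l • w)} with hbad
  have hbc : bad.Countable := by
    refine (hN.mono Set.sdiff_subset).biUnion fun n hn => Set.Subsingleton.countable ?_
    -- The products of n - p with `d` and with its perpendicular determine the position `b` on the
    -- segment and then the parameter `l`.
    have key : ∀ l : ℝ, n ∈ segment ℝ p (q₀ + l • w) → ∃ μ : ℝ, μ ≠ 0 ∧
        (n 0 - p 0) * d 0 + (n 1 - p 1) * d 1 = μ * (d 0 ^ 2 + d 1 ^ 2) ∧
        (n 1 - p 1) * d 0 - (n 0 - p 0) * d 1 = μ * l * (d 0 ^ 2 + d 1 ^ 2) := by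
      rintro l ⟨a, b, ha, hb, hab, e⟩
      have e0 := congrArg (fun x : Plane => x 0) e
      have e1 := congrArg (fun x : Plane => x 1) e
      simp [hw] at e0 e1
      have ea : a = 1 - b := by linarith
      subst ea
      have hq0 : q₀ 0 = d 0 + p 0 := by simp [hd]
      have hq1 : q₀ 1 = d 1 + p 1 := by simp [hd]
      rw [hq0] at e0
      rw [hq1] at e1
      refine ⟨b, ?_, ?_, ?_⟩
      · rintro rfl
        exact hn.2 (plane_ext (by linarith) (by linarith))
      · rw [← e0, ← e1]; ring
      · rw [← e0, ← e1]; ring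
    intro l hl l' hl'
    obtain ⟨μ, hμ, h1, h2⟩ := key l hl
    obtain ⟨μ', hμ', h1', h2'⟩ := key l' hl'
    have eμ : μ = μ' := mul_right_cancel₀ hdpos.ne' (h1.symm.trans h1')
    rw [← eμ] at h2'
    exact mul_left_cancel₀ hμ (mul_right_cancel₀ hdpos.ne' (h2.symm.trans h2'))
  have hnot : ¬ (Set.Ioo 0 ε ⊆ bad) := fun hsub =>
    (Cardinal.Real.Ioo_countable_iff.not.mpr (not_le.mpr hε)) (hbc.mono hsub)
  obtain ⟨l, hl, hlb⟩ := Set.not_subset.mp hnot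
  refine ⟨q₀ + l • w, hball ?_, fun z hz hzp hzN => hlb ?_⟩
  · rw [Metric.mem_ball, dist_zero_right, Real.norm_of_nonneg hl.1.le]
    exact hl.2
  · exact Set.mem_biUnion (x := z) ⟨hzN, hzp⟩ hz

/-- A point outside the region of a class is separated from it by a wall. -/
theorem IsPlaneAmmann.exists_separating_wall {T : TileSet} (hT : IsPlaneAmmann T) {t : Set Plane}
    (ht : t ∈ T) (hA : AxisTile t) {p : Plane} (hp : p ∉ ⋃₀ cls T t) :
    ∃ i c, Wall T t i c ∧ (((∀ q ∈ ⋃₀ cls T t, c ≤ q i) ∧ p i < c) ∨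
      ((∀ q ∈ ⋃₀ cls T t, q i ≤ c) ∧ c < p i)) := by
  have h := hT.hereditary
  have hl := h.locallyAmmann
  -- The points common to two tiles with finite intersection are countable in number. Away from its
  -- starting point, a generic segment passes between tiles only at infinite contacts.
  set N : Set Plane := ⋃ a ∈ T, ⋃ b ∈ T, {z | z ∈ a ∩ b ∧ (a ∩ b).Finite} with hN
  have hTc := countable_of_noOverlap hl.tile hl.noOverlap
  have hNc : N.Countable := by
    refine hTc.biUnion fun a _ => hTc.biUnion fun b _ => ?_
    by_cases hf : (a ∩ b).Finite
    · exact hf.countable.mono fun z hz => hz.1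
    · convert Set.countable_empty
      exact Set.eq_empty_of_forall_notMem fun z hz => hf hz.2
  obtain ⟨q₀, hq₀⟩ := (hl.tile t ht).nonempty_interior
  have htC : t ⊆ ⋃₀ cls T t := Set.subset_sUnion_of_mem (mem_cls_self ht)
  obtain ⟨q, hq, hseg⟩ := exists_generic_segment hNc isOpen_interior hq₀ (p := p)
    (by rintro rfl; exact hp (htC (interior_subset hq₀)))
  have hcl1 : IsClosed (⋃₀ cls T t) :=
    isClosed_sUnion (fun u hu => hl.tile u hu.1) (hl.noOverlap.mono fun u hu => hu.1)
  have hcl2 : IsClosed (⋃₀ (T \ cls T t)) :=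
    isClosed_sUnion (fun u hu => hl.tile u hu.1) (hl.noOverlap.mono Set.sdiff_subset)
  have hcov : ∀ z, z ∈ ⋃₀ cls T t ∨ z ∈ ⋃₀ (T \ cls T t) := by
    intro z
    obtain ⟨u, hu, hz⟩ : z ∈ ⋃₀ T := hT.1.2 ▸ Set.mem_univ z
    by_cases hc : u ∈ cls T t
    · exact Or.inl ⟨u, hc, hz⟩
    · exact Or.inr ⟨u, ⟨hu, hc⟩, hz⟩
  -- The region of the class and the union of the other tiles are closed and cover the segment, so
  -- they share a point of it. That point is not `p`, so the tiles meeting there have infinite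
  -- intersection and yield a wall.
  have hpre : IsPreconnected (segment ℝ p q) := (convex_segment p q).isPreconnected
  obtain ⟨z, hzs, ⟨x, hx, hzx⟩, y, hy, hzy⟩ := isPreconnected_closed_iff.mp hpre _ _ hcl1 hcl2
    (fun z _ => hcov z) ⟨q, right_mem_segment ℝ p q, htC (interior_subset hq)⟩
    ⟨p, left_mem_segment ℝ p q, (hcov p).resolve_left hp⟩
  have hzp : z ≠ p := by rintro rfl; exact hp ⟨x, hx, hzx⟩
  have hinf : (x ∩ y).Infinite := by
    intro hf
    exact hseg z hzs hzp (Set.mem_biUnion hx.1 (Set.mem_biUnion hy.1 ⟨⟨hzx, hzy⟩, hf⟩))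
  obtain ⟨i, c, hw, hline⟩ := h.exists_wall ht hA hx hy.1 hy.2 hinf
  have hzi := hline z ⟨hzx, hzy⟩
  have hqi : q i ≠ c := hw.interior_ne h (interior_mono htC hq)
  refine ⟨i, c, hw, ?_⟩
  obtain ⟨a, b, ha, hb, hab, e⟩ := hzs
  have e' : a * p i + b * q i = c := by
    rw [← hzi, ← e]; simp
  have hb0 : 0 < b := by
    refine hb.lt_of_ne fun hb0 => hzp ?_
    rw [← e, ← hb0, show a = 1 by linarith]
    simp
  have ha0 : 0 < a := by
    refine ha.lt_of_ne fun ha0 => hqi ?_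
    rw [← e', ← ha0, show b = 1 by linarith]
    ring
  have e2 : a * (p i - c) = - (b * (q i - c)) := by
    have : c = a * c + b * c := by rw [← add_mul, hab, one_mul]
    linarith
  rcases hw.one_sided h ht with h1 | h1
  · left
    refine ⟨h1, ?_⟩
    have h2 : 0 < b * (q i - c) :=
      mul_pos hb0 (sub_pos.mpr ((h1 q (htC (interior_subset hq))).lt_of_ne hqi.symm))
    by_contra hcon
    have := mul_nonneg ha0.le (sub_nonneg.mpr (not_lt.mp hcon))
    linarith
  · right
    refine ⟨h1, ?_⟩
    have h2 : 0 < b * (c - q i) :=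
      mul_pos hb0 (sub_pos.mpr ((h1 q (htC (interior_subset hq))).lt_of_ne hqi))
    by_contra hcon
    have := mul_nonneg ha0.le (sub_nonneg.mpr (not_lt.mp hcon))
    linarith

/-! ### There is only one class -/

/-! ### Classes fill a half plane, a quadrant, or the plane -/

/-- The region reaches each of its walls, so parallel walls with the region on the same side
coincide. With the region on opposite sides they would bound a strip. -/
theorem Wall.unique {T : TileSet} (h : Hereditary T) {t : Set Plane} (ht : t ∈ T) (hA : AxisTile t)
    {i : Fin 2} {c c' : ℝ} (hw : Wall T t i c) (hw' : Wall T t i c') : c = c' := by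
  obtain ⟨p, hp, e⟩ := hw.1
  obtain ⟨p', hp', e'⟩ := hw'.1
  rcases hw.one_sided h ht with h1 | h1 <;> rcases hw'.one_sided h ht with h2 | h2
  · exact le_antisymm (e' ▸ h1 p' hp') (e ▸ h2 p hp)
  · exact (h.not_in_strip ht hA h1 h2).elim
  · exact (h.not_in_strip ht hA h2 h1).elim
  · exact le_antisymm (e ▸ h2 p hp) (e' ▸ h1 p' hp')

/-- The side of a wall on which the class lies, as a sign. -/
theorem Wall.exists_sign {T : TileSet} (h : Hereditary T) {t : Set Plane} (ht : t ∈ T)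
    (hA : AxisTile t) {i : Fin 2} {c : ℝ} (hw : Wall T t i c) : ∃ ε : ℝ, (ε = 1 ∨ ε = -1) ∧
      (∀ p ∈ ⋃₀ cls T t, 0 ≤ ε * (p i - c)) ∧
      ∀ p : Plane, (((∀ q ∈ ⋃₀ cls T t, c ≤ q i) ∧ p i < c) ∨
        ((∀ q ∈ ⋃₀ cls T t, q i ≤ c) ∧ c < p i)) → ε * (p i - c) < 0 := by
  rcases hw.one_sided h ht with h1 | h1
  · refine ⟨1, Or.inl rfl, fun p hp => by linarith [h1 p hp], ?_⟩
    rintro p (⟨-, h2⟩ | ⟨h2, -⟩)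
    · linarith
    · exact (h.not_in_strip ht hA h1 h2).elim
  · refine ⟨-1, Or.inr rfl, fun p hp => by linarith [h1 p hp], ?_⟩
    rintro p (⟨h2, -⟩ | ⟨-, h2⟩)
    · exact (h.not_in_strip ht hA h2 h1).elim
    · linarith

theorem IsPlaneAmmann.region_half {T : TileSet} (hT : IsPlaneAmmann T) {t : Set Plane} (ht : t ∈ T)
    (hA : AxisTile t) {i : Fin 2} {c : ℝ} (hw : Wall T t i c)
    (hno : ∀ i' c', Wall T t i' c' → i' = i) : ∃ ε : ℝ, (ε = 1 ∨ ε = -1) ∧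
      ∀ p, p ∈ ⋃₀ cls T t ↔ 0 ≤ ε * (p i - c) := by
  have h := hT.hereditary
  obtain ⟨ε, hε, h1, h2⟩ := hw.exists_sign h ht hA
  refine ⟨ε, hε, fun p => ⟨h1 p, fun hp => ?_⟩⟩
  by_contra hcon
  obtain ⟨i', c', hw', hs⟩ := hT.exists_separating_wall ht hA hcon
  obtain rfl := hno i' c' hw'
  obtain rfl := hw.unique h ht hA hw'
  exact absurd hp (not_le.mpr (h2 p hs))

theorem IsPlaneAmmann.region_quadrant {T : TileSet} (hT : IsPlaneAmmann T) {t : Set Plane}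
    (ht : t ∈ T) (hA : AxisTile t) {c₀ c₁ : ℝ} (hw₀ : Wall T t 0 c₀) (hw₁ : Wall T t 1 c₁) :
    ∃ ε₀ ε₁ : ℝ, (ε₀ = 1 ∨ ε₀ = -1) ∧ (ε₁ = 1 ∨ ε₁ = -1) ∧
      ∀ p, p ∈ ⋃₀ cls T t ↔ 0 ≤ ε₀ * (p 0 - c₀) ∧ 0 ≤ ε₁ * (p 1 - c₁) := by
  have h := hT.hereditary
  obtain ⟨ε₀, hε₀, h1, h2⟩ := hw₀.exists_sign h ht hA
  obtain ⟨ε₁, hε₁, k1, k2⟩ := hw₁.exists_sign h ht hA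
  refine ⟨ε₀, ε₁, hε₀, hε₁, fun p => ⟨fun hp => ⟨h1 p hp, k1 p hp⟩, fun hp => ?_⟩⟩
  by_contra hcon
  obtain ⟨i, c', hw', hs⟩ := hT.exists_separating_wall ht hA hcon
  fin_cases i
  · obtain rfl := hw₀.unique h ht hA hw'
    exact absurd hp.1 (not_le.mpr (h2 p hs))
  · obtain rfl := hw₁.unique h ht hA hw'
    exact absurd hp.2 (not_le.mpr (k2 p hs))

theorem IsNestedUnion.map {S : TileSet} (h : IsNestedUnion S) {U : Equiv.Perm Plane}
    (hU : Scales 1 U) : IsNestedUnion (mapTiles U S) := by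
  obtain ⟨m, P, hm, hP, hc, rfl⟩ := h
  refine ⟨m, fun n => mapTiles U (P n), hm, fun a b hab => mapTiles_mono (hP hab), fun n => ?_,
    mapTiles_iUnion _ _⟩
  obtain ⟨W, hW, e⟩ := (hc n).exists_scales
  refine ⟨(show Scales 1 (U * W) by simpa using hU.mul hW).toIso, ?_⟩
  rw [Scales.coe_toIso, ← mapTiles_mul, e]

theorem mapTiles_conj {A B W : Equiv.Perm Plane} (h : A * W = W * B) (S : TileSet) :
    mapTiles A (mapTiles W S) = mapTiles W (mapTiles B S) := by
  rw [mapTiles_mul, mapTiles_mul, h]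

theorem Scales.congruent_of_map {U : Equiv.Perm Plane} (hU : Scales 1 U) (S : TileSet) :
    CongruentTilings (mapTiles U S) S := by
  refine ⟨(show Scales 1 U⁻¹ by simpa using hU.inv).toIso, ?_⟩
  rw [Scales.coe_toIso, mapTiles_mul, inv_mul_cancel, mapTiles_one]

/-- The isometry that carries the line on which the `i`-th coordinate is `c` to the first axis. -/
def halfMap (i : Fin 2) (c ε : ℝ) (hε : ε * ε = 1) : Equiv.Perm Plane where
  toFun p := pt (if i = 0 then p 1 else p 0) (ε * ((if i = 0 then p 0 else p 1) - c))
  invFun q := pt (if i = 0 then ε * q 1 + c else q 0) (if i = 0 then q 0 else ε * q 1 + c)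
  left_inv p := by
    apply plane_ext <;> fin_cases i <;> simp <;> linear_combination (p _ - c) * hε
  right_inv p := by
    apply plane_ext <;> fin_cases i <;> simp <;> linear_combination (p 1) * hε

theorem halfMap_apply {i : Fin 2} {c ε : ℝ} (hε : ε * ε = 1) (p : Plane) : halfMap i c ε hε p =
    pt (if i = 0 then p 1 else p 0) (ε * ((if i = 0 then p 0 else p 1) - c)) := rfl

theorem scales_halfMap {i : Fin 2} {c ε : ℝ} (hε : ε * ε = 1) : Scales 1 (halfMap i c ε hε) :=
  Scales.of_sq one_pos fun x y => by
    rw [dist_sq, dist_sq, halfMap_apply, halfMap_apply]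
    fin_cases i <;> simp
    · linear_combination (x 0 - y 0) ^ 2 * hε
    · linear_combination (x 1 - y 1) ^ 2 * hε

theorem permX_mul_halfMap {i : Fin 2} {c ε : ℝ} (hε : ε * ε = 1) :
    permX * halfMap i c ε hε = halfMap i c ε hε * refl i c := by
  ext1 p
  rw [Equiv.Perm.mul_apply, Equiv.Perm.mul_apply, halfMap_apply, halfMap_apply, coe_permX, refl_apply]
  apply plane_ext <;> fin_cases i <;> simp [reflX] <;> ring

/-- The isometry that carries a quadrant to the first one. -/
def quadMap (c₀ c₁ ε₀ ε₁ : ℝ) (h₀ : ε₀ * ε₀ = 1) (h₁ : ε₁ * ε₁ = 1) : Equiv.Perm Plane where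
  toFun p := pt (ε₀ * (p 0 - c₀)) (ε₁ * (p 1 - c₁))
  invFun q := pt (ε₀ * q 0 + c₀) (ε₁ * q 1 + c₁)
  left_inv p := by
    apply plane_ext <;> simp
    · linear_combination (p 0 - c₀) * h₀
    · linear_combination (p 1 - c₁) * h₁
  right_inv p := by
    apply plane_ext <;> simp
    · linear_combination (p 0) * h₀
    · linear_combination (p 1) * h₁

theorem quadMap_apply {c₀ c₁ ε₀ ε₁ : ℝ} (h₀ : ε₀ * ε₀ = 1) (h₁ : ε₁ * ε₁ = 1) (p : Plane) :
    quadMap c₀ c₁ ε₀ ε₁ h₀ h₁ p = pt (ε₀ * (p 0 - c₀)) (ε₁ * (p 1 - c₁)) := rfl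

theorem scales_quadMap {c₀ c₁ ε₀ ε₁ : ℝ} (h₀ : ε₀ * ε₀ = 1) (h₁ : ε₁ * ε₁ = 1) :
    Scales 1 (quadMap c₀ c₁ ε₀ ε₁ h₀ h₁) :=
  Scales.of_sq one_pos fun x y => by
    rw [dist_sq, dist_sq, quadMap_apply, quadMap_apply]
    simp
    linear_combination (x 0 - y 0) ^ 2 * h₀ + (x 1 - y 1) ^ 2 * h₁

theorem permX_mul_quadMap {c₀ c₁ ε₀ ε₁ : ℝ} (h₀ : ε₀ * ε₀ = 1) (h₁ : ε₁ * ε₁ = 1) :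
    permX * quadMap c₀ c₁ ε₀ ε₁ h₀ h₁ = quadMap c₀ c₁ ε₀ ε₁ h₀ h₁ * refl 1 c₁ := by
  ext1 p
  rw [Equiv.Perm.mul_apply, Equiv.Perm.mul_apply, quadMap_apply, quadMap_apply, coe_permX, refl_apply]
  apply plane_ext <;> simp [reflX]; ring

theorem permY_mul_quadMap {c₀ c₁ ε₀ ε₁ : ℝ} (h₀ : ε₀ * ε₀ = 1) (h₁ : ε₁ * ε₁ = 1) :
    permY * quadMap c₀ c₁ ε₀ ε₁ h₀ h₁ = quadMap c₀ c₁ ε₀ ε₁ h₀ h₁ * refl 0 c₀ := by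
  ext1 p
  rw [Equiv.Perm.mul_apply, Equiv.Perm.mul_apply, quadMap_apply, quadMap_apply, coe_permY, refl_apply]
  apply plane_ext <;> simp [reflY]; ring

theorem sign_mul_self {ε : ℝ} (h : ε = 1 ∨ ε = -1) : ε * ε = 1 := by
  rcases h with rfl | rfl <;> norm_num

theorem LocallyAmmann.mem_of_cover {T : TileSet} (h : LocallyAmmann T) {S : TileSet} (hS : S ⊆ T)
    (hc : ⋃₀ S = Set.univ) : S = T := by
  refine hS.antisymm fun u hu => ?_
  obtain ⟨z, hz⟩ := (h.tile u hu).nonempty_interior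
  obtain ⟨v, hv, hzv⟩ : z ∈ ⋃₀ S := hc ▸ Set.mem_univ z
  rwa [h.noOverlap.eq hu (hS hv) (h.tile v (hS hv)).regular hz hzv]

theorem cls_subset (T : TileSet) (t : Set Plane) : cls T t ⊆ T := fun _ hu => hu.1

theorem Wall.map_subset {T : TileSet} {t : Set Plane} {i : Fin 2} {c : ℝ} (hw : Wall T t i c) :
    mapTiles (refl i c) (cls T t) ⊆ T := by
  obtain ⟨-, y, -, -, -, e⟩ := hw
  rw [← e]
  exact cls_subset T y

theorem mem_refl_image {i : Fin 2} {c : ℝ} {A : Set Plane} {p : Plane} :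
    p ∈ refl i c '' A ↔ refl i c p ∈ A := by
  constructor
  · rintro ⟨q, hq, rfl⟩
    rwa [refl_refl]
  · exact fun h => ⟨_, h, refl_refl i c p⟩

theorem IsPlaneAmmann.isReflected_of_half {T : TileSet} (hT : IsPlaneAmmann T) {t : Set Plane}
    (ht : t ∈ T) (hA : AxisTile t) {i : Fin 2} {c : ℝ} (hw : Wall T t i c)
    (hno : ∀ i' c', Wall T t i' c' → i' = i) : IsReflected T := by
  have h := hT.hereditary
  have hl := h.locallyAmmann
  obtain ⟨ε, hε, hD⟩ := hT.region_half ht hA hw hno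
  have hε2 := sign_mul_self hε
  set W := halfMap i c ε hε2
  have hW : Scales 1 W := scales_halfMap hε2
  refine Or.inl ⟨mapTiles W (cls T t), (h.isNestedUnion_cls ht).map hW,
    ⟨hW.noOverlap (hl.noOverlap.mono (cls_subset T t)), ?_⟩, ?_⟩
  · rw [sUnion_mapTiles]
    ext q
    constructor
    · rintro ⟨p, hp, rfl⟩
      have := (hD p).mp hp
      rw [halfMap_apply]
      fin_cases i <;> simpa [upperHalf] using this
    · intro hq
      obtain ⟨p, rfl⟩ := W.surjective q
      refine ⟨p, (hD p).mpr ?_, rfl⟩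
      rw [halfMap_apply] at hq
      fin_cases i <;> simpa [upperHalf] using hq
  · have e : mapTiles W (cls T t) ∪ mapTiles reflX (mapTiles W (cls T t)) = mapTiles W T := by
      rw [← coe_permX, mapTiles_conj (permX_mul_halfMap hε2), ← mapTiles_union]
      congr 1
      refine hl.mem_of_cover (Set.union_subset (cls_subset T t) hw.map_subset) ?_
      rw [Set.sUnion_union, sUnion_mapTiles, Set.eq_univ_iff_forall]
      intro p
      rcases le_total 0 (ε * (p i - c)) with h1 | h1
      · exact Or.inl ((hD p).mpr h1)
      · refine Or.inr (mem_refl_image.mpr ((hD _).mpr ?_))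
        rw [refl_coord]
        linarith
    rw [e]
    exact hW.congruent_of_map T

/-- A point just beyond the horizontal border ray is separated from the quadrant by a wall. It
cannot be vertical, and since the region reaches it, it is the border line. This wall provides the
fourth quadrant in the case of two walls. -/
theorem Wall.across {T : TileSet} (hT : IsPlaneAmmann T) {y : Set Plane} (hy : y ∈ T)
    (hA : AxisTile y) {c₀ c₁ ε₀ ε₁ : ℝ} (h₀ : ε₀ = 1 ∨ ε₀ = -1) (h₁ : ε₁ = 1 ∨ ε₁ = -1)
    (hD : ∀ p, p ∈ ⋃₀ cls T y ↔ 0 ≤ ε₀ * (p 0 - c₀) ∧ 0 ≤ ε₁ * (p 1 - c₁)) : Wall T y 1 c₁ := by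
  have hq : pt (c₀ + ε₀) c₁ ∈ ⋃₀ cls T y := by
    rw [hD]
    rcases h₀ with rfl | rfl <;> simp
  have hp : pt (c₀ + ε₀) (c₁ - ε₁) ∉ ⋃₀ cls T y := by
    rw [hD]
    rintro ⟨-, h2⟩
    rcases h₁ with rfl | rfl <;> norm_num at h2
  obtain ⟨i, c, hw, hs⟩ := hT.exists_separating_wall hy hA hp
  obtain ⟨z, hz, hzc⟩ := hw.1
  have hz1 := ((hD z).mp hz).2
  fin_cases i
  · exfalso
    rcases hs with ⟨h1, h2⟩ | ⟨h1, h2⟩ <;> have h3 := h1 _ hq <;> simp at h2 h3 <;> linarith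
  · suffices c = c₁ from this ▸ hw
    simp only [Fin.mk_one] at hzc hs
    rw [hzc] at hz1
    rcases hs with ⟨h1, h2⟩ | ⟨h1, h2⟩ <;> have h3 := h1 _ hq <;> simp at h2 h3 <;>
      rcases h₁ with rfl | rfl <;> linarith

/-- The mirror image of the class in the vertical wall is again a class filling a quadrant. By
`Wall.across` the horizontal line is a wall of it too, so all four quadrants carry reflected copies.
-/
theorem IsPlaneAmmann.isReflected_of_quadrant {T : TileSet} (hT : IsPlaneAmmann T) {t : Set Plane}
    (ht : t ∈ T) (hA : AxisTile t) {c₀ c₁ : ℝ} (hw₀ : Wall T t 0 c₀) (hw₁ : Wall T t 1 c₁) :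
    IsReflected T := by
  have h := hT.hereditary
  have hl := h.locallyAmmann
  obtain ⟨ε₀, ε₁, hε₀, hε₁, hD⟩ := hT.region_quadrant ht hA hw₀ hw₁
  have h₀ := sign_mul_self hε₀
  have h₁ := sign_mul_self hε₁
  set W := quadMap c₀ c₁ ε₀ ε₁ h₀ h₁
  have hW : Scales 1 W := scales_quadMap h₀ h₁
  obtain ⟨-, y, hy, -, hAy, ey⟩ := hw₀
  have hwy : Wall T y 1 c₁ := by
    refine Wall.across hT hy hAy (c₀ := c₀) (ε₀ := -ε₀) (ε₁ := ε₁) ?_ hε₁ fun p => ?_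
    · rcases hε₀ with rfl | rfl <;> norm_num
    · rw [ey, sUnion_mapTiles, mem_refl_image, hD, refl_coord, refl_apply]
      simp only [pt_one, if_pos]
      rw [show ε₀ * (2 * c₀ - p 0 - c₀) = -ε₀ * (p 0 - c₀) by ring]
  have hsub := hwy.map_subset
  rw [ey] at hsub
  refine Or.inr ⟨mapTiles W (cls T t), (h.isNestedUnion_cls ht).map hW,
    ⟨hW.noOverlap (hl.noOverlap.mono (cls_subset T t)), ?_⟩, ?_⟩
  · rw [sUnion_mapTiles]
    ext q
    constructor
    · rintro ⟨p, hp, rfl⟩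
      have := (hD p).mp hp
      rw [quadMap_apply]
      simpa [quadrant] using this
    · intro hq
      obtain ⟨p, rfl⟩ := W.surjective q
      refine ⟨p, (hD p).mpr ?_, rfl⟩
      rw [quadMap_apply] at hq
      simpa [quadrant] using hq
  · have e : mapTiles W (cls T t) ∪ mapTiles reflX (mapTiles W (cls T t)) ∪
        mapTiles reflY (mapTiles W (cls T t)) ∪ mapTiles (reflX ∘ reflY) (mapTiles W (cls T t)) =
        mapTiles W T := by
      rw [← mapTiles_comp reflX reflY, ← coe_permX, ← coe_permY, mapTiles_conj (permX_mul_quadMap h₀ h₁),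
        mapTiles_conj (permY_mul_quadMap h₀ h₁), mapTiles_conj (permX_mul_quadMap h₀ h₁),
        ← mapTiles_union, ← mapTiles_union, ← mapTiles_union]
      congr 1
      refine hl.mem_of_cover (Set.union_subset (Set.union_subset (Set.union_subset (cls_subset T t)
        hw₁.map_subset) (ey ▸ cls_subset T y)) hsub) ?_
      simp only [Set.sUnion_union, sUnion_mapTiles]
      rw [Set.eq_univ_iff_forall]
      intro p
      simp only [Set.mem_union, mem_refl_image, hD, refl_apply]
      simp
      rcases le_total 0 (ε₀ * (p 0 - c₀)) with h1 | h1 <;>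
      rcases le_total 0 (ε₁ * (p 1 - c₁)) with h2 | h2
      · exact Or.inl (Or.inl (Or.inl ⟨h1, h2⟩))
      · exact Or.inl (Or.inl (Or.inr ⟨h1, by linarith⟩))
      · exact Or.inl (Or.inr ⟨by linarith, h2⟩)
      · exact Or.inr ⟨by linarith, by linarith⟩
    rw [e]
    exact hW.congruent_of_map T

theorem IsPlaneAmmann.cls_eq_self_of_axisTile {T : TileSet} (hT : IsPlaneAmmann T)
    (hr : ¬ IsReflected T) {t : Set Plane} (ht : t ∈ T) (hA : AxisTile t) : cls T t = T := by
  have hno : ∀ i c, ¬ Wall T t i c := by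
    intro i c hw
    by_cases hex : ∃ i' c', Wall T t i' c' ∧ i' ≠ i
    · obtain ⟨i', c', hw', hne⟩ := hex
      fin_cases i <;> fin_cases i' <;> simp at hne
      · exact hr (hT.isReflected_of_quadrant ht hA hw hw')
      · exact hr (hT.isReflected_of_quadrant ht hA hw' hw)
    · push Not at hex
      exact hr (hT.isReflected_of_half ht hA hw fun i' c' hw' => hex i' c' hw')
  refine hT.hereditary.locallyAmmann.mem_of_cover (cls_subset T t) (Set.eq_univ_iff_forall.mpr ?_)
  intro p
  by_contra hp
  obtain ⟨i, c, hw, -⟩ := hT.exists_separating_wall ht hA hp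
  exact hno i c hw

/-! ### Change of frame -/

theorem CongruentTilings.trans {S T R : TileSet} (h : CongruentTilings S T)
    (h' : CongruentTilings T R) : CongruentTilings S R := by
  obtain ⟨U, rfl⟩ := h
  obtain ⟨W, rfl⟩ := h'
  exact ⟨U.trans W, (mapTiles_comp W U S).symm⟩

theorem IsReflected.congr {S T : TileSet} (h : IsReflected S) (h' : CongruentTilings S T) :
    IsReflected T := by
  rcases h with ⟨R, h1, h2, h3⟩ | ⟨R, h1, h2, h3⟩
  · exact Or.inl ⟨R, h1, h2, h3.trans h'⟩
  · exact Or.inr ⟨R, h1, h2, h3.trans h'⟩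

theorem IsTile.map {t : Set Plane} (ht : IsTile t) {U : Equiv.Perm Plane} (hU : Scales 1 U) :
    IsTile (U '' t) := by
  rcases ht with h | h
  · obtain ⟨V, hV, rfl⟩ := isLarge_iff.mp h
    exact Or.inl (isLarge_iff.mpr ⟨U * V, by simpa using hU.mul hV, image_mul_G _ _ _⟩)
  · obtain ⟨V, hV, rfl⟩ := isSmall_iff.mp h
    exact Or.inr (isSmall_iff.mpr ⟨U * V, by simpa using hU.mul hV, image_mul_G _ _ _⟩)

theorem IsPlaneAmmann.map {T : TileSet} (hT : IsPlaneAmmann T) {U : Equiv.Perm Plane}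
    (hU : Scales 1 U) : IsPlaneAmmann (mapTiles U T) := by
  obtain ⟨⟨h1, h2⟩, h3, h4⟩ := hT
  refine ⟨⟨hU.noOverlap h1, ?_⟩, ?_, ?_⟩
  · rw [sUnion_mapTiles, h2, Set.image_univ, U.surjective.range_eq]
  · rintro _ ⟨t, ht, rfl⟩
    exact IsTile.map (h3 t ht) hU
  · intro F hF hFT
    have hU' : Scales 1 U⁻¹ := by simpa using hU.inv
    obtain ⟨n, P, hP, hc⟩ := h4 (mapTiles (U⁻¹ : Equiv.Perm Plane) F) (hF.image _) (by
      rintro _ ⟨t, ht, rfl⟩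
      obtain ⟨u, hu, rfl⟩ := hFT ht
      simpa [← Set.image_comp] using hu)
    refine ⟨n, P, hP, hc.trans ?_⟩
    exact hU'.congruent_of_map F

theorem desub_mapTiles {T : TileSet} (h : LocallyAmmann T) {U : Equiv.Perm Plane} (hU : Scales 1 U) :
    desub (mapTiles U T) = mapTiles (scS * U * scS⁻¹ : Equiv.Perm Plane) (desub T) := by
  have hU' := scales_conj' hU
  conv_lhs => rw [← h.substitute_desub]
  rw [← desub_substitute (S := mapTiles (scS * U * scS⁻¹ : Equiv.Perm Plane) (desub T)),
    substitute_mapTiles hU']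
  · congr 2
    group
  · rintro _ ⟨t, ht, rfl⟩
    exact IsTile.map (isTile_of_mem_desub ht) hU'
  · exact hU'.noOverlap h.noOverlap_desub

theorem Hereditary.desub_iterate_mapTiles {T : TileSet} (h : Hereditary T) {U : Equiv.Perm Plane}
    (hU : Scales 1 U) (j : ℕ) : ∃ U', Scales 1 U' ∧ U = scS⁻¹ ^ j * U' * scS ^ j ∧
      Ammann.desub^[j] (mapTiles U T) = mapTiles U' (Ammann.desub^[j] T) := by
  induction j with
  | zero => exact ⟨U, hU, by simp, rfl⟩
  | succ j ih =>
    obtain ⟨U', h1, h2, h3⟩ := ih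
    refine ⟨_, scales_conj' h1, ?_, ?_⟩
    · rw [h2, pow_succ, pow_succ']
      group
    · rw [Function.iterate_succ_apply', h3, desub_mapTiles (h j) h1, Function.iterate_succ_apply']

/-- Ancestors commute with isometries, up to conjugation at higher levels, so classes do not depend
on the frame. -/
theorem mem_cls_of_map {T : TileSet} (h : Hereditary T) {U : Equiv.Perm Plane} (hU : Scales 1 U)
    (h' : Hereditary (mapTiles U T)) {t u : Set Plane} (ht : t ∈ T) (hu : u ∈ T)
    (hc : U '' u ∈ cls (mapTiles U T) (U '' t)) : u ∈ cls T t := by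
  obtain ⟨-, j, hj⟩ := hc
  obtain ⟨U', h1, h2, h3⟩ := h.desub_iterate_mapTiles hU j
  have key : ∀ x ∈ T, anc j (mapTiles U T) (U '' x) = U' '' anc j T x := by
    intro x hx
    refine h'.anc_eq ?_ ?_
    · rw [h3]
      exact ⟨_, h.anc_mem hx j, rfl⟩
    · have : ({U' '' anc j T x} : TileSet) = mapTiles U' {anc j T x} := by
        rw [mapTiles, Set.image_singleton]
      rw [this, substitute_iterate_mapTiles h1, ← h2]
      exact ⟨_, h.mem_anc hx j, rfl⟩
  rw [key u hu, key t ht] at hj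
  exact ⟨hu, j, U'.injective.image_injective hj⟩

theorem IsPlaneAmmann.cls_eq_self {T : TileSet} (hT : IsPlaneAmmann T) (hr : ¬ IsReflected T)
    {t : Set Plane} (ht : t ∈ T) : cls T t = T := by
  -- An isometry brings `t` into the position of the standard large or small tile, which is parallel
  -- to the axes.
  obtain ⟨U, hU, hA⟩ : ∃ U, Scales 1 U ∧ AxisTile (U '' t) := by
    obtain ⟨b, V, hV, e⟩ := hT.hereditary.placement_anc ht 0
    change t = _ at e
    obtain ⟨Z, hZ, hZA⟩ : ∃ Z, Scales (ratio b) Z ∧ Axis Z := by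
      cases b
      · exact ⟨scS, scales_scS, axis_scS⟩
      · exact ⟨scS * scS, by simpa [ratio, sq] using scales_scS.mul scales_scS,
          axis_scS.mul axis_scS⟩
    refine ⟨Z * V⁻¹, ?_, _, Z, hZ, hZA, ?_⟩
    · have := hZ.mul hV.inv
      rwa [mul_inv_cancel₀ hV.1.ne'] at this
    · rw [e, ← image_mul_G, inv_mul_cancel_right]
  have hT1 := hT.map hU
  have hr1 : ¬ IsReflected (mapTiles U T) := fun h => hr (h.congr (hU.congruent_of_map T))
  have h1 := hT1.cls_eq_self_of_axisTile hr1 (t := U '' t) ⟨t, ht, rfl⟩ hA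
  refine (cls_subset T t).antisymm fun u hu => ?_
  refine mem_cls_of_map hT.hereditary hU hT1.hereditary ht hu ?_
  rw [h1]
  exact ⟨u, hu, rfl⟩

/-! ### Nested unions of supertiles form a single class -/

theorem mem_desub_iterate_of_copy {T : TileSet} (h : Hereditary T) {U : Equiv.Perm Plane}
    (hU : Scales 1 U) {n j : ℕ} (hs : mapTiles U (supertile (n + 1 + j)) ⊆ T) :
    ∃ U', Scales 1 U' ∧ mapTiles U' (supertile (n + 1)) ⊆ Ammann.desub^[j] T ∧
      mapTiles U (supertile (n + 1 + j)) = substitute^[j] (mapTiles U' (supertile (n + 1))) := by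
  induction j generalizing T U with
  | zero => exact ⟨U, hU, hs, rfl⟩
  | succ j ih =>
    have e := copy_succ hU (n + 1 + j)
    have hs' : mapTiles (scS * U * scS⁻¹ : Equiv.Perm Plane) (supertile (n + 1 + j)) ⊆
        Ammann.desub T := by
      have e2 : n + 1 + j = n + j + 1 := by omega
      rw [e2] at e ⊢
      refine subset_desub_of_copy h.locallyAmmann.noOverlap (scales_conj' hU) ?_
      rw [← e]
      exact (show n + j + 1 + 1 = n + 1 + (j + 1) by omega) ▸ hs
    obtain ⟨U', h1, h2, h3⟩ := ih h.desub (scales_conj' hU) hs'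
    refine ⟨U', h1, h2, ?_⟩
    rw [Function.iterate_succ_apply', ← h3, ← e]
    rfl

theorem supertile_subset_children {T : TileSet} {U : Equiv.Perm Plane}
    (hU : Scales 1 U) (hs : mapTiles U (supertile 1) ⊆ T) :
    ∃ P ∈ desub T, mapTiles U (supertile 1) ⊆ substitute {P} := by
  set V := scS * U * scS⁻¹ * scS
  have hV : Scales s V := by
    have := (scales_conj' hU).mul scales_scS
    rwa [one_mul] at this
  have e : mapTiles U (supertile 1) = substitute {V '' G} := by
    rw [copy_succ hU 0]
    congr 1
    rw [supertile, Function.iterate_zero_apply, mapTiles, Set.image_singleton, ← image_scS,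
      ← image_mul_G]
  rw [e] at hs ⊢
  have hp := pair_substitute hV (Set.mem_singleton (V '' G))
  refine ⟨V '' G, Or.inl ⟨_, ⟨hp.1, hs hp.2.1, hs hp.2.2⟩, by rw [mul_inv_cancel_left]⟩, subset_rfl⟩

/-- Two tiles lie in one member of the union, a copy of a supertile. By `subset_desub_of_copy` its
hierarchy agrees with that of `T`, so its single tile of level zero is a common ancestor. -/
theorem IsNestedUnion.cls_eq_self {T : TileSet} (hT : IsNestedUnion T) (h : Hereditary T)
    {t : Set Plane} (ht : t ∈ T) : cls T t = T := by
  refine (cls_subset T t).antisymm fun u hu => ?_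
  obtain ⟨m, P, hm, hP, hc, hTP⟩ := hT
  obtain ⟨n, hn⟩ := finite_subset_of_monotone hP (Set.toFinite {t, u}) (by
    rw [← hTP]; exact Set.insert_subset ht (Set.singleton_subset_iff.mpr hu))
  have hn' : ({t, u} : TileSet) ⊆ P (n + 1) := hn.trans (hP (by omega))
  obtain ⟨U, hU, e⟩ := (hc (n + 1)).exists_scales
  have hmn : n + 1 ≤ m (n + 1) := hm.id_le _
  obtain ⟨j, hj⟩ : ∃ j, m (n + 1) = 0 + 1 + j := ⟨m (n + 1) - 1, by omega⟩
  rw [hj] at e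
  obtain ⟨U', h1, h2, h3⟩ := mem_desub_iterate_of_copy h hU (n := 0) (j := j) (by
    rw [e, hTP]; exact Set.subset_iUnion P (n + 1))
  obtain ⟨Q, hQ, hQs⟩ := supertile_subset_children h1 h2
  have hsub : P (n + 1) ⊆ Ammann.substitute^[j + 1] {Q} := by
    rw [← e, h3, Function.iterate_succ_apply]
    exact substitute_iterate_mono j hQs
  have hQ' : Q ∈ Ammann.desub^[j + 1] T := by rwa [Function.iterate_succ_apply']
  refine ⟨hu, j + 1, ?_⟩
  rw [h.anc_eq hQ' (hsub (hn' (by simp))), h.anc_eq hQ' (hsub (hn' (by simp)))]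

/-- Any two tiles of an Ammann tiling have a common ancestor. -/
theorem IsAmmann.cls_eq_self {T : TileSet} (hT : IsAmmann T) {t : Set Plane} (ht : t ∈ T) :
    cls T t = T := by
  have h := hT.hereditary
  rcases hT with ⟨h1, hr⟩ | ⟨h1, -⟩
  · exact h1.cls_eq_self hr ht
  · exact h1.cls_eq_self h ht

/-! ### Codes and the tiling T(θ) -/

/-! ### Partners and amalgamation of distorted tilings -/

theorem exists_pullback {T S : TileSet} {h k : Plane ≃ₜ Plane} (e : mapTiles k S = mapTiles h T) :
    ∃ φ : Equiv.Perm Plane, mapTiles φ S = T ∧ ∀ a : Set Plane, h '' (φ '' a) = k '' a := by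
  refine ⟨k.toEquiv.trans h.symm.toEquiv, ?_, fun a => ?_⟩
  · change mapTiles (h.symm ∘ k) S = T
    rw [← mapTiles_comp, e, mapTiles_comp, h.symm_comp_self, mapTiles_id]
  · change h '' ((h.symm ∘ k) '' a) = k '' a
    rw [← Set.image_comp, ← Function.comp_assoc, h.self_comp_symm, Function.id_comp]

/-- Two Ammann tilings with the same distorted image differ by the bijection of `exists_pullback`,
which preserves partners. Any one preimage therefore suffices. -/
theorem IsAmmann.isPartner'_iff {T : TileSet} (hT : IsAmmann T) (h : Plane ≃ₜ Plane)
    {a' b' : Set Plane} : IsPartner' (mapTiles h T) a' b' ↔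
      ∃ a b, IsPartner T a b ∧ a' = h '' a ∧ b' = h '' b := by
  constructor
  · rintro ⟨S, k, a, b, hS, e, hp, rfl, rfl⟩
    obtain ⟨φ, hφ, himg⟩ := exists_pullback e
    exact ⟨φ '' a, φ '' b, (hS.locallyAmmann.isPartner_map hT.locallyAmmann hφ).mpr hp,
      (himg a).symm, (himg b).symm⟩
  · rintro ⟨a, b, hp, rfl, rfl⟩
    exact ⟨T, h, a, b, hT, rfl, hp, rfl, rfl⟩

theorem IsAmmann.exists_large {T : TileSet} (hT : IsAmmann T) (h : Plane ≃ₜ Plane) {t' : Set Plane}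
    (ht' : IsLargeTile' (mapTiles h T) t') : ∃ V, Scales s V ∧ V '' G ∈ T ∧ t' = h '' (V '' G) := by
  obtain ⟨S, k, t, hS, e, ht, hl, rfl⟩ := ht'
  obtain ⟨φ, hφ, himg⟩ := exists_pullback e
  have hmem : φ '' t ∈ T := hφ ▸ ⟨t, ht, rfl⟩
  rcases hT.locallyAmmann.tile _ hmem with h1 | h1
  · obtain ⟨V, hV, eV⟩ := isLarge_iff.mp h1
    exact ⟨V, hV, eV ▸ hmem, by rw [eV, himg]⟩
  · rw [hS.locallyAmmann.isSmall_map hT.locallyAmmann hφ ht] at h1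
    exact (hl.not_isSmall h1).elim

/-- The homeomorphism that carries the desubstitution of `T` to the amalgamation of `h(T)`. -/
def enlarge (h : Plane ≃ₜ Plane) : Plane ≃ₜ Plane := scales_scS.inv.toHomeo.trans h

theorem enlarge_image (h : Plane ≃ₜ Plane) (V : Equiv.Perm Plane) :
    enlarge h '' ((scS * V : Equiv.Perm Plane) '' G) = h '' (V '' G) := by
  change (h ∘ (scS⁻¹ : Equiv.Perm Plane)) '' _ = _
  rw [Set.image_comp, ← image_mul_G, inv_mul_cancel_left]

/-- Amalgamation leaves the tiles in place while `desub` shrinks them; `enlarge` compensates. The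
amalgamated tiling is thus again a distorted Ammann tiling, and `g` can be iterated. -/
theorem IsAmmann.amalgamate_map {T : TileSet} (hT : IsAmmann T) (h : Plane ≃ₜ Plane) :
    amalgamate (mapTiles h T) = mapTiles (enlarge h) (Ammann.desub T) := by
  have hl := hT.locallyAmmann
  have hinj : Function.Injective fun A : Set Plane => h '' A := Set.image_injective.mpr h.injective
  apply Set.Subset.antisymm
  · rintro u (⟨a, b, hp', rfl⟩ | ⟨⟨t, ht, rfl⟩, hno⟩)
    · obtain ⟨a, b, hp, rfl, rfl⟩ := (hT.isPartner'_iff h).mp hp'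
      obtain ⟨V, hV, rfl, rfl, ha, hb⟩ := isPartner_iff.mp hp
      refine ⟨_, Or.inl ⟨V, ⟨hV, hb, ha⟩, rfl⟩, ?_⟩
      change enlarge h '' _ = _
      rw [enlarge_image, ← Set.image_union, image_G_eq_union V, Set.union_comm]
    · rcases hl.tile t ht with h1 | h1
      · obtain ⟨V, hV, rfl⟩ := isLarge_iff.mp h1
        refine ⟨_, Or.inr ⟨V, hV, ht, ?_, rfl⟩, enlarge_image h V⟩
        rintro W hW rfl
        exact (hno _ _ ((hT.isPartner'_iff h).mpr ⟨_, _, hW.isPartner, rfl, rfl⟩)).2 rfl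
      · obtain ⟨b, hb⟩ := (hl.isSmall_iff_partner ht).mp h1
        exact ((hno _ _ ((hT.isPartner'_iff h).mpr ⟨_, _, hb, rfl, rfl⟩)).1 rfl).elim
  · rintro _ ⟨_, ⟨V, hV, rfl⟩ | ⟨V, hV, hVT, hno, rfl⟩, rfl⟩
    · refine Or.inl ⟨_, _, (hT.isPartner'_iff h).mpr ⟨_, _, hV.isPartner, rfl, rfl⟩, ?_⟩
      change enlarge h '' _ = _
      rw [enlarge_image, ← Set.image_union, image_G_eq_union V, Set.union_comm]
    · refine Or.inr ⟨⟨_, hVT, (enlarge_image h V).symm⟩, fun a b hp' => ?_⟩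
      obtain ⟨a, b, hp, rfl, rfl⟩ := (hT.isPartner'_iff h).mp hp'
      change enlarge h '' _ ≠ _ ∧ enlarge h '' _ ≠ _
      rw [enlarge_image]
      constructor
      · intro e
        exact (isLarge_iff.mpr ⟨V, hV, rfl⟩ : IsLarge (V '' G)).not_isSmall (hinj e ▸ hp.2.2.1)
      · intro e
        obtain ⟨W, hW, rfl, rfl, ha, hb⟩ := isPartner_iff.mp hp
        have hP : Pair T W := ⟨hW, hb, ha⟩
        exact hno W hP (hV.eq_of_image hP.scales_one (hinj e))

/-! ### The codes -/

theorem Pair.eq_of_f₁ {T : TileSet} {W : Equiv.Perm Plane} (hW : Pair T W) {a : Set Plane}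
    (h : IsPartner T a ((W * f₁ : Equiv.Perm Plane) '' G)) : a = (W * f₂ : Equiv.Perm Plane) '' G := by
  obtain ⟨X, hX, rfl, e, ha, hb⟩ := isPartner_iff.mp h
  have hX' : Scales s (X * f₁) := by simpa using hX.mul scales_f₁
  rw [mul_right_cancel (hW.scales_one.eq_of_image hX' e)]

theorem Pair.eq_of_f₂ {T : TileSet} {W : Equiv.Perm Plane} (hW : Pair T W) {b : Set Plane}
    (h : IsPartner T ((W * f₂ : Equiv.Perm Plane) '' G) b) : b = (W * f₁ : Equiv.Perm Plane) '' G := by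
  obtain ⟨X, hX, e, rfl, ha, hb⟩ := isPartner_iff.mp h
  have hX' : Scales (s ^ 2) (X * f₂) := by simpa using hX.mul scales_f₂
  rw [mul_right_cancel (hW.scales_two.eq_of_image hX' e)]

theorem IsAmmann.hasPartner_iff {T : TileSet} (hT : IsAmmann T) (h : Plane ≃ₜ Plane)
    {V : Equiv.Perm Plane} (hV : Scales s V) :
    HasPartner (mapTiles h T) (h '' (V '' G)) ↔ ∃ W, Pair T W ∧ V = W * f₁ := by
  constructor
  · rintro ⟨a, ha⟩
    obtain ⟨a, b, hp, rfl, e⟩ := (hT.isPartner'_iff h).mp ha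
    obtain ⟨W, hW, rfl, rfl, ha, hb⟩ := isPartner_iff.mp hp
    have hP : Pair T W := ⟨hW, hb, ha⟩
    exact ⟨W, hP, hV.eq_of_image hP.scales_one (Set.image_injective.mpr h.injective e)⟩
  · rintro ⟨W, hW, rfl⟩
    exact ⟨_, (hT.isPartner'_iff h).mpr ⟨_, _, hW.isPartner, rfl, rfl⟩⟩

theorem IsAmmann.union_partner_f₁ {T : TileSet} (hT : IsAmmann T) (h : Plane ≃ₜ Plane)
    {W : Equiv.Perm Plane} (hW : Pair T W) :
    h '' ((W * f₁ : Equiv.Perm Plane) '' G) ∪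
      ⋃₀ {a | IsPartner' (mapTiles h T) a (h '' ((W * f₁ : Equiv.Perm Plane) '' G))} =
    h '' (W '' G) := by
  have e : {a | IsPartner' (mapTiles h T) a (h '' ((W * f₁ : Equiv.Perm Plane) '' G))} =
      {h '' ((W * f₂ : Equiv.Perm Plane) '' G)} := by
    ext a
    constructor
    · intro ha
      obtain ⟨a, b, hp, rfl, e⟩ := (hT.isPartner'_iff h).mp ha
      rw [← Set.image_injective.mpr h.injective e] at hp
      rw [hW.eq_of_f₁ hp]
      rfl
    · rintro rfl
      exact (hT.isPartner'_iff h).mpr ⟨_, _, hW.isPartner, rfl, rfl⟩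
  rw [e, Set.sUnion_singleton, ← Set.image_union, image_G_eq_union W]

theorem IsAmmann.union_partner_f₂ {T : TileSet} (hT : IsAmmann T) (h : Plane ≃ₜ Plane)
    {W : Equiv.Perm Plane} (hW : Pair T W) :
    h '' ((W * f₂ : Equiv.Perm Plane) '' G) ∪
      ⋃₀ {b | IsPartner' (mapTiles h T) (h '' ((W * f₂ : Equiv.Perm Plane) '' G)) b} =
    h '' (W '' G) := by
  have e : {b | IsPartner' (mapTiles h T) (h '' ((W * f₂ : Equiv.Perm Plane) '' G)) b} =
      {h '' ((W * f₁ : Equiv.Perm Plane) '' G)} := by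
    ext b
    constructor
    · intro hb
      obtain ⟨a, b, hp, e, rfl⟩ := (hT.isPartner'_iff h).mp hb
      rw [← Set.image_injective.mpr h.injective e] at hp
      rw [hW.eq_of_f₂ hp]
      rfl
    · rintro rfl
      exact (hT.isPartner'_iff h).mpr ⟨_, _, hW.isPartner, rfl, rfl⟩
  rw [e, Set.sUnion_singleton, ← Set.image_union, image_G_eq_union W, Set.union_comm]

/-- The effect of `g` and of the digit on a distorted tiling, in terms of the undistorted one. -/
theorem IsAmmann.exists_g_eq {T : TileSet} (hT : IsAmmann T) (h : Plane ≃ₜ Plane)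
    {V : Equiv.Perm Plane} (hV : Scales s V) (hVT : V '' G ∈ T) {d : Digit}
    (hd : digit (mapTiles h T, h '' (V '' G)) = d) {V' : Equiv.Perm Plane}
    (hV' : V' = scS ^ d.val * V * (f d)⁻¹) : ∃ h' : Plane ≃ₜ Plane,
      g (mapTiles h T, h '' (V '' G)) = (mapTiles h' (Ammann.desub^[d.val] T), h' '' (V' '' G)) ∧
      Scales s V' ∧ V' '' G ∈ Ammann.desub^[d.val] T ∧ V '' G ∈ substitute^[d.val] {V' '' G} := by
  by_cases hp : HasPartner (mapTiles h T) (h '' (V '' G))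
  · have hd' : d = .one := by rw [← hd, digit, if_pos hp]
    obtain ⟨W, hW, rfl⟩ := (hT.hasPartner_iff h hV).mp hp
    have e : V' = scS * W := by rw [hV', hd']; simp [Digit.val, f, mul_assoc]
    rw [e, hd']
    refine ⟨enlarge h, ?_, hW.1.scS_mul, Or.inl ⟨W, hW, rfl⟩,
      mem_substitute.mpr (Or.inr ⟨scS * W, .one, hW.1.scS_mul, rfl, ?_⟩)⟩
    · rw [g, if_pos hp, hT.amalgamate_map, hT.union_partner_f₁ h hW, enlarge_image]
      rfl
    · rw [inv_mul_cancel_left]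
      rfl
  · have hd' : d = .two := by rw [← hd, digit, if_neg hp]
    rw [hT.hasPartner_iff h hV] at hp
    push Not at hp
    have hmem : (scS * V : Equiv.Perm Plane) '' G ∈ Ammann.desub T := Or.inr ⟨V, hV, hVT, hp, rfl⟩
    -- Without a partner in `T`, the tile becomes a small tile of `desub T`. There it has a partner,
    -- because `desub T` is an Ammann tiling.
    obtain ⟨X, hX, eX⟩ := hT.desub.locallyAmmann.partnered _ (scales_scS_mul hV) hmem
    have e : V' = scS * X := by
      rw [hV', hd']
      change scS ^ 2 * V * f₂⁻¹ = _
      rw [sq, mul_assoc scS, eX, mul_assoc, mul_inv_cancel_right]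
    have hp' : ¬ HasPartner (mapTiles h T) (h '' (V '' G)) := by
      rw [hT.hasPartner_iff h hV]
      push Not
      exact hp
    rw [e, hd']
    refine ⟨enlarge (enlarge h), ?_, hX.1.scS_mul, Or.inl ⟨X, hX, rfl⟩, ?_⟩
    · rw [g, if_neg hp']
      simp only
      rw [hT.amalgamate_map, hT.desub.amalgamate_map, ← enlarge_image h V, eX,
        hT.desub.union_partner_f₂ _ hX, enlarge_image]
      rfl
    · change _ ∈ substitute (substitute _)
      refine mem_substitute.mpr (Or.inl ⟨scS * V, scales_scS_mul hV, ?_, by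
        rw [inv_mul_cancel_left]⟩)
      refine mem_substitute.mpr (Or.inr ⟨scS * X, .two, hX.1.scS_mul, rfl, ?_⟩)
      rw [inv_mul_cancel_left, eX]
      rfl

theorem trunc_succ (θ : ℕ → Digit) (k : ℕ) : trunc θ (k + 1) = trunc θ k ++ [θ k] := by
  simp [trunc, List.range_succ]

theorem e_append (σ : List Digit) (d : Digit) : e (σ ++ [d]) = e σ + d.val := by simp [e]

theorem fPos_append (σ : List Digit) (d : Digit) : fPos (σ ++ [d]) = fPos σ * f d := by simp [fPos]

theorem fNeg_append (σ : List Digit) (d : Digit) : fNeg (σ ++ [d]) = fNeg σ * (f d)⁻¹ := by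
  simp [fNeg]

theorem Digit.one_le_val (d : Digit) : 1 ≤ d.val := by cases d <;> simp [Digit.val]

theorem le_e_trunc (θ : ℕ → Digit) (k : ℕ) : k ≤ e (trunc θ k) := by
  induction k with
  | zero => exact Nat.zero_le _
  | succ k ih =>
    rw [trunc_succ, e_append]
    have := (θ k).one_le_val
    omega

/-- A digit d climbs d levels and multiplies the placement by `scS ^ d` on the left and by the
inverse of its map on the right. The inverse maps accumulate to f_{-(θ|k)}. -/
theorem IsAmmann.exists_g_iterate_eq {T : TileSet} (hT : IsAmmann T) (h : Plane ≃ₜ Plane)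
    {V : Equiv.Perm Plane} (hV : Scales s V) (hVT : V '' G ∈ T) {θ : ℕ → Digit}
    (hθ : code (mapTiles h T) (h '' (V '' G)) = θ) (k : ℕ) {n : ℕ} (hn : n = e (trunc θ k))
    {V' : Equiv.Perm Plane} (hV' : V' = scS ^ n * V * fNeg (trunc θ k)) : ∃ h' : Plane ≃ₜ Plane,
      g^[k] (mapTiles h T, h '' (V '' G)) = (mapTiles h' (Ammann.desub^[n] T), h' '' (V' '' G)) ∧
      Scales s V' ∧ V' '' G ∈ Ammann.desub^[n] T ∧ V '' G ∈ substitute^[n] {V' '' G} := by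
  induction k generalizing n V' with
  | zero =>
    have h0 : n = 0 := hn
    have h1 : V' = V := by rw [hV', h0]; simp [trunc, fNeg]
    rw [h0, h1]
    exact ⟨h, rfl, hV, hVT, rfl⟩
  | succ k ih =>
    obtain ⟨k', h1, h2, h3, h4⟩ := ih rfl rfl
    set m := e (trunc θ k)
    set V₁ := scS ^ m * V * fNeg (trunc θ k)
    have hd : digit (mapTiles k' (Ammann.desub^[m] T), k' '' (V₁ '' G)) = θ k := by
      rw [← h1, ← hθ]
      rfl
    obtain ⟨h', h5, h6, h7, h8⟩ := (hT.desub_iterate m).exists_g_eq k' h2 h3 hd (V' := V') (by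
      rw [hV', hn, trunc_succ, e_append, fNeg_append, add_comm, pow_add]
      simp only [V₁, m, mul_assoc])
    have hnm : n = (θ k).val + m := by rw [hn, trunc_succ, e_append, add_comm]
    have hit : Ammann.desub^[n] T = Ammann.desub^[(θ k).val] (Ammann.desub^[m] T) := by
      rw [hnm, Function.iterate_add_apply]
    refine ⟨h', ?_, h6, hit ▸ h7, ?_⟩
    · rw [Function.iterate_succ_apply', h1, h5, hit]
    · rw [hnm, add_comm, Function.iterate_add_apply]
      exact substitute_iterate_mono m (Set.singleton_subset_iff.mpr h8) h4

/-! ### Strings and paths -/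

/-- The string omits the steps that merely turn a small tile into a large one. Digit 2 therefore
stands for two levels, and a path that ends at a small tile has completed only the first of them. -/
theorem exists_string {w : List Bool} (hw : valid w) : ∃ σ, place w = fPos σ ∧
    ((small w = false ∧ e σ = w.length) ∨
      (small w = true ∧ e σ = w.length + 1 ∧ σ.getLast? = some .two)) := by
  induction w with
  | nil => exact ⟨[], rfl, Or.inl ⟨rfl, rfl⟩⟩
  | cons i w ih =>
    obtain ⟨σ, hσ, ⟨h1, h2⟩ | ⟨h1, h2, h3⟩⟩ := ih hw.1
    · cases i
      · refine ⟨σ ++ [.one], ?_, Or.inl ⟨?_, ?_⟩⟩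
        · rw [place, hσ, h1, fPos_append]; rfl
        · rw [small, h1]; rfl
        · rw [e_append, h2]; rfl
      · refine ⟨σ ++ [.two], ?_, Or.inr ⟨?_, ?_, by simp⟩⟩
        · rw [place, hσ, h1, fPos_append]; rfl
        · rw [small, h1]; rfl
        · rw [e_append, h2]; rfl
    · cases i
      · refine ⟨σ, ?_, Or.inl ⟨?_, h2⟩⟩
        · rw [place, hσ, h1, step, mul_one]
        · rw [small, h1]; rfl
      · have := hw.2
        rw [h1] at this
        cases this

theorem exists_path (σ : List Digit) :
    ∃ w, valid w ∧ small w = false ∧ w.length = e σ ∧ place w = fPos σ := by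
  induction σ using List.reverseRecOn with
  | nil => exact ⟨[], trivial, rfl, rfl, rfl⟩
  | append_singleton σ d ih =>
    obtain ⟨w, h1, h2, h3, h4⟩ := ih
    rw [e_append, fPos_append, ← h3, ← h4]
    cases d
    · exact ⟨false :: w, ⟨h1, by rw [h2]; rfl⟩, by rw [small, h2]; rfl, rfl, by
        rw [place, h2]; rfl⟩
    · have h5 : small (true :: w) = true := by rw [small, h2]; rfl
      exact ⟨false :: true :: w, ⟨⟨h1, by rw [h2]; rfl⟩, by rw [h5]; rfl⟩, by rw [small, h5]; rfl,
        rfl, by rw [place, h5, step, mul_one, place, h2]; rfl⟩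

/-- This explains the condition in W(θ, k): the sum of the digits is n for large tiles, and n + 1
with last digit 2 for small ones. -/
theorem exists_path_iff {n : ℕ} (hn : 1 ≤ n) (Z : Equiv.Perm Plane) :
    (∃ w, valid w ∧ w.length = n ∧ Z = place w) ↔
      ∃ σ, (∃ l ∈ σ.getLast?, n ≤ e σ ∧ e σ < n + l.val) ∧ Z = fPos σ := by
  constructor
  · rintro ⟨w, hw, rfl, rfl⟩
    obtain ⟨σ, hσ, ⟨-, h2⟩ | ⟨-, h2, h3⟩⟩ := exists_string hw
    · refine ⟨σ, ?_, hσ⟩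
      have hne : σ ≠ [] := by
        rintro rfl
        rw [← h2] at hn
        cases hn
      have := (σ.getLast hne).one_le_val
      exact ⟨σ.getLast hne, List.getLast?_eq_some_getLast hne, h2.ge, by omega⟩
    · exact ⟨σ, ⟨.two, h3, by omega, by simp [Digit.val]; omega⟩, hσ⟩
  · rintro ⟨σ, ⟨l, hl, h1, h2⟩, rfl⟩
    -- Equality gives a large tile. Otherwise the last digit is 2 and the sum is n + 1, so the path
    -- stops after the first of the two levels of this digit.
    rcases h1.eq_or_lt with h3 | h3
    · obtain ⟨w, hw, -, hlen, hp⟩ := exists_path σ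
      exact ⟨w, hw, hlen.trans h3.symm, hp.symm⟩
    · obtain ⟨σ', rfl⟩ : ∃ σ', σ = σ' ++ [l] := by
        obtain ⟨hne, rfl⟩ := List.mem_getLast?_eq_getLast hl
        exact ⟨σ.dropLast, (List.dropLast_append_getLast hne).symm⟩
      rw [e_append] at h1 h2 h3
      cases l
      · simp only [Digit.val] at *
        omega
      · obtain ⟨w, hw, hs, hlen, hp⟩ := exists_path σ'
        refine ⟨true :: w, ⟨hw, by rw [hs]; rfl⟩, ?_, ?_⟩
        · simp only [Digit.val, List.length_cons] at *
          omega
        · rw [fPos_append, place, hp, hs]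
          rfl

/-- By `exists_path_iff` the strings of W(θ, k) name the same placements as the paths of length
e(θ|k). The factor `scS⁻¹` cancels the scaling by s in `thetaTile`. -/
theorem mapTiles_thetaPatch (V : Equiv.Perm Plane) (θ : ℕ → Digit) {k : ℕ} (hk : 1 ≤ k) :
    mapTiles (V * scS⁻¹ : Equiv.Perm Plane) (thetaPatch θ k) =
      level (V * fNeg (trunc θ k)) (e (trunc θ k)) := by
  have hn : 1 ≤ e (trunc θ k) := hk.trans (le_e_trunc θ k)
  have himg : ∀ σ, (V * scS⁻¹ : Equiv.Perm Plane) '' thetaTile θ k σ =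
      (V * fNeg (trunc θ k) * fPos σ : Equiv.Perm Plane) '' G := fun σ => by
    rw [thetaTile, ← image_scS, ← image_mul_G, ← image_mul_G]
    congr 2
    group
  ext t
  constructor
  · rintro ⟨_, ⟨σ, hσ, rfl⟩, rfl⟩
    obtain ⟨w, hw, hlen, hp⟩ := (exists_path_iff hn (fPos σ)).mpr ⟨σ, hσ, rfl⟩
    exact ⟨w, hw, hlen, by rw [tileAt, ← hp]; exact himg σ⟩
  · rintro ⟨w, hw, hlen, rfl⟩
    obtain ⟨σ, hσ, hp⟩ := (exists_path_iff hn (place w)).mp ⟨w, hw, hlen, rfl⟩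
    exact ⟨_, ⟨σ, hσ, rfl⟩, by rw [tileAt, hp]; exact himg σ⟩

/-- The code of a large tile determines the Ammann tiling up to congruence. -/
theorem IsAmmann.congruent_thetaTiling {T : TileSet} (hT : IsAmmann T) (h : Plane ≃ₜ Plane)
    {t' : Set Plane} (ht' : IsLargeTile' (mapTiles h T) t') :
    CongruentTilings (thetaTiling (code (mapTiles h T) t')) T := by
  obtain ⟨V, hV, hVT, rfl⟩ := hT.exists_large h ht'
  set θ := code (mapTiles h T) (h '' (V '' G)) with hθ
  have hH := hT.hereditary
  have hU : Scales 1 (V * scS⁻¹) := by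
    have := hV.mul scales_scS.inv
    rwa [mul_inv_cancel₀ s_ne] at this
  have hpatch : ∀ k, 1 ≤ k → mapTiles (V * scS⁻¹ : Equiv.Perm Plane) (thetaPatch θ k) =
      substitute^[e (trunc θ k)] {anc (e (trunc θ k)) T (V '' G)} := by
    intro k hk
    obtain ⟨-, -, h2, h3, h4⟩ := hT.exists_g_iterate_eq h hV hVT hθ.symm k rfl rfl
    rw [hH.anc_eq h3 h4, substitute_iterate h2, mapTiles_thetaPatch V θ hk]
    congr 1
    rw [mul_assoc, inv_pow, inv_mul_cancel_left]
  refine ⟨hU.toIso, ?_⟩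
  rw [Scales.coe_toIso]
  apply Set.Subset.antisymm
  · rintro _ ⟨u, ⟨k, hk, hu⟩, rfl⟩
    refine hH.iterate_subset (hH.anc_mem hVT (e (trunc θ k))) ?_
    rw [← hpatch k hk]
    exact ⟨u, hu, rfl⟩
  -- Since the class of the chosen tile is all of `T`, `u` descends from some `j`-th ancestor. The
  -- patches grow and k digits climb at least k levels; the index j + 1 is used because the patches
  -- start at 1.
  · intro u hu
    rw [← hT.cls_eq_self hVT, hH.mem_cls_iff hVT] at hu
    obtain ⟨j, hj⟩ := hu
    have hk : 1 ≤ j + 1 := by omega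
    have hle : j ≤ e (trunc θ (j + 1)) := (by omega : j ≤ j + 1).trans (le_e_trunc θ _)
    have := hH.monotone_patches hVT hle hj
    change u ∈ substitute^[_] _ at this
    rw [← hpatch _ hk] at this
    obtain ⟨v, hv, rfl⟩ := this
    exact ⟨v, ⟨j + 1, hk, hv⟩, rfl⟩

end Ammann

end

theorem theorem7p4 (T : Ammann.TileSet) (hT : Ammann.IsAmmann T)
    (h : Ammann.Plane ≃ₜ Ammann.Plane) (T' : Ammann.TileSet) (hT' : T' = Ammann.mapTiles h T)
    (t' : Set Ammann.Plane) (ht' : Ammann.IsLargeTile' T' t') :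
    Ammann.CongruentTilings (Ammann.thetaTiling (Ammann.code T' t')) T := by
  subst hT'
  exact hT.congruent_thetaTiling h ht'
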